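/- **Conventions.** All fields have characteristic $0$. A difference ring $(A,\sigma)$ is a commutative ring with a ring automorphism; $\mathrm{const}(A,\sigma)=\{c\in A\mid\sigma(c)=c\}$. Let $(F,\sigma)$ be a difference field with constant field $K=\mathrm{const}(F,\sigma)$. $S(K)$ is the ring of sequences $\mathbb N\to K$ modulo eventual equality, with the shift $S(a_0,a_1,\dots)=(a_1,a_2,\dots)$. For a difference ring extension $(A,\sigma)$ of $(F,\sigma)$, a *$K$-homomorphism* is a ring homomorphism $\tau:A\to S(K)$ with $\tau(\sigma(f))=S(\tau(f))$ for $f\in A$ and $\tau(c)=(c,c,\dots)$ for $c\in K$; a *$K$-embedding* is an injective one. An *evaluation function* for $(A,\sigma)$ is a map $\mathrm{ev}:A\times\mathbb N\to K$ such that, for all $f,g\in A$, $c\in K$, $l\in\mathbb Z$, the equations $\mathrm{ev}(c,n)=c$, $\mathrm{ev}(f+g,n)=\mathrm{ev}(f,n)+\mathrm{ev}(g,n)$, $\mathrm{ev}(fg,n)=\mathrm{ev}(f,n)\,\mathrm{ev}(g,n)$, $\mathrm{ev}(\sigma^l(f),n)=\mathrm{ev}(f,n+l)$ hold for all sufficiently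 large $n$; it is an evaluation function *for $\tau$* if $\tau(f)=(\mathrm{ev}(f,n))_{n\ge0}$ for all $f$. A map $L:A\to\mathbb N$ is an *$o^\sigma$-function* for $\mathrm{ev}$ if the second and third equation hold for $n\ge\max(L(f),L(g))$ and the fourth one for $n\ge L(f)+\max(0,-l)$; a map $Z:A\to\mathbb N$ is a *$z$-function* if $\mathrm{ev}(f,n)\ne0$ for all $f\ne0$ and $n\ge Z(f)$. $F\langle x_1\rangle\dots\langle x_s\rangle[z_1]\dots[z_l]$ denotes the ring of Laurent polynomials over $F$ in $x_1,\dots,x_s$ with adjoined generators $z_j$ subject to $z_j^{\lambda_j}=1$, $\lambda_j=\mathrm{ord}(z_j)>1$. An *$R\Pi$-extension* of $(F,\sigma)$ is here a difference ring extension of $(F,\sigma)$ of this form with $\sigma(x_i)/x_i\in F\langle x_1\rangle\dots\langle x_{i-1}\rangle^*$, $\sigma(z_j)/z_j\in K^*$, whose set of constants is $K$; then the $x_i$ are called $\Pi$-monomials and the $z_j$ $R$-monomials of order $\lambda_j$. A *$P$-extension* $(F\langle \hat x_1\rangle\dots\langle\hat x_r\rangle,\sigma)$ with $\hat\alpha_i=\sigma(\hat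 x_i)/\hat x_i\in F^*$ is a difference ring extension of $(F,\sigma)$ with no condition on its constants. Let $H_{(F,\sigma)}=\{\sigma(g)/g\mid g\in F^*\}$. $(F,\sigma)$ is *radical-stable* if for all $a\in F^*$ and $m\ge1$ with $a^m\in H_{(F,\sigma)}$ there is $\rho\in K^*$ with $\rho^m=1$ and $a\rho\in H_{(F,\sigma)}$. Let $M((\alpha_1,\dots,\alpha_r),F)=\{n\in\mathbb Z^r\mid\alpha_1^{n_1}\cdots\alpha_r^{n_r}\in H_{(F,\sigma)}\}$, a submodule of $\mathbb Z^r$. The *largest divisor* of a nonzero submodule of $\mathbb Z^r$ of rank $u$ is the last entry $d_u$ of the Smith normal form $\mathrm{diag}(d_1,\dots,d_u)\in\mathbb Z^{u\times r}$, $d_1\mid\dots\mid d_u$, $d_i>0$, of a matrix whose rows form a basis of the submodule. **Theorem.** Let $(F,\sigma)$ be a radical-stable difference field with $K=\mathrm{const}(F,\sigma)$ and let $\bar\tau:F\to S(K)$ be a $K$-embedding. Let $(F\langle\hat x_1\rangle\dots\langle\hat x_r\rangle,\sigma)$ be a $P$-extension of $(F,\sigma)$ with $\hat\alpha_i=\sigma(\hat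 x_i)/\hat x_i\in F^*$, and let $\hat\tau:F\langle\hat x_1\rangle\dots\langle\hat x_r\rangle\to S(K)$ be a $K$-homomorphism with $\hat\tau|_F=\bar\tau$. Assume $M((\hat\alpha_1,\dots,\hat\alpha_r),F)\ne\{0\}$, and let $u\ge1$ be its rank and $d\ge1$ its largest divisor. Then there are an $R\Pi$-extension $(H,\sigma)$ of $(F,\sigma)$, a $K$-embedding $\tau':H\to S(K)$ with $\tau'|_F=\bar\tau$ and a surjective difference ring homomorphism $\hat\lambda:F\langle\hat x_1\rangle\dots\langle\hat x_r\rangle\to H$ such that: 1. $\tau'(\hat\lambda(f))=\hat\tau(f)$ for all $f$. 2. If $d=1$, then $H=F\langle x_{u+1}\rangle\dots\langle x_r\rangle$ with $r-u$ $\Pi$-monomials $x_i$, $\alpha_i=\sigma(x_i)/x_i\in F^*$. Otherwise $H=F\langle x_{u+1}\rangle\dots\langle x_r\rangle[z]$ with such $\Pi$-monomials $x_i$ and one $R$-monomial $z$ of order $d$ with $\rho=\sigma(z)/z\in K^*$. 3. $\hat\lambda|_F=\mathrm{id}$ and $\hat\lambda(\hat x_i)=\gamma_i\,z^{o_i}x_{u+1}^{m_{i,u+1}}\cdots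 x_r^{m_{i,r}}$ for $1\le i\le r$, with $\gamma_i\in F^*$, $0\le o_i<d$, $m_{i,j}\in\mathbb Z$ (without the factor $z^{o_i}$ if $d=1$). 4. For every evaluation function $\overline{\mathrm{ev}}$ for $\bar\tau$ there are $\kappa_i\in K^*$ and integers $l_i\ge1$ ($u+1\le i\le r$) and an evaluation function $\mathrm{ev}'$ for $\tau'$ with $\mathrm{ev}'|_{F\times\mathbb N}=\overline{\mathrm{ev}}$, $\mathrm{ev}'(x_i,n)=\kappa_i\prod_{k=l_i}^n\overline{\mathrm{ev}}(\alpha_i,k-1)$ and, if $d>1$, $\mathrm{ev}'(z,n)=\rho^n$. 5. Let $(H',\sigma)$ with $H'=F\langle y_1\rangle\dots\langle y_e\rangle[z_1]\dots[z_l]$ be any $R\Pi$-extension of $(F,\sigma)$ with a $K$-embedding $\tau'':H'\to S(K)$, $\tau''|_F=\bar\tau$, and a (not necessarily surjective) difference ring homomorphism $\lambda':F\langle\hat x_1\rangle\dots\langle\hat x_r\rangle\to H'$ with $\tau''\circ\lambda'=\hat\tau$. Then $r-u\le e$; and if $d>1$, then $l\ge1$ and $d\le\mathrm{lcm}(\mathrm{ord}(z_1),\dots,\mathrm{ord}(z_l))=\mathrm{ord}(z_1)\cdots\mathrm{ord}(z_l)$.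 6. There is a matrix $(n_{i,j})\in\mathbb Z^{u\times r}$ with linearly independent rows such that $g_i:=\hat\lambda(\hat x_1^{n_{i,1}}\cdots\hat x_r^{n_{i,r}})\in F^*$ for $1\le i\le u$ and $$\ker\hat\tau=\ker\hat\lambda=\big\langle \hat x_1^{n_{1,1}}\cdots\hat x_r^{n_{1,r}}-g_1,\dots,\hat x_1^{n_{u,1}}\cdots\hat x_r^{n_{u,r}}-g_u\big\rangle .$$ Moreover, suppose that the elements of $F$ are encoded such that addition, multiplication, inversion and $\sigma$ are computable; that $\bar\tau$ has a computable evaluation function $\overline{\mathrm{ev}}$ with a computable $o^\sigma$-function and a computable $z$-function; that for $w\in F^*$ one can compute, if it exists, a $g\in F^*$ with $\sigma(g)=w\,g$; and that for $\alpha_1,\dots,\alpha_r\in F^*$ one can compute a $\mathbb Z$-basis of $M((\alpha_1,\dots,\alpha_r),F)$. Then there is an algorithm that, given $\hat\alpha_1,\dots,\hat\alpha_r\in F^*$ with $M((\hat\alpha_1,\dots,\hat\alpha_r),F)\neq\{0\}$, and programs for an evaluation function $\widehat{\mathrm{ev}}$ for $\hat\tau$ with $\widehat{\mathrm{ev}}|_{F\times\mathbb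 N}=\overline{\mathrm{ev}}$ and for an $o^\sigma$-function for $\widehat{\mathrm{ev}}$, computes $d$, the $\alpha_i$ and (if $d>1$) $\rho$ defining $(H,\sigma)$; the $\gamma_i,o_i,m_{i,j}$ defining $\hat\lambda$; the $n_{i,j},g_i$ defining the generators of $\ker\hat\lambda$; and the $\kappa_i,l_i$ defining $\mathrm{ev}'$ for $\overline{\mathrm{ev}}$, such that all of the above holds. -/

import Mathlib

noncomputable section

namespace DiffRing

open Filter

variable {F : Type*} [Field F]

/-! ### Difference fields -/

/-- The constant field `K = {c ∈ F | σ c = c}` of a difference field `(F, σ)`. -/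
def constField (σ : RingAut F) : Subfield F where
  carrier := {c | σ c = c}
  mul_mem' {a b} ha hb := by
    simp only [Set.mem_ofPred_eq] at ha hb ⊢
    rw [map_mul, ha, hb]
  one_mem' := map_one σ
  add_mem' {a b} ha hb := by
    simp only [Set.mem_ofPred_eq] at ha hb ⊢
    rw [map_add, ha, hb]
  zero_mem' := map_zero σ
  neg_mem' {a} ha := by
    simp only [Set.mem_ofPred_eq] at ha ⊢
    rw [map_neg, ha]
  inv_mem' a ha := by
    simp only [Set.mem_ofPred_eq] at ha ⊢
    rw [map_inv₀, ha]

/-- `a` lies in the homogeneous group `{σ g / g | g ∈ F*}`. -/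
def InHomogGroup (σ : RingAut F) (a : F) : Prop :=
  ∃ g : F, g ≠ 0 ∧ a = σ g / g

/-- Radical-stability: if `a ^ m` (with `m > 0`) is in the homogeneous group, then so is `a * ρ`
for some `m`-th root of unity `ρ` in the constant field. -/
def RadicalStable (σ : RingAut F) : Prop :=
  ∀ (a : F) (m : ℕ), a ≠ 0 → 0 < m → InHomogGroup σ (a ^ m) →
    ∃ ρ ∈ constField σ, ρ ^ m = 1 ∧ InHomogGroup σ (a * ρ)

/-- The `ℤ`-module `M((α₁,…,α_r), F)` of all exponent vectors `n` such that
`α₁^{n₁} ⋯ α_r^{n_r} = σ g / g` for some `g ∈ F*`. -/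
def multRel (σ : RingAut F) {r : ℕ} (α : Fin r → Fˣ) : Submodule ℤ (Fin r → ℤ) where
  carrier := {n | InHomogGroup σ (∏ i, (α i : F) ^ n i)}
  add_mem' {a b} := by
    rintro ⟨g, hg, hga⟩ ⟨h, hh, hhb⟩
    refine ⟨g * h, mul_ne_zero hg hh, ?_⟩
    have : (∏ i, (α i : F) ^ (a + b) i) = (∏ i, (α i : F) ^ a i) * ∏ i, (α i : F) ^ b i := by
      rw [← Finset.prod_mul_distrib]
      exact Finset.prod_congr rfl fun i _ => zpow_add₀ (α i).ne_zero _ _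
    rw [this, hga, hhb, map_mul, div_mul_div_comm]
  zero_mem' := ⟨1, one_ne_zero, by simp⟩
  smul_mem' c n := by
    rintro ⟨g, hg, hgn⟩
    refine ⟨g ^ c, zpow_ne_zero _ hg, ?_⟩
    have : (∏ i, (α i : F) ^ (c • n) i) = (∏ i, (α i : F) ^ n i) ^ c := by
      rw [← Finset.prod_zpow]
      refine Finset.prod_congr rfl fun i _ => ?_
      rw [← zpow_mul, Pi.smul_apply, smul_eq_mul, mul_comm]
    rw [this, hgn, map_zpow₀, div_zpow]

/-! ### Largest divisor of a submodule of `ℤ^r` -/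

/-- The rows of the integer matrix `Z` form a `ℤ`-basis of `V`. -/
def RowsAreBasis {r u : ℕ} (V : Submodule ℤ (Fin r → ℤ)) (Z : Matrix (Fin u) (Fin r) ℤ) : Prop :=
  LinearIndependent ℤ Z.row ∧ Submodule.span ℤ (Set.range Z.row) = V

/-- `d` is the largest divisor of the nonzero submodule `V` of `ℤ^r`: for a matrix `Z` whose rows
are a basis of `V`, there are matrices `A`, `B`, invertible over `ℤ`, such that `A Z B` is the
diagonal matrix (Smith normal form) with positive entries `d₁ ∣ d₂ ∣ ⋯ ∣ d_u`, and `d = d_u`. -/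
def IsLargestDivisor {r : ℕ} (V : Submodule ℤ (Fin r → ℤ)) (d : ℕ) : Prop :=
  ∃ (u : ℕ) (hu : 0 < u) (Z : Matrix (Fin u) (Fin r) ℤ) (A : Matrix (Fin u) (Fin u) ℤ)
    (B : Matrix (Fin r) (Fin r) ℤ) (δ : Fin u → ℕ),
    RowsAreBasis V Z ∧ IsUnit A.det ∧ IsUnit B.det ∧
    A * Z * B = Matrix.of (fun (i : Fin u) (j : Fin r) => if i.val = j.val then (δ i : ℤ) else 0) ∧
    (∀ i, 0 < δ i) ∧ (∀ i j, i ≤ j → δ i ∣ δ j) ∧ d = δ ⟨u - 1, Nat.sub_lt hu one_pos⟩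

/-! ### The ring of sequences, `K`-homomorphisms and evaluation functions -/

/-- Sequences with entries in `K`, where two sequences are identified if they agree from some
point on. -/
abbrev SeqRing (K : Type*) : Type _ := Germ (atTop : Filter ℕ) K

/-- The class of a sequence. -/
def toSeq {K : Type*} (a : ℕ → K) : SeqRing K := (a : Germ (atTop : Filter ℕ) K)

/-- The shift `(a₀, a₁, a₂, …) ↦ (a₁, a₂, …)`. -/
def shift {K : Type*} (a : SeqRing K) : SeqRing K :=
  a.compTendsto (fun n => n + 1) (tendsto_add_atTop_nat 1)

/-- `τ : A → S(K)` is a `K`-homomorphism from the difference ring `(A, σA)`, an extension of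
`(F, σ)`, where `K` is the constant field of `(F, σ)`. -/
structure IsKHom (σ : RingAut F) {A : Type*} [CommRing A] [Algebra F A] (σA : RingAut A)
    (τ : A →+* SeqRing (constField σ)) : Prop where
  map_shift : ∀ a, τ (σA a) = shift (τ a)
  map_const : ∀ c : constField σ, τ (algebraMap F A c) = toSeq (fun _ => c)

/-- An injective `K`-homomorphism. -/
structure IsKEmbedding (σ : RingAut F) {A : Type*} [CommRing A] [Algebra F A] (σA : RingAut A)
    (τ : A →+* SeqRing (constField σ)) : Prop extends IsKHom σ σA τ where
  injective : Function.Injective τ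

/-- `ev` is an evaluation function for the difference ring `(A, σA)`, with values in the constant
field of `(F, σ)`. -/
structure IsEvalFun (σ : RingAut F) {A : Type*} [CommRing A] [Algebra F A] (σA : RingAut A)
    (ev : A → ℕ → constField σ) : Prop where
  map_const : ∀ c : constField σ, ∃ N : ℕ, ∀ n : ℕ, N ≤ n → ev (algebraMap F A c) n = c
  map_add : ∀ f g, ∃ N : ℕ, ∀ n : ℕ, N ≤ n → ev (f + g) n = ev f n + ev g n
  map_mul : ∀ f g, ∃ N : ℕ, ∀ n : ℕ, N ≤ n → ev (f * g) n = ev f n * ev g n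
  map_shift : ∀ (f : A) (k : ℤ), ∃ N : ℕ, ∀ n : ℕ, N ≤ n → ∀ m : ℕ, (m : ℤ) = n + k →
    ev ((σA ^ k) f) n = ev f m

/-- `L` is an `o^σ`-function for `ev`: it provides explicit bounds from which on `ev` is compatible
with the ring operations and with the automorphism. -/
structure IsOSigmaFun {K A : Type*} [Field K] [CommRing A] (σA : RingAut A)
    (ev : A → ℕ → K) (L : A → ℕ) : Prop where
  map_add : ∀ f g, ∀ n : ℕ, max (L f) (L g) ≤ n → ev (f + g) n = ev f n + ev g n
  map_mul : ∀ f g, ∀ n : ℕ, max (L f) (L g) ≤ n → ev (f * g) n = ev f n * ev g n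
  map_shift : ∀ (f : A) (k : ℤ), ∀ n : ℕ, L f + (-k).toNat ≤ n → ∀ m : ℕ, (m : ℤ) = n + k →
    ev ((σA ^ k) f) n = ev f m

/-- `Z` is a `z`-function for `ev`. -/
def IsZFun {K A : Type*} [Field K] [CommRing A] (ev : A → ℕ → K) (Z : A → ℕ) : Prop :=
  ∀ f, f ≠ 0 → ∀ n : ℕ, Z f ≤ n → ev f n ≠ 0

/-- `ev` is an evaluation function for `τ`, i.e. `τ f = (ev(f, n))_{n ≥ 0}` for all `f`. -/
def Represents {K A : Type*} [Field K] [CommRing A] (ev : A → ℕ → K)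
    (τ : A →+* SeqRing K) : Prop :=
  ∀ f, τ f = toSeq (ev f)

/-! ### `AP`-extensions -/

/-- The ring `F⟨x₁⟩…⟨x_s⟩[z₁]…[z_l]` with Laurent polynomial variables `x_i` and with generators
`z_j` subject to `z_j ^ ord j = 1`: the group algebra over `F` of the group
`ℤ^s × ∏_j ℤ/(ord j)` of exponents. -/
abbrev APRing (F : Type*) [Field F] (s : ℕ) {l : ℕ} (ord : Fin l → ℕ) : Type _ :=
  AddMonoidAlgebra F ((Fin s → ℤ) × ((j : Fin l) → ZMod (ord j)))

/-- The Laurent polynomial ring `F⟨x₁⟩…⟨x_r⟩`. -/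
abbrev PRing (F : Type*) [Field F] (r : ℕ) : Type _ :=
  APRing F r (fun j : Fin 0 => j.elim0)

section Generators

variable {s l : ℕ} {ord : Fin l → ℕ}

/-- The monomial `x₁^{m₁} ⋯ x_s^{m_s} z₁^{k₁} ⋯ z_l^{k_l}`. -/
def mono (m : Fin s → ℤ) (k : (j : Fin l) → ZMod (ord j)) : APRing F s ord :=
  AddMonoidAlgebra.single (m, k) 1

/-- The Laurent variable `x_i`. -/
def xVar (i : Fin s) : APRing F s ord := mono (Pi.single i 1) 0

/-- The generator `z_j` of multiplicative order `ord j`. -/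
def zVar (j : Fin l) : APRing F s ord := mono 0 (Pi.single j 1)

/-- The subring `F⟨x₁⟩…⟨x_{i-1}⟩` of `F⟨x₁⟩…⟨x_s⟩[z₁]…[z_l]`. -/
def lowerRing (F : Type*) [Field F] {s l : ℕ} (ord : Fin l → ℕ) (i : Fin s) :
    Subalgebra F (APRing F s ord) :=
  Algebra.adjoin F {f | ∃ m : Fin s → ℤ, (∀ j, i ≤ j → m j = 0) ∧ f = mono m 0}

/-- `(F⟨x₁⟩…⟨x_s⟩[z₁]…[z_l], σE)` is a (nested) `AP`-extension of `(F, σ)` in which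
`σE x_i / x_i` is a unit of `F⟨x₁⟩…⟨x_{i-1}⟩` and the `z_j` are `A`-monomials with
`σE z_j / z_j` in the constant field of `(F, σ)`. -/
structure IsAPExtension (σ : RingAut F) (σE : RingAut (APRing F s ord)) : Prop where
  one_lt_ord : ∀ j, 1 < ord j
  map_base : ∀ f : F, σE (algebraMap F _ f) = algebraMap F _ (σ f)
  map_x : ∀ i, ∃ β ∈ lowerRing F ord i, ∃ β' ∈ lowerRing F ord i,
    β * β' = 1 ∧ σE (xVar i) = β * xVar i
  map_z : ∀ j, ∃ ρ : constField σ, ρ ≠ 0 ∧ σE (zVar j) = algebraMap F _ ρ * zVar j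

/-- An `RΠ`-extension (of the same shape): an `AP`-extension with the same constants. -/
structure IsRPiExtension (σ : RingAut F) (σE : RingAut (APRing F s ord)) : Prop
    extends IsAPExtension σ σE where
  const_eq : ∀ f, σE f = f ↔ ∃ c ∈ constField σ, algebraMap F _ c = f

end Generators

/-- `(F⟨x₁⟩…⟨x_r⟩, σE)` is the `P`-extension of `(F, σ)` with `σE x_i = α_i x_i`, `α_i ∈ F*`. -/
structure IsPExtension (σ : RingAut F) {r : ℕ} (α : Fin r → Fˣ) (σE : RingAut (PRing F r)) :
    Prop where
  map_base : ∀ f : F, σE (algebraMap F _ f) = algebraMap F _ (σ f)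
  map_x : ∀ i, σE (xVar i) = algebraMap F _ (α i : F) * xVar i

/-! ### Representation of products -/

/-- The ring `F⟨x₁⟩…⟨x_s⟩` if `d = 1`, and `F⟨x₁⟩…⟨x_s⟩[z]` with `z ^ d = 1` otherwise. -/
abbrev HRing (F : Type*) [Field F] (s d : ℕ) : Type _ :=
  APRing F s (fun _ : Fin (if d = 1 then 0 else 1) => d)

/-- The finite data describing the difference ring `(H, σ)`, the homomorphism `λ` and the generators
of its kernel. The value of `ρ` is relevant for `d > 1` only. -/
structure RepData (F : Type*) [Field F] (r s u : ℕ) where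
  /-- the order of the `R`-monomial (`d = 1`: there is none) -/
  d : ℕ
  /-- the quotients `σ x_i / x_i` of the `Π`-monomials -/
  α : Fin s → Fˣ
  /-- the quotient `σ z / z` of the `R`-monomial -/
  ρ : F
  /-- the coefficient of `λ x̂_i` -/
  γ : Fin r → Fˣ
  /-- the exponent of `z` in `λ x̂_i` -/
  o : Fin r → ℕ
  /-- the exponents of the `Π`-monomials in `λ x̂_i` -/
  m : Fin r → Fin s → ℤ
  /-- the exponent vectors of the generators `x̂^{n_i} - g_i` of the kernel -/
  n : Fin u → Fin r → ℤ
  /-- the elements `g_i` in the generators `x̂^{n_i} - g_i` of the kernel -/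
  g : Fin u → Fˣ

/-- No representation in an `RΠ`-extension needs fewer than `s` many `Π`-monomials, and, if `d > 1`,
every such representation needs at least one `R`-monomial and the product of the orders of its
`R`-monomials (which equals their least common multiple) is at least `d`. -/
def IsMinimal (σ : RingAut F) (τ₀ : F →+* SeqRing (constField σ)) {r : ℕ}
    (σE : RingAut (PRing F r)) (τE : PRing F r →+* SeqRing (constField σ)) (s d : ℕ) : Prop :=
  ∀ (e l : ℕ) (ord : Fin l → ℕ) (σ' : RingAut (APRing F e ord))
    (τ' : APRing F e ord →+* SeqRing (constField σ)) (lam' : PRing F r →+* APRing F e ord),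
    IsRPiExtension σ σ' →
    IsKEmbedding σ σ' τ' → (∀ f : F, τ' (algebraMap F _ f) = τ₀ f) →
    (∀ f, lam' (σE f) = σ' (lam' f)) → (∀ f, τ' (lam' f) = τE f) →
    s ≤ e ∧
    (1 < d → 1 ≤ l ∧ d ≤ Finset.univ.lcm ord ∧ Finset.univ.lcm ord = ∏ j, ord j)

/-- `(H, σH)` with the embedding `τH` and the map `lam`, all described by the data `D`, is an
optimal representation of the `P`-extension `(F⟨x̂₁⟩…⟨x̂_r⟩, σE)` with its `K`-homomorphism `τE`. -/
structure IsOptimalRep (σ : RingAut F) (τ₀ : F →+* SeqRing (constField σ)) {r : ℕ}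
    (σE : RingAut (PRing F r)) (τE : PRing F r →+* SeqRing (constField σ)) {s u : ℕ}
    (D : RepData F r s u) (σH : RingAut (HRing F s D.d))
    (τH : HRing F s D.d →+* SeqRing (constField σ)) (lam : PRing F r →+* HRing F s D.d) :
    Prop where
  rpi : IsRPiExtension σ σH
  embedding : IsKEmbedding σ σH τH
  embedding_base : ∀ f : F, τH (algebraMap F _ f) = τ₀ f
  lam_shift : ∀ f, lam (σE f) = σH (lam f)
  lam_surjective : Function.Surjective lam
  commutes : ∀ f, τH (lam f) = τE f
  map_x : ∀ i, σH (xVar i) = algebraMap F _ (D.α i : F) * xVar i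
  map_z : ∀ j, D.ρ ∈ constField σ ∧ σH (zVar j) = algebraMap F _ D.ρ * zVar j
  lam_base : ∀ f : F, lam (algebraMap F _ f) = algebraMap F _ f
  o_lt : ∀ i, D.o i < D.d
  lam_x : ∀ i, lam (xVar i) =
    algebraMap F _ (D.γ i : F) * mono (D.m i) (fun _ => (D.o i : ZMod D.d))
  minimal : IsMinimal σ τ₀ σE τE s D.d
  n_indep : LinearIndependent ℤ D.n
  lam_n : ∀ i, lam (mono (D.n i) 0) = algebraMap F _ (D.g i : F)
  ker_eq : RingHom.ker τE = RingHom.ker lam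
  ker_lam : RingHom.ker lam =
    Ideal.span (Set.range fun i => mono (D.n i) 0 - algebraMap F _ (D.g i : F))

/-- Given an evaluation function `ev` of the ground field, there is an evaluation function of `τH`
that extends `ev`, with `x_i ↦ κ_i ∏_{k = l_i}^n ev(α_i, k - 1)` and `z ↦ ρ^n`. -/
def HasProductEval (σ : RingAut F) (ev : F → ℕ → constField σ) {r s u : ℕ}
    (D : RepData F r s u) (σH : RingAut (HRing F s D.d))
    (τH : HRing F s D.d →+* SeqRing (constField σ)) (κ : Fin s → constField σ)
    (l : Fin s → ℕ) : Prop :=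
  (∀ i, κ i ≠ 0) ∧ (∀ i, 1 ≤ l i) ∧
  ∃ ev' : HRing F s D.d → ℕ → constField σ,
    IsEvalFun σ σH ev' ∧ Represents ev' τH ∧
    (∀ (f : F) (n : ℕ), ev' (algebraMap F _ f) n = ev f n) ∧
    (∀ i n, ev' (xVar i) n = κ i * ∏ k ∈ Finset.Icc (l i) n, ev (D.α i : F) (k - 1)) ∧
    (∀ j n, (ev' (zVar j) n : F) = D.ρ ^ n)

/-! ### Algorithmic aspects -/

/-- The required algorithmic properties of the ground field `(F, σ)` with the embedding `τ₀`: the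
field operations and `σ` are computable; `ev` is a computable evaluation function for `τ₀`
with a computable `o^σ`-function `L` and a computable `z`-function `Z`; one can solve the equations
`σ g = w g`; one can compute bases of the modules `M((α₁,…,α_r), F)`. -/
structure IsAlgorithmic [Primcodable F] (σ : RingAut F) (τ₀ : F →+* SeqRing (constField σ))
    (ev : F → ℕ → constField σ) (L Z : F → ℕ) : Prop where
  add : Computable₂ fun a b : F => a + b
  mul : Computable₂ fun a b : F => a * b
  inv : Computable fun a : F => a⁻¹
  aut : Computable fun a : F => σ a
  evalFun : IsEvalFun σ σ ev
  represents : Represents ev τ₀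
  ev_computable : Computable₂ fun (f : F) (n : ℕ) => (ev f n : F)
  oFun : IsOSigmaFun σ ev L
  oFun_computable : Computable L
  zFun : IsZFun ev Z
  zFun_computable : Computable Z
  radicalStable : RadicalStable σ
  solve : ∃ sol : F → Option F, Computable sol ∧ ∀ w, w ≠ 0 →
    (∀ g, sol w = some g → g ≠ 0 ∧ σ g = w * g) ∧
    (sol w = none → ¬ ∃ g, g ≠ 0 ∧ σ g = w * g)
  basis : ∃ bas : List F → List (List ℤ), Computable bas ∧ ∀ (r : ℕ) (α : Fin r → Fˣ),
    ∃ (u : ℕ) (Z : Matrix (Fin u) (Fin r) ℤ), RowsAreBasis (multRel σ α) Z ∧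
      bas (List.ofFn fun i => (α i : F)) = List.ofFn fun i => List.ofFn (Z i)

/-- The element of `F⟨x₁⟩…⟨x_r⟩` that is given by a list of terms (coefficient and list of
exponents). -/
def ofTerms (F : Type*) [Field F] (r : ℕ) (t : List (F × List ℤ)) : PRing F r :=
  (t.map fun p => algebraMap F _ p.1 * mono (fun i : Fin r => p.2.getD i 0) 0).sum

/-- The program `c` computes the function `f`. -/
def Computes {α β : Type*} [Primcodable α] [Primcodable β] (c : Nat.Partrec.Code) (f : α → β) :
    Prop :=
  ∀ a, c.eval (Encodable.encode a) = Part.some (Encodable.encode (f a))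

/-- The pair of programs `(c₁, c₂)` computes the evaluation function `ev` on `F⟨x₁⟩…⟨x_r⟩` and the
function `L`, where the elements of this ring are given by lists of terms. -/
def ComputesEval [Primcodable F] (σ : RingAut F) {r : ℕ} (ev : PRing F r → ℕ → constField σ)
    (L : PRing F r → ℕ) (c₁ c₂ : Nat.Partrec.Code) : Prop :=
  Computes c₁ (fun p : List (F × List ℤ) × ℕ => (ev (ofTerms F r p.1) p.2 : F)) ∧
  Computes c₂ (fun t : List (F × List ℤ) => L (ofTerms F r t))

/-- Input of the algorithm: the quotients `σ x̂_i / x̂_i`, and programs for an evaluation function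
and an `o^σ`-function on `F⟨x̂₁⟩…⟨x̂_r⟩`. -/
abbrev AlgInput (F : Type*) : Type _ := List F × Nat.Partrec.Code × Nat.Partrec.Code

/-- Output of the algorithm: `d`, `ρ`, the `α_i`, the triples `(γ_i, o_i, (m_{ij})_j)`, the pairs
`((n_{ij})_j, g_i)` and the pairs `(κ_i, l_i)`. -/
abbrev AlgOutput (F : Type*) : Type _ :=
  ℕ × F × List F × List (F × ℕ × List ℤ) × List (List ℤ × F) × List (F × ℕ)

/-- The explicit description of the data as an output of an algorithm. -/
def RepData.toOutput {r s u : ℕ} (D : RepData F r s u) (κ : Fin s → F) (l : Fin s → ℕ) :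
    AlgOutput F :=
  (D.d, D.ρ, List.ofFn (fun i => (D.α i : F)),
    List.ofFn (fun i => ((D.γ i : F), D.o i, List.ofFn (D.m i))),
    List.ofFn (fun i => (List.ofFn (D.n i), (D.g i : F))),
    List.ofFn (fun i => (κ i, l i)))

end DiffRing

end

/-!
Write `V` for the lattice of relations `M((α₁, …, αᵣ), F)`. Changing the monomial basis of the
`P`-extension according to a Smith normal form of `V`, one may assume that `V` is spanned by
`δᵢ eᵢ`, `i ≤ u`, with `δᵤ = d`. The monomials with index `i > u` then satisfy no relation and
become `Π`-monomials. For `i ≤ u` the multiplier of the `i`-th monomial has its `δᵢ`-th power of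
the form `σ g / g`, so by radical stability it has this form itself up to a root of unity; since
`δᵢ ∣ d`, the powers of a single root of unity `ρ` of order `d` are enough for all `i ≤ u`.

Both rings are group algebras over `F`, of `ℤ^r` and of `ℤ^(r-u) × ℤ/d`, and `λ` is induced, up to
twisting by elements of `F`, by a homomorphism of these groups; hence its kernel is generated by the
binomials coming from generators of the kernel on exponents. The map `τ'` is injective since, up to
a unit, a kernel element of minimal support is a constant. A competing representation has to solve
the same first order equations, and in an `RΠ`-extension the solutions are monomials: comparing
exponents gives the minimality of `r - u` and of `d`.

The data of the representation form a finite certificate. A solution of a first order recurrence is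
determined by one value, so the conditions on a certificate can be tested by evaluation at a single
sufficiently large point, and the algorithm is an unbounded search for a certificate that passes.
-/

noncomputable section

namespace DiffRing

open Filter AddMonoidAlgebra Nat.Partrec

/-! ### Power products -/

section PowerProducts

variable {ι κ G H : Type*} [Fintype ι] [CommGroup G] [CommGroup H]

/-- The power product `∏ i, a i ^ n i` of a family `a` in a commutative group, with integer
exponents `n`. -/
def zpowProd (a : ι → G) (n : ι → ℤ) : G := ∏ i, a i ^ n i

theorem zpowProd_zero (a : ι → G) : zpowProd a 0 = 1 := by simp [zpowProd]

theorem zpowProd_add (a : ι → G) (m n : ι → ℤ) :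
    zpowProd a (m + n) = zpowProd a m * zpowProd a n := by
  simp [zpowProd, zpow_add, Finset.prod_mul_distrib]

theorem zpowProd_mul (a b : ι → G) (n : ι → ℤ) :
    zpowProd (a * b) n = zpowProd a n * zpowProd b n := by
  simp [zpowProd, mul_zpow, Finset.prod_mul_distrib]

theorem zpowProd_zsmul (a : ι → G) (c : ℤ) (n : ι → ℤ) :
    zpowProd a (c • n) = zpowProd a n ^ c := by
  simp only [zpowProd, Pi.smul_apply, smul_eq_mul, ← Finset.prod_zpow]
  exact Finset.prod_congr rfl fun i _ => by rw [mul_comm, zpow_mul]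

theorem zpowProd_single [DecidableEq ι] (a : ι → G) (i : ι) (c : ℤ) :
    zpowProd a (Pi.single i c) = a i ^ c := by
  rw [zpowProd, Finset.prod_eq_single i] <;> simp +contextual

theorem map_zpowProd (f : G →* H) (a : ι → G) (n : ι → ℤ) :
    f (zpowProd a n) = zpowProd (fun i => f (a i)) n := by
  simp [zpowProd]

/-- The power products of `a`, as a homomorphism in the exponent vector. -/
def zpowProdHom (a : ι → G) : Multiplicative (ι → ℤ) →* G where
  toFun n := zpowProd a n.toAdd
  map_one' := zpowProd_zero a
  map_mul' m n := zpowProd_add a m.toAdd n.toAdd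

theorem hom_vecMul (f : Multiplicative (κ → ℤ) →* G) (y : ι → ℤ) (C : Matrix ι κ ℤ) :
    f (.ofAdd (Matrix.vecMul y C)) = zpowProd (fun i => f (.ofAdd (C i))) y := by
  rw [Matrix.vecMul_eq_sum, ofAdd_sum, map_prod]
  exact Finset.prod_congr rfl fun i _ => by rw [ofAdd_zsmul, map_zpow]

theorem zpowProd_vecMul [Fintype κ] (a : κ → G) (y : ι → ℤ) (C : Matrix ι κ ℤ) :
    zpowProd a (Matrix.vecMul y C) = zpowProd (fun i => zpowProd a (C i)) y :=
  hom_vecMul (zpowProdHom a) y C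

theorem hom_eq_zpowProd [DecidableEq ι] (f : Multiplicative (ι → ℤ) →* G) (n : ι → ℤ) :
    f (.ofAdd n) = zpowProd (fun i => f (.ofAdd (Pi.single i 1))) n := by
  have hone (i : ι) : (1 : Matrix ι ι ℤ) i = Pi.single i 1 :=
    funext fun _ => Matrix.one_eq_pi_single
  simpa only [Matrix.vecMul_one, hone] using hom_vecMul f n (1 : Matrix ι ι ℤ)

theorem zpowProd_pow_const (x : G) (c : ι → ℕ) (n : ι → ℤ) :
    zpowProd (fun i => x ^ c i) n = x ^ ∑ i, n i * c i := by
  simp only [zpowProd, ← zpow_natCast, ← zpow_mul, mul_comm (n _)]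
  exact (map_sum (zmultiplesHom (Additive G) (.ofMul x)) _ _).symm

theorem val_zpowProd {R : Type*} [Field R] (a : ι → Rˣ) (n : ι → ℤ) :
    ((zpowProd a n : Rˣ) : R) = ∏ i, (a i : R) ^ n i := by
  simp [zpowProd]

end PowerProducts

section Units

/-- The action of a ring automorphism on units. -/
abbrev onUnits {A : Type*} [Semiring A] (σ : RingAut A) : Aˣ →* Aˣ :=
  Units.map (σ : A →* A)

theorem mem_multRel {F : Type*} [Field F] {σ : RingAut F} {r : ℕ} {α : Fin r → Fˣ}
    {n : Fin r → ℤ} : n ∈ multRel σ α ↔ ∃ g : Fˣ, onUnits σ g = zpowProd α n * g := by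
  change InHomogGroup σ _ ↔ _
  rw [← val_zpowProd]
  constructor
  · rintro ⟨g, hg, h⟩
    exact ⟨Units.mk0 g hg, Units.ext (by simp [h, hg])⟩
  · rintro ⟨g, h⟩
    refine ⟨g, g.ne_zero, eq_div_of_mul_eq g.ne_zero ?_⟩
    simpa using (congrArg Units.val h).symm

end Units

/-! ### Monomial homomorphisms between group algebras -/

section MonomialHom

variable {R S G H : Type*} [CommRing R] [CommRing S] [AddCommGroup G] [AddCommGroup H]

/-- The ring homomorphism `c g ↦ φ(c) γ(g) π(g)` between group algebras. -/
def monomialHom (φ : R →+* S) (π : G →+ H) (γ : Multiplicative G →* Sˣ) :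
    AddMonoidAlgebra R G →+* AddMonoidAlgebra S H :=
  liftNCRingHom ((algebraMap S (AddMonoidAlgebra S H)).comp φ)
    { toFun := fun g => single (π g.toAdd) (γ g : S)
      map_one' := by simp [AddMonoidAlgebra.one_def]
      map_mul' := fun a b => by simp [AddMonoidAlgebra.single_mul_single] }
    fun _ _ => Commute.all _ _

theorem monomialHom_single (φ : R →+* S) (π : G →+ H) (γ : Multiplicative G →* Sˣ) (g : G)
    (c : R) : monomialHom φ π γ (single g c) = single (π g) (φ c * γ (.ofAdd g)) := by
  simp [monomialHom, liftNCRingHom_single, AddMonoidAlgebra.single_mul_single]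

theorem monomialHom_surjective {φ : R →+* S} (hφ : Function.Surjective φ) {π : G →+ H}
    (hπ : Function.Surjective π) (γ : Multiplicative G →* Sˣ) :
    Function.Surjective (monomialHom φ π γ) := by
  intro f
  induction f using AddMonoidAlgebra.induction_linear with
  | zero => exact ⟨0, map_zero _⟩
  | add a b ha hb =>
    obtain ⟨x, rfl⟩ := ha
    obtain ⟨y, rfl⟩ := hb
    exact ⟨x + y, map_add _ _ _⟩
  | single h c =>
    obtain ⟨g, rfl⟩ := hπ h
    obtain ⟨c', hc'⟩ := hφ (c * ((γ (.ofAdd g))⁻¹ : Sˣ))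
    exact ⟨single g c', by rw [monomialHom_single, hc', Units.inv_mul_cancel_right]⟩

theorem coeff_monomialHom (φ : R →+* S) {π : G →+ H} (hπ : Function.Injective π)
    (γ : Multiplicative G →* Sˣ) (f : AddMonoidAlgebra R G) (g : G) :
    (monomialHom φ π γ f).coeff (π g) = φ (f.coeff g) * γ (.ofAdd g) := by
  induction f using AddMonoidAlgebra.induction_linear with
  | zero => simp
  | add a b ha hb => simp [ha, hb, add_mul]
  | single h c =>
    rw [monomialHom_single]
    by_cases hg : h = g
    · subst hg; simp
    · simp [hg, hπ.ne hg]

theorem exists_eq_monomialHom_of_closure {φ : R →+* S} {π : G →+ H}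
    {f : AddMonoidAlgebra R G →+* AddMonoidAlgebra S H}
    (hφ : ∀ c, f (single 0 c) = single 0 (φ c)) {X : Set G} (hX : AddSubgroup.closure X = ⊤)
    (hf : ∀ g ∈ X, ∃ c : Sˣ, f (single g 1) = single (π g) (c : S)) :
    ∃ γ, f = monomialHom φ π γ := by
  have hmul (a b : G) : f (single (a + b) 1) = f (single a 1) * f (single b 1) := by
    rw [← map_mul, AddMonoidAlgebra.single_mul_single, one_mul]
  have hzero : f (single 0 1) = single (π 0) ((1 : Sˣ) : S) := by simp [hφ]
  have hall (g : G) : ∃ c : Sˣ, f (single g 1) = single (π g) (c : S) := by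
    induction (hX ▸ AddSubgroup.mem_top g : g ∈ AddSubgroup.closure X) using
      AddSubgroup.closure_induction with
    | mem g hg => exact hf g hg
    | zero => exact ⟨1, hzero⟩
    | add a b _ _ ha hb =>
      obtain ⟨c, hc⟩ := ha
      obtain ⟨c', hc'⟩ := hb
      exact ⟨c * c', by simp [hmul, hc, hc', AddMonoidAlgebra.single_mul_single]⟩
    | neg a _ ha =>
      obtain ⟨c, hc⟩ := ha
      refine ⟨c⁻¹, left_inv_eq_right_inv (a := f (single a 1)) ?_ ?_⟩
      · rw [← hmul, neg_add_cancel, hzero, map_zero, Units.val_one, AddMonoidAlgebra.one_def]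
      · simp [hc, AddMonoidAlgebra.single_mul_single, AddMonoidAlgebra.one_def]
  choose γ hγ using hall
  obtain ⟨χ, hχ⟩ : ∃ χ : Multiplicative G →* Sˣ,
      ∀ g, f (single g 1) = single (π g) (χ (.ofAdd g) : S) := by
    refine ⟨{ toFun g := γ g.toAdd, map_one' := ?_, map_mul' a b := ?_ }, hγ⟩
    · exact Units.ext (single_right_injective ((hγ 0).symm.trans hzero))
    · have h := hmul a.toAdd b.toAdd
      rw [hγ, hγ, hγ, AddMonoidAlgebra.single_mul_single, ← map_add π] at h
      exact Units.ext (single_right_injective h)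
  refine ⟨χ, AddMonoidAlgebra.ringHom_ext (fun c => ?_) fun g => ?_⟩
  · rw [hφ, monomialHom_single, map_zero, ofAdd_zero, map_one, Units.val_one, mul_one]
  · simp [hχ, monomialHom_single]

/-- The automorphism `c g ↦ σ(c) χ(g) g` of a group algebra. -/
def twist (σ : RingAut R) (χ : Multiplicative G →* Rˣ) : RingAut (AddMonoidAlgebra R G) :=
  RingEquiv.ofRingHom (monomialHom (σ : R →+* R) (AddMonoidHom.id G) χ)
    (monomialHom ((σ⁻¹ : RingAut R) : R →+* R) (AddMonoidHom.id G) ((onUnits σ⁻¹).comp χ⁻¹))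
    (AddMonoidAlgebra.ringHom_ext (by simp [monomialHom_single])
      (by simp [monomialHom_single, ← Units.val_mul]))
    (AddMonoidAlgebra.ringHom_ext (by simp [monomialHom_single])
      (by simp [monomialHom_single, ← map_mul, ← Units.val_mul]))

theorem twist_single (σ : RingAut R) (χ : Multiplicative G →* Rˣ) (g : G) (c : R) :
    twist σ χ (single g c) = single g (σ c * χ (.ofAdd g)) :=
  monomialHom_single _ _ _ g c

theorem coeff_twist (σ : RingAut R) (χ : Multiplicative G →* Rˣ) (f : AddMonoidAlgebra R G)
    (g : G) : (twist σ χ f).coeff g = σ (f.coeff g) * χ (.ofAdd g) :=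
  coeff_monomialHom (σ : R →+* R) (π := AddMonoidHom.id G) Function.injective_id χ f g

/-- The exponents `g` of the binomials `g - γ(g)` that lie in an ideal of a group algebra. -/
def binomialSubgroup (I : Ideal (AddMonoidAlgebra R G)) (γ : Multiplicative G →* Rˣ) :
    AddSubgroup G where
  carrier := {g | single g 1 - single 0 (γ (.ofAdd g) : R) ∈ I}
  zero_mem' := by simp
  add_mem' {a b} ha hb := by
    have h := I.add_mem (I.mul_mem_left (single a 1) hb)
      (I.mul_mem_left (single 0 (γ (.ofAdd b) : R)) ha)
    simpa [mul_sub, AddMonoidAlgebra.single_mul_single, mul_comm] using h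
  neg_mem' {a} ha := by
    have h := I.neg_mem (I.mul_mem_left (single (-a) ((γ (.ofAdd a))⁻¹ : Rˣ)) ha)
    rw [mul_sub, AddMonoidAlgebra.single_mul_single, AddMonoidAlgebra.single_mul_single,
      neg_sub] at h
    simpa using h

theorem ker_monomialHom_le {π : G →+ H} {γ : Multiplicative G →* Rˣ}
    {I : Ideal (AddMonoidAlgebra R G)} (hI : π.ker ≤ binomialSubgroup I γ) :
    RingHom.ker (monomialHom (RingHom.id R) π γ) ≤ I := by
  let rep (w : H) : G := Function.invFun π w
  have hrep (v : G) : π (rep (π v)) = π v := Function.invFun_eq ⟨v, rfl⟩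
  let lift : AddMonoidAlgebra R H →+ AddMonoidAlgebra R G :=
    liftNC (algebraMap R (AddMonoidAlgebra R G)).toAddMonoidHom fun w =>
      single (rep w.toAdd) (((γ (.ofAdd (rep w.toAdd)))⁻¹ : Rˣ) : R)
  have sub_lift_mem (f : AddMonoidAlgebra R G) :
      f - lift (monomialHom (RingHom.id R) π γ f) ∈ I := by
    induction f using AddMonoidAlgebra.induction_linear with
    | zero => simp
    | add a b ha hb =>
      rw [map_add, map_add, add_sub_add_comm]
      exact I.add_mem ha hb
    | single v c =>
      have hker : v - rep (π v) ∈ π.ker := by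
        rw [AddMonoidHom.mem_ker, map_sub, hrep, sub_self]
      have h := I.mul_mem_left (single (rep (π v)) c) (hI hker)
      simpa [lift, monomialHom_single, liftNC_single, mul_sub,
        AddMonoidAlgebra.single_mul_single, mul_assoc, div_eq_mul_inv] using h
  intro f hf
  simpa [RingHom.mem_ker.mp hf] using sub_lift_mem f

theorem ker_monomialHom_eq_span {π : G →+ H} (γ : Multiplicative G →* Rˣ) {ι : Type*}
    {n : ι → G} (hn : AddSubgroup.closure (Set.range n) = π.ker) :
    RingHom.ker (monomialHom (RingHom.id R) π γ) =
      Ideal.span (Set.range fun i => single (n i) (1 : R) -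
        algebraMap R (AddMonoidAlgebra R G) (γ (.ofAdd (n i)))) := by
  refine le_antisymm (ker_monomialHom_le ?_) (Ideal.span_le.mpr ?_)
  · rw [← hn, AddSubgroup.closure_le]
    rintro _ ⟨i, rfl⟩
    exact Ideal.subset_span ⟨i, by simp⟩
  · rintro _ ⟨i, rfl⟩
    have : π (n i) = 0 := AddMonoidHom.mem_ker.mp (hn ▸ AddSubgroup.subset_closure ⟨i, rfl⟩)
    simp [monomialHom_single, this]

end MonomialHom

section Simple

variable {F G : Type*} [Field F] [AddCommGroup G] {σ : RingAut F} {χ : Multiplicative G →* Fˣ}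

theorem support_twist_sub_self_ssubset {f : AddMonoidAlgebra F G} (h0 : f.coeff 0 = 1) :
    (twist σ χ f - f).coeff.support ⊂ f.coeff.support := by
  refine ⟨fun g hg => ?_, fun hsub => ?_⟩
  · simp only [coeff_sub, Finsupp.mem_support_iff, Finsupp.sub_apply, coeff_twist] at hg ⊢
    intro hg'
    simp [hg'] at hg
  · have : (0 : G) ∈ (twist σ χ f - f).coeff.support := hsub (by simp [h0])
    simp [coeff_twist, h0] at this

-- An element of the kernel with minimal support can be normalised to have coefficient `1` at `0`;
-- then `σ f - f` has smaller support, so `f` is a constant.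
theorem injective_of_constants_scalar {R : Type*} [Ring R] [Nontrivial R]
    (hconst : ∀ f, twist σ χ f = f → ∃ c, f = algebraMap F _ c)
    (τ : AddMonoidAlgebra F G →+* R) (hτ : ∀ f, τ f = 0 → τ (twist σ χ f) = 0) :
    Function.Injective τ := by
  rw [injective_iff_map_eq_zero]
  intro f
  induction hN : f.coeff.support.card using Nat.strong_induction_on generalizing f with
  | _ N ih =>
  intro hf
  by_contra hne
  obtain ⟨g, hg⟩ : f.coeff.support.Nonempty := by
    rw [Finsupp.support_nonempty_iff]; simpa using hne
  have hg' : f.coeff g ≠ 0 := Finsupp.mem_support_iff.mp hg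
  set f₁ := single (-g) (f.coeff g)⁻¹ * f with hf₁
  have hτ₁ : τ f₁ = 0 := by rw [hf₁, map_mul, hf, mul_zero]
  have h0 : f₁.coeff 0 = 1 := by simp [hf₁, coeff_single_mul_apply, hg']
  have hcard : f₁.coeff.support.card = N := by
    rw [hf₁, support_coeff_single_mul _ _ (by simp [hg']), Finset.card_map, hN]
  have hlt := hcard ▸ Finset.card_lt_card (support_twist_sub_self_ssubset (σ := σ) (χ := χ) h0)
  have hz := ih _ hlt _ rfl (by rw [map_sub, hτ _ hτ₁, hτ₁, sub_zero])
  obtain ⟨c, hc⟩ := hconst f₁ (sub_eq_zero.mp hz)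
  have hc0 : c = 0 :=
    (τ.comp (algebraMap F (AddMonoidAlgebra F G))).injective (by simpa [hc] using hτ₁)
  simp [hc, hc0] at h0

end Simple

/-! ### Sequences -/

section Sequences

variable {K : Type*}

theorem toSeq_eq_iff {a b : ℕ → K} : toSeq a = toSeq b ↔ ∃ N, ∀ n, N ≤ n → a n = b n := by
  rw [toSeq, toSeq, Germ.coe_eq, EventuallyEq, eventually_atTop]

theorem exists_toSeq (x : SeqRing K) : ∃ a, x = toSeq a := by
  induction x using Quotient.inductionOn with
  | _ a => exact ⟨a, rfl⟩

theorem shift_toSeq (a : ℕ → K) : shift (toSeq a) = toSeq fun n => a (n + 1) := rfl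

theorem exists_const_of_shift_eq {x : SeqRing K} (h : shift x = x) :
    ∃ c : K, x = toSeq fun _ => c := by
  obtain ⟨a, rfl⟩ := exists_toSeq x
  rw [shift_toSeq, toSeq_eq_iff] at h
  obtain ⟨N, hN⟩ := h
  refine ⟨a N, toSeq_eq_iff.mpr ⟨N, fun n hn => ?_⟩⟩
  induction n, hn using Nat.le_induction with
  | base => rfl
  | succ n hn ih => rw [hN n hn, ih]

theorem toSeq_add [Add K] (a b : ℕ → K) : toSeq (fun n => a n + b n) = toSeq a + toSeq b := rfl

theorem toSeq_mul [Mul K] (a b : ℕ → K) : toSeq (fun n => a n * b n) = toSeq a * toSeq b := rfl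

/-- The shift, as a homomorphism of multiplicative monoids. -/
def shiftHom [Monoid K] : SeqRing K →* SeqRing K where
  toFun := shift
  map_one' := rfl
  map_mul' x y := by
    obtain ⟨a, rfl⟩ := exists_toSeq x
    obtain ⟨b, rfl⟩ := exists_toSeq y
    rfl

/-- The unit of the ring of sequences that is given by a sequence of units. -/
def unitSeq [Monoid K] : (ℕ → Kˣ) →* (SeqRing K)ˣ :=
  (Units.map (Germ.coeMulHom atTop : (ℕ → K) →* SeqRing K)).comp
    (MulEquiv.piUnits (ι := ℕ) (M := fun _ => K)).symm.toMonoidHom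

/-- The geometric sequence `n ↦ ρ ^ n`, as a homomorphism in `ρ`. -/
def geomSeq [CommMonoid K] : Kˣ →* (SeqRing K)ˣ :=
  unitSeq.comp (MonoidHom.pi fun n => powMonoidHom n)

/-- The constant sequence `n ↦ c`, as a homomorphism in `c`. -/
def constSeq [Monoid K] : Kˣ →* (SeqRing K)ˣ := unitSeq.comp (Pi.constMonoidHom ℕ Kˣ)

theorem val_geomSeq [CommMonoid K] (ρ : Kˣ) :
    (geomSeq ρ : SeqRing K) = toSeq fun n => (ρ : K) ^ n := rfl

theorem shift_geomSeq [CommMonoid K] (ρ : Kˣ) :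
    Units.map shiftHom (geomSeq ρ) = constSeq ρ * geomSeq ρ := by
  refine Units.ext ?_
  change shift (toSeq fun n => (ρ : K) ^ n) = toSeq (fun _ => (ρ : K)) * toSeq fun n => (ρ : K) ^ n
  simp only [shift_toSeq, ← toSeq_mul, pow_succ']

theorem exists_constSeq_of_shift_eq [Field K] {x : (SeqRing K)ˣ} (h : Units.map shiftHom x = x) :
    ∃ c : Kˣ, x = constSeq c := by
  obtain ⟨c, hc⟩ := exists_const_of_shift_eq (congrArg Units.val h)
  have hc0 : c ≠ 0 := by
    rintro rfl
    exact x.ne_zero hc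
  exact ⟨Units.mk0 c hc0, Units.ext hc⟩

theorem eq_prod_of_recurrence [CommMonoid K] {a x : ℕ → K} {N : ℕ}
    (h : ∀ n, N ≤ n → x (n + 1) = a n * x n) {n : ℕ} (hn : N ≤ n) :
    x n = x N * ∏ k ∈ Finset.Icc (N + 1) n, a (k - 1) := by
  induction n, hn using Nat.le_induction with
  | base => simp
  | succ n hn ih =>
    rw [h n hn, ih, Finset.prod_Icc_succ_top (by omega), Nat.add_sub_cancel, mul_comm, mul_assoc]

theorem exists_product_form [Field K] {x : SeqRing K} (hx : IsUnit x) {a : ℕ → K}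
    (h : shift x = toSeq a * x) : ∃ (κ : K) (l : ℕ), κ ≠ 0 ∧ 1 ≤ l ∧
      x = toSeq fun n => κ * ∏ k ∈ Finset.Icc l n, a (k - 1) := by
  obtain ⟨b, rfl⟩ := exists_toSeq x
  rw [shift_toSeq, ← toSeq_mul, toSeq_eq_iff] at h
  obtain ⟨N, hN⟩ := h
  have hb : toSeq b = toSeq fun n => b N * ∏ k ∈ Finset.Icc (N + 1) n, a (k - 1) :=
    toSeq_eq_iff.mpr ⟨N, fun n hn => eq_prod_of_recurrence hN hn⟩
  refine ⟨b N, N + 1, fun h0 => hx.ne_zero ?_, by omega, hb⟩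
  rw [hb, h0]
  simp only [zero_mul]
  rfl

end Sequences

/-! ### Evaluation functions -/

section Evaluation

variable {F : Type*} [Field F] {σ : RingAut F} {A : Type*} [CommRing A]

theorem exists_represents_extending {K T : Type*} [Field K] (τ : A →+* SeqRing K) {g : T → A}
    (hg : Function.Injective g) {a : T → ℕ → K} (h : ∀ t, τ (g t) = toSeq (a t)) :
    ∃ ev, Represents ev τ ∧ ∀ t, ev (g t) = a t := by
  choose ev₀ hev₀ using fun f => exists_toSeq (τ f)
  refine ⟨Function.extend g a ev₀, fun f => ?_, hg.extend_apply a ev₀⟩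
  by_cases hf : ∃ t, g t = f
  · obtain ⟨t, rfl⟩ := hf
    rw [hg.extend_apply, h]
  · rw [Function.extend_apply' _ _ _ hf, hev₀]

variable [Algebra F A] {σA : RingAut A} {τ : A →+* SeqRing (constField σ)}
  {ev : A → ℕ → constField σ}

theorem IsKHom.toSeq_pow (hτ : IsKHom σ σA τ) (hev : Represents ev τ) (f : A) (m : ℕ) :
    toSeq (ev ((σA ^ m) f)) = toSeq fun n => ev f (n + m) := by
  induction m with
  | zero => simp
  | succ m ih =>
    rw [pow_succ', RingAut.mul_apply, ← hev, hτ.map_shift, hev, ih, shift_toSeq]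
    simp only [Nat.add_right_comm, Nat.add_assoc]

theorem IsKHom.isEvalFun (hτ : IsKHom σ σA τ) (hev : Represents ev τ) : IsEvalFun σ σA ev where
  map_const c := by
    rw [← toSeq_eq_iff (b := fun _ => c), ← hev, hτ.map_const]
  map_add f g := by
    rw [← toSeq_eq_iff (b := fun n => ev f n + ev g n), ← hev, map_add, hev, hev, toSeq_add]
  map_mul f g := by
    rw [← toSeq_eq_iff (b := fun n => ev f n * ev g n), ← hev, map_mul, hev, hev, toSeq_mul]
  map_shift f k := by
    obtain ⟨m, rfl | rfl⟩ := k.eq_nat_or_neg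
    · obtain ⟨N, hN⟩ := toSeq_eq_iff.mp (hτ.toSeq_pow hev f m)
      refine ⟨N, fun n hn m' hm' => ?_⟩
      rw [zpow_natCast, hN n hn]
      congr 1; omega
    · set g := (σA ^ (-(m : ℤ))) f with hg
      have hfg : (σA ^ m) g = f := by
        rw [hg, ← zpow_natCast, ← RingAut.mul_apply, ← zpow_add, add_neg_cancel, zpow_zero]
        rfl
      obtain ⟨N, hN⟩ := toSeq_eq_iff.mp (hτ.toSeq_pow hev g m)
      rw [hfg] at hN
      refine ⟨N + m, fun n hn m' hm' => ?_⟩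
      rw [hN m' (by omega)]
      congr 1; omega

end Evaluation

section ProductEval

variable {F : Type*} [Field F]

theorem algebraMap_eq_single {s l : ℕ} {ord : Fin l → ℕ} (f : F) :
    algebraMap F (APRing F s ord) f = single 0 f := by
  simp

theorem generators_injective {s l : ℕ} {ord : Fin l → ℕ} (hord : ∀ j, ord j ≠ 1) :
    Function.Injective (Sum.elim (algebraMap F (APRing F s ord)) (Sum.elim xVar zVar)) := by
  have hz (j : Fin l) : (Pi.single j 1 : (j : Fin l) → ZMod (ord j)) ≠ 0 := by
    simpa [ZMod.one_eq_zero_iff] using hord j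
  refine Function.Injective.sumElim (algebraMap F _).injective
    (Function.Injective.sumElim ?_ ?_ ?_) ?_
  · intro i i' h
    rw [xVar, xVar, mono, mono, single_left_inj one_ne_zero, Prod.ext_iff] at h
    by_contra hne
    simpa [Pi.single_eq_of_ne hne] using congrFun h.1 i
  · intro j j' h
    rw [zVar, zVar, mono, mono, single_left_inj one_ne_zero, Prod.ext_iff] at h
    by_contra hne
    simpa [Pi.single_eq_of_ne hne, ZMod.one_eq_zero_iff, hord] using congrFun h.2 j
  · intro i j h
    rw [xVar, zVar, mono, mono, single_left_inj one_ne_zero, Prod.ext_iff] at h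
    exact hz j h.2.symm
  · rintro c (i | j) h <;>
      simp only [Sum.elim_inl, Sum.elim_inr, algebraMap_eq_single, xVar, zVar, mono, single_inj,
        Prod.ext_iff, Prod.fst_zero, Prod.snd_zero, one_ne_zero, and_false, or_false] at h
    · exact absurd (congrFun h.1.1 i) (by simp)
    · exact hz j h.1.2.symm

theorem hasProductEval_of_toSeq {σ : RingAut F} {τ₀ : F →+* SeqRing (constField σ)}
    {ev : F → ℕ → constField σ} (hev : Represents ev τ₀) {r s u : ℕ} {D : RepData F r s u}
    {σH : RingAut (HRing F s D.d)} {τH : HRing F s D.d →+* SeqRing (constField σ)}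
    (hτ : IsKHom σ σH τH) (hτ₀ : ∀ f : F, τH (algebraMap F _ f) = τ₀ f)
    {ρ : constField σ} (hρ : (ρ : F) = D.ρ) (hz : ∀ j, τH (zVar j) = toSeq fun n => ρ ^ n)
    {κ : Fin s → constField σ} {l : Fin s → ℕ} (hκ : ∀ i, κ i ≠ 0) (hl : ∀ i, 1 ≤ l i)
    (hx : ∀ i, τH (xVar i) =
      toSeq fun n => κ i * ∏ k ∈ Finset.Icc (l i) n, ev (D.α i : F) (k - 1)) :
    HasProductEval σ ev D σH τH κ l := by
  have hd : ∀ _ : Fin (if D.d = 1 then 0 else 1), D.d ≠ 1 := fun j hd => by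
    simpa [hd] using j.isLt
  obtain ⟨ev', hrep, hev'⟩ := exists_represents_extending τH (generators_injective hd)
    (a := Sum.elim ev (Sum.elim
      (fun i n => κ i * ∏ k ∈ Finset.Icc (l i) n, ev (D.α i : F) (k - 1)) fun _ n => ρ ^ n)) <| by
    rintro (c | i | j)
    exacts [(hτ₀ c).trans (hev c), hx i, hz j]
  refine ⟨hκ, hl, ev', hτ.isEvalFun hrep, hrep, fun f => congrFun (hev' (.inl f)),
    fun i => congrFun (hev' (.inr (.inl i))), fun j n => ?_⟩
  rw [show ev' (zVar j) = _ from hev' (.inr (.inr j)), ← hρ]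
  simp

end ProductEval

/-! ### Unipotent integer matrices -/

section Unipotent

variable {e : ℕ} {T : Matrix (Fin e) (Fin e) ℤ} {v m : Fin e → ℤ} {i : Fin e}

/-- The map `m ↦ m + m T`; it is unipotent if `T` is strictly lower triangular. -/
def unip (T : Matrix (Fin e) (Fin e) ℤ) : (Fin e → ℤ) →+ (Fin e → ℤ) :=
  AddMonoidHom.id _ + (Matrix.vecMulLinear T).toAddMonoidHom

theorem unip_apply (T : Matrix (Fin e) (Fin e) ℤ) (m : Fin e → ℤ) :
    unip T m = m + Matrix.vecMul m T := rfl

theorem exists_last_ne_zero (hv : v ≠ 0) : ∃ i, v i ≠ 0 ∧ ∀ j, i < j → v j = 0 := by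
  obtain ⟨i, hi⟩ := (Set.toFinite {i | v i ≠ 0}).exists_maximal (Function.ne_iff.mp hv)
  refine ⟨i, hi.prop, fun j hj => ?_⟩
  by_contra h
  exact hi.not_gt h hj

theorem unip_apply_eq (hT : ∀ i j, i ≤ j → T i j = 0) (hv : ∀ j, i < j → v j = 0) {j : Fin e}
    (hj : i ≤ j) : unip T v j = v j := by
  rw [unip_apply, Pi.add_apply, add_eq_left]
  change ∑ k, v k * T k j = 0
  refine Finset.sum_eq_zero fun k _ => ?_
  rcases le_or_gt k j with h | h
  · rw [hT k j h, mul_zero]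
  · rw [hv k (hj.trans_lt h), zero_mul]

theorem unip_injective (hT : ∀ i j, i ≤ j → T i j = 0) : Function.Injective (unip T) := by
  rw [injective_iff_map_eq_zero]
  intro v hv
  by_contra hne
  obtain ⟨i, hi, hlast⟩ := exists_last_ne_zero hne
  exact hi (by rw [← unip_apply_eq hT hlast le_rfl, hv, Pi.zero_apply])

theorem unip_iterate_apply_eq (hT : ∀ i j, i ≤ j → T i j = 0) (hv : ∀ j, i < j → v j = 0) (n : ℕ)
    {j : Fin e} (hj : i ≤ j) : (unip T)^[n] v j = v j := by
  induction n generalizing j with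
  | zero => rfl
  | succ n ih =>
    rw [Function.iterate_succ_apply', unip_apply_eq hT (fun k hk => ?_) hj, ih hj]
    rw [ih hk.le, hv k hk]

theorem unip_iterate_apply (hT : ∀ i j, i ≤ j → T i j = 0)
    (hm : ∀ j, i < j → (unip T m - m) j = 0) (n : ℕ) :
    (unip T)^[n] m i = m i + n * (unip T m - m) i := by
  induction n with
  | zero => simp
  | succ n ih =>
    rw [Function.iterate_succ_apply, ← add_sub_cancel m (unip T m), iterate_map_add,
      add_sub_cancel, Pi.add_apply, ih, unip_iterate_apply_eq hT hm n le_rfl]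
    push_cast
    ring

theorem unip_eq_self_of_finite_orbit (hT : ∀ i j, i ≤ j → T i j = 0) {S : Set (Fin e → ℤ)}
    (hS : S.Finite) (hm : ∀ n : ℕ, (unip T)^[n] m ∈ S) : unip T m = m := by
  by_contra hne
  obtain ⟨i, hi, hlast⟩ := exists_last_ne_zero (sub_ne_zero.mpr hne)
  refine Set.infinite_of_injective_forall_mem (f := fun n : ℕ => (unip T)^[n] m) ?_ hm hS
  intro a b hab
  have hab := congrFun hab i
  simp only [unip_iterate_apply hT hlast] at hab
  exact_mod_cast mul_right_cancel₀ hi (add_left_cancel hab)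

end Unipotent

/-! ### Nested `RΠ`-extensions -/

section UniqueSums

theorem exists_eq_single_of_mul_eq_one {R G : Type*} [Semiring R] [Nontrivial R] [NoZeroDivisors R]
    [AddMonoid G] [TwoUniqueSums G] {a b : AddMonoidAlgebra R G} (h : a * b = 1) :
    ∃ g c, c ≠ 0 ∧ a = single g c := by
  have hcard_pos {c : AddMonoidAlgebra R G} (hc : c ≠ 0) : 0 < c.coeff.support.card := by
    rw [Finset.card_pos, Finsupp.support_nonempty_iff]
    simpa using hc
  have ha := hcard_pos (left_ne_zero_of_mul_eq_one h)
  have hb := hcard_pos (right_ne_zero_of_mul_eq_one h)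
  have add_eq_zero {p q : G} (hp : p ∈ a.coeff.support) (hq : q ∈ b.coeff.support)
      (hu : UniqueAdd a.coeff.support b.coeff.support p q) : p + q = 0 := by
    have hco := coeff_mul_add_of_uniqueAdd hu
    by_contra hpq
    rw [h, AddMonoidAlgebra.one_def, coeff_single, Finsupp.single_eq_of_ne hpq] at hco
    exact mul_ne_zero (Finsupp.mem_support_iff.mp hp) (Finsupp.mem_support_iff.mp hq) hco.symm
  have hcard : a.coeff.support.card = 1 := by
    by_contra hcard
    obtain ⟨p, hp, q, hq, hpq, hup, huq⟩ := TwoUniqueSums.uniqueAdd_of_one_lt_card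
      (A := a.coeff.support) (B := b.coeff.support)
      (Nat.one_lt_mul_iff.mpr ⟨ha, hb, .inl (by omega)⟩)
    rw [Finset.mem_product] at hp hq
    obtain ⟨h₁, h₂⟩ := hup hq.1 hq.2
      ((add_eq_zero hq.1 hq.2 huq).trans (add_eq_zero hp.1 hp.2 hup).symm)
    exact hpq (Prod.ext h₁.symm h₂.symm)
  obtain ⟨g, hg⟩ := Finset.card_eq_one.mp hcard
  obtain ⟨hg0, hg⟩ := Finsupp.support_eq_singleton.mp hg
  exact ⟨g, _, hg0, coeff_inj.mp (by rw [coeff_single, ← hg])⟩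

end UniqueSums

section Nested

variable {F : Type*} [Field F] {s l : ℕ} {ord : Fin l → ℕ}

/-- The monomials in the Laurent variables as units. -/
def monoUnit : Multiplicative (Fin s → ℤ) →* (APRing F s ord)ˣ :=
  MonoidHom.toHomUnits
    { toFun := fun n => mono n.toAdd 0
      map_one' := rfl
      map_mul' := fun a b => by simp [mono, AddMonoidAlgebra.single_mul_single] }

theorem isUnit_xVar (i : Fin s) : IsUnit (xVar i : APRing F s ord) :=
  (monoUnit (.ofAdd (Pi.single i 1)) : (APRing F s ord)ˣ).isUnit

theorem algebraMap_mul_mono (c : F) (n : Fin s → ℤ) (k : (j : Fin l) → ZMod (ord j)) :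
    algebraMap F (APRing F s ord) c * mono n k = single (n, k) c := by
  rw [algebraMap_eq_single, mono, AddMonoidAlgebra.single_mul_single]
  simp

theorem closure_unit_vectors :
    AddSubgroup.closure (Set.range (fun i : Fin s => ((Pi.single i 1, 0) :
      (Fin s → ℤ) × ((j : Fin l) → ZMod (ord j)))) ∪
      Set.range fun j : Fin l => (0, Pi.single j 1)) = ⊤ := by
  refine eq_top_iff.mpr fun g _ => ?_
  have hg : g = ∑ i, g.1 i • ((Pi.single i 1, 0) : (Fin s → ℤ) × ((j : Fin l) → ZMod (ord j))) +
      ∑ j, ((g.2 j).cast : ℤ) •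
        ((0, Pi.single j 1) : (Fin s → ℤ) × ((j : Fin l) → ZMod (ord j))) := by
    refine Prod.ext (funext fun k => ?_) (funext fun k => ?_)
    · simp [Prod.fst_sum, Finset.sum_apply, Pi.single_apply]
    · simp only [Prod.snd_add, Prod.snd_sum, Prod.smul_snd, smul_zero, Finset.sum_const_zero,
        zero_add]
      rw [Finset.sum_apply, Finset.sum_eq_single k]
      · simp
      · intro j _ hj
        simp [hj.symm]
      · simp
  rw [hg]
  exact add_mem
    (sum_mem fun i _ => zsmul_mem (AddSubgroup.subset_closure (.inl ⟨i, rfl⟩)) _)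
    (sum_mem fun j _ => zsmul_mem (AddSubgroup.subset_closure (.inr ⟨j, rfl⟩)) _)

/-- The group of exponents of the monomials in `x₁, …, x_{i-1}`. -/
def lowerExponents (i : Fin s) : AddSubgroup (Fin s → ℤ) where
  carrier := {m | ∀ j, i ≤ j → m j = 0}
  zero_mem' _ _ := rfl
  add_mem' hm hn j hj := by simp [hm j hj, hn j hj]
  neg_mem' hm j hj := by simp [hm j hj]

theorem lowerRing_le_range (i : Fin s) :
    lowerRing F ord i ≤ (mapDomainAlgHom F F
      ((AddMonoidHom.inl _ _).comp (lowerExponents i).subtype)).range := by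
  refine Algebra.adjoin_le ?_
  rintro _ ⟨m, hm, rfl⟩
  exact ⟨single ⟨m, hm⟩ 1, by simp [mono]⟩

theorem exists_eq_single_of_mem_lowerRing {i : Fin s} {β β' : APRing F s ord}
    (hβ : β ∈ lowerRing F ord i) (hβ' : β' ∈ lowerRing F ord i) (h : β * β' = 1) :
    ∃ (t : Fin s → ℤ) (b : Fˣ), (∀ j, i ≤ j → t j = 0) ∧ β = single (t, 0) (b : F) := by
  obtain ⟨p, rfl⟩ := lowerRing_le_range i hβ
  obtain ⟨p', rfl⟩ := lowerRing_le_range i hβ'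
  let ι := (AddMonoidHom.inl (Fin s → ℤ) ((j : Fin l) → ZMod (ord j))).comp
    (lowerExponents i).subtype
  have hinj : Function.Injective ι := fun m n hmn => Subtype.ext (congrArg Prod.fst hmn)
  have hpp' : p * p' = 1 := mapDomain_injective hinj <|
    (map_mul (mapDomainAlgHom F F ι) p p').trans (h.trans (map_one (mapDomainAlgHom F F ι)).symm)
  have : TwoUniqueSums (lowerExponents i) :=
    TwoUniqueSums.of_injective_addHom (lowerExponents i).subtype.toAddHom
      (lowerExponents i).subtype_injective inferInstance
  obtain ⟨t, b, hb, rfl⟩ := exists_eq_single_of_mul_eq_one hpp'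
  exact ⟨t, Units.mk0 b hb, t.2, by simp⟩

variable {σ : RingAut F} {σ' : RingAut (APRing F s ord)}

/-- The action `(m, k) ↦ (m + m T, k)` of the automorphism of a nested extension on the exponents
of the monomials `x^m z^k`. -/
def exponentMap (T : Matrix (Fin s) (Fin s) ℤ) :
    (Fin s → ℤ) × ((j : Fin l) → ZMod (ord j)) →+ (Fin s → ℤ) × ((j : Fin l) → ZMod (ord j)) :=
  (unip T).prodMap (AddMonoidHom.id _)

theorem exponentMap_apply (T : Matrix (Fin s) (Fin s) ℤ)
    (g : (Fin s → ℤ) × ((j : Fin l) → ZMod (ord j))) : exponentMap T g = (unip T g.1, g.2) := rfl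

theorem exponentMap_injective {T : Matrix (Fin s) (Fin s) ℤ} (hT : ∀ i j, i ≤ j → T i j = 0) :
    Function.Injective (exponentMap T : (Fin s → ℤ) × ((j : Fin l) → ZMod (ord j)) →+ _) :=
  (unip_injective hT).prodMap Function.injective_id

theorem IsAPExtension.exists_eq_monomialHom (h : IsAPExtension σ σ') :
    ∃ (T : Matrix (Fin s) (Fin s) ℤ) (χ : Multiplicative _ →* Fˣ), (∀ i j, i ≤ j → T i j = 0) ∧
      (σ' : APRing F s ord →+* APRing F s ord) =
        monomialHom (σ : F →+* F) (exponentMap T) χ := by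
  have hx (i : Fin s) : ∃ (t : Fin s → ℤ) (b : Fˣ), (∀ j, i ≤ j → t j = 0) ∧
      σ' (xVar i) = single (t + Pi.single i 1, 0) (b : F) := by
    obtain ⟨β, hβ, β', hβ', h₁, h₂⟩ := h.map_x i
    obtain ⟨t, b, ht, rfl⟩ := exists_eq_single_of_mem_lowerRing hβ hβ' h₁
    refine ⟨t, b, ht, ?_⟩
    rw [h₂, xVar, mono, AddMonoidAlgebra.single_mul_single, Prod.mk_add_mk, add_zero, mul_one]
  obtain ⟨T, b, hT, hσ⟩ : ∃ (T : Matrix (Fin s) (Fin s) ℤ) (b : Fin s → Fˣ),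
      (∀ i j, i ≤ j → T i j = 0) ∧
        ∀ i, σ' (xVar i) = single (T.row i + Pi.single i 1, 0) (b i : F) := by
    choose T b hT hσ using hx
    exact ⟨T, b, hT, hσ⟩
  obtain ⟨χ, hχ⟩ := exists_eq_monomialHom_of_closure (f := (σ' : APRing F s ord →+* APRing F s ord))
    (φ := (σ : F →+* F)) (π := exponentMap T)
    (fun c => by simpa [algebraMap_eq_single] using h.map_base c) closure_unit_vectors <| by
      rintro _ (⟨i, rfl⟩ | ⟨j, rfl⟩)
      · refine ⟨b i, (hσ i).trans ?_⟩
        simp [exponentMap_apply, unip_apply, add_comm]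
      · obtain ⟨ρ, hρ, h₂⟩ := h.map_z j
        refine ⟨Units.mk0 (ρ : F) (by simpa using hρ), h₂.trans ?_⟩
        simp [exponentMap_apply, zVar, mono, AddMonoidAlgebra.single_mul_single]
  exact ⟨T, χ, hT, hχ⟩

-- The support of `w` is mapped into itself by the unipotent map of the exponents, which therefore
-- fixes it pointwise; so every monomial of `w` is a solution.
theorem exists_monomial_solution {T : Matrix (Fin s) (Fin s) ℤ} (hT : ∀ i j, i ≤ j → T i j = 0)
    {χ : Multiplicative _ →* Fˣ} {a : Fˣ} {w : APRing F s ord} (hw : w ≠ 0)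
    (haw : monomialHom (σ : F →+* F) (exponentMap T) χ w =
      algebraMap F _ (a : F) * w) :
    ∃ g, exponentMap T g = g ∧ ∃ f : Fˣ, onUnits σ f * χ (.ofAdd g) = a * f := by
  have hrel (g) : σ (w.coeff g) * χ (.ofAdd g) = a * w.coeff (exponentMap T g) := by
    have h := coeff_monomialHom (σ : F →+* F) (exponentMap_injective hT) χ w g
    rw [haw, algebraMap_eq_single, coeff_single_mul_apply, neg_zero, zero_add] at h
    exact h.symm
  obtain ⟨g, hg⟩ : w.coeff.support.Nonempty := by
    rw [Finsupp.support_nonempty_iff]; simpa using hw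
  have horbit (n : ℕ) : ((unip T)^[n] g.1, g.2) ∈ w.coeff.support := by
    induction n with
    | zero => exact hg
    | succ n ih =>
      rw [Finsupp.mem_support_iff] at ih ⊢
      rw [Function.iterate_succ_apply']
      refine right_ne_zero_of_mul (a := (a : F)) ?_
      rw [← exponentMap_apply T ((unip T)^[n] g.1, g.2), ← hrel]
      exact mul_ne_zero ((map_ne_zero σ).mpr ih) (χ _).ne_zero
  have hfix : exponentMap T g = g :=
    Prod.ext (unip_eq_self_of_finite_orbit hT (w.coeff.support.finite_toSet.image Prod.fst)
      fun n => ⟨((unip T)^[n] g.1, g.2), horbit n, rfl⟩) rfl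
  refine ⟨g, hfix, Units.mk0 _ (Finsupp.mem_support_iff.mp hg), Units.ext ?_⟩
  simpa [hfix] using hrel g

theorem IsRPiExtension.eq_zero_of_isConstant_single (h : IsRPiExtension σ σ') {g} {c : F}
    (hc : c ≠ 0) (hσ : σ' (single g c) = single g c) : g = 0 := by
  obtain ⟨k, _, hk⟩ := (h.const_eq _).mp hσ
  rw [algebraMap_eq_single, single_inj] at hk
  rcases hk with hk | hk
  · exact hk.1.symm
  · exact absurd hk.2 hc

-- Monomial solutions `f_i x^{g_i}` give `ψ n = ∑ n_i g_i`.
theorem IsRPiExtension.exists_mem_multRel_iff (h : IsRPiExtension σ σ') {r : ℕ} {α : Fin r → Fˣ}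
    {w : Fin r → APRing F s ord} (hw : ∀ i, w i ≠ 0)
    (haw : ∀ i, σ' (w i) = algebraMap F _ (α i : F) * w i) :
    ∃ ψ : (Fin r → ℤ) →+ (Fin s → ℤ) × ((j : Fin l) → ZMod (ord j)),
      ∀ n, n ∈ multRel σ α ↔ ψ n = 0 := by
  obtain ⟨T, χ, hT, hσ⟩ := h.exists_eq_monomialHom
  choose g hg f hf using fun i => exists_monomial_solution hT (hw i)
    ((DFunLike.congr_fun hσ (w i)).symm.trans (haw i))
  let ψ : (Fin r → ℤ) →+ (Fin s → ℤ) × ((j : Fin l) → ZMod (ord j)) :=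
    AddMonoidHom.toMultiplicative.symm (zpowProdHom fun i => Multiplicative.ofAdd (g i))
  have hψ (n) : Multiplicative.ofAdd (ψ n) = zpowProd (fun i => .ofAdd (g i)) n := rfl
  have hfix (n) : exponentMap T (ψ n) = ψ n := by
    have := map_zpowProd
      (AddMonoidHom.toMultiplicative (exponentMap (l := l) (ord := ord) T))
      (fun i => Multiplicative.ofAdd (g i)) n
    exact this.trans (congrArg (zpowProd · n) (funext hg))
  have hpow (n) : onUnits σ (zpowProd f n) * χ (.ofAdd (ψ n)) = zpowProd α n * zpowProd f n := by
    rw [hψ, map_zpowProd, map_zpowProd, ← zpowProd_mul, ← zpowProd_mul]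
    exact congrArg (zpowProd · n) (funext hf)
  refine ⟨ψ, fun n => mem_multRel.trans ⟨?_, fun hn => ⟨zpowProd f n, ?_⟩⟩⟩
  · rintro ⟨x, hx⟩
    refine h.eq_zero_of_isConstant_single (zpowProd f n / x).ne_zero ?_
    have hconst : onUnits σ (zpowProd f n / x) * χ (.ofAdd (ψ n)) = zpowProd f n / x := by
      rw [map_div, div_mul_eq_mul_div, hpow, hx, mul_div_mul_left_eq_div]
    refine (DFunLike.congr_fun hσ _).trans ?_
    rw [monomialHom_single]
    exact congrArg₂ single (hfix n) (congrArg Units.val hconst)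
  · rw [← hpow, hn, ofAdd_zero, map_one, mul_one]

theorem IsRPiExtension.lcm_eq_prod (h : IsRPiExtension σ σ') :
    Finset.univ.lcm ord = ∏ j, ord j := by
  have hord (j : Fin l) : NeZero (ord j) := ⟨(zero_lt_one.trans (h.one_lt_ord j)).ne'⟩
  obtain ⟨T, χ, -, hσ⟩ := h.exists_eq_monomialHom
  let χz : Multiplicative ((j : Fin l) → ZMod (ord j)) →* Fˣ :=
    χ.comp (AddMonoidHom.toMultiplicative (AddMonoidHom.inr _ _))
  have hχz : Function.Injective χz := by
    rw [injective_iff_map_eq_one]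
    intro k hk
    have : ((0, k.toAdd) : (Fin s → ℤ) × ((j : Fin l) → ZMod (ord j))) = 0 := by
      refine h.eq_zero_of_isConstant_single one_ne_zero ((DFunLike.congr_fun hσ _).trans ?_)
      rw [monomialHom_single]
      refine congrArg₂ single (Prod.ext (map_zero (unip T)) rfl) ?_
      rw [map_one, one_mul]
      exact congrArg Units.val hk
    exact congrArg Prod.snd this
  have hcyc : IsCyclic (Multiplicative ((j : Fin l) → ZMod (ord j))) :=
    isCyclic_of_injective_ringHom ((Units.coeHom F).comp χz) (Units.val_injective.comp hχz)
  have hcard : Nat.card (Multiplicative ((j : Fin l) → ZMod (ord j))) = ∏ j, ord j := by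
    rw [Nat.card_congr Multiplicative.toAdd, Nat.card_pi]
    simp
  refine Nat.dvd_antisymm (Finset.lcm_dvd fun j hj => Finset.dvd_prod_of_mem ord hj) ?_
  rw [← hcard, ← IsCyclic.exponent_eq_card]
  refine Monoid.exponent_dvd_of_forall_pow_eq_one fun k => funext fun j => ?_
  have : ((Finset.univ.lcm ord : ℕ) : ZMod (ord j)) = 0 :=
    (ZMod.natCast_eq_zero_iff _ _).mpr (Finset.dvd_lcm (Finset.mem_univ j))
  change (Finset.univ.lcm ord) • k.toAdd j = 0
  rw [nsmul_eq_mul, this, zero_mul]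

theorem lcm_zsmul_eq_zero {g : (Fin s → ℤ) × ((j : Fin l) → ZMod (ord j))} (hg : g.1 = 0) :
    ((Finset.univ.lcm ord : ℕ) : ℤ) • g = 0 := by
  refine Prod.ext (by simp [hg]) (funext fun j => ?_)
  have : ord j ∣ Finset.univ.lcm ord := Finset.dvd_lcm (Finset.mem_univ j)
  simp [(ZMod.natCast_eq_zero_iff _ _).mpr this]

theorem le_of_ker_le {A : Type*} [AddCommGroup A] {s e : ℕ} {M : A →+ (Fin s → ℤ)}
    {ψ : A →+ (Fin e → ℤ)} (h : ψ.ker ≤ M.ker) (hM : Function.Surjective M) : s ≤ e := by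
  choose v hv using fun j : Fin s => hM (Pi.single j 1)
  have hli : LinearIndependent ℤ fun j => ψ (v j) := by
    rw [Fintype.linearIndependent_iff]
    intro c hc
    simp only [← map_zsmul, ← map_sum] at hc
    have hMc : M (∑ j, c j • v j) = 0 := h hc
    simp only [map_sum, map_zsmul, hv] at hMc
    intro i
    simpa [Finset.sum_apply, Pi.single_apply] using congrFun hMc i
  simpa using hli.fintype_card_le_finrank

theorem isMinimal_of_multRel {τ₀ : F →+* SeqRing (constField σ)} {r : ℕ} {α : Fin r → Fˣ}
    {σE : RingAut (PRing F r)} {τE : PRing F r →+* SeqRing (constField σ)}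
    (hE : IsPExtension σ α σE) (hτE : ∀ f : F, τE (algebraMap F _ f) = τ₀ f) {s d : ℕ}
    {M : (Fin r → ℤ) →+ (Fin s → ℤ)} (hM : ∀ n ∈ multRel σ α, M n = 0)
    (hM_surj : Function.Surjective M) {vz : Fin r → ℤ}
    (hvz : ∀ k : ℕ, (k : ℤ) • vz ∈ multRel σ α ↔ d ∣ k) :
    IsMinimal σ τ₀ σE τE s d := by
  intro e l ord σ' τ' lam' hR hemb hτ' hlam hcomm
  have hbase (f : F) : lam' (algebraMap F _ f) = algebraMap F _ f :=
    hemb.injective (by rw [hcomm, hτE, hτ'])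
  obtain ⟨ψ, hψ⟩ := hR.exists_mem_multRel_iff (α := α) (w := fun i => lam' (xVar i))
    (fun i => ((isUnit_xVar i).map lam').ne_zero)
    (fun i => by rw [← hlam, hE.map_x, map_mul, hbase])
  have hlcm : Finset.univ.lcm ord ≠ 0 := by
    rw [hR.lcm_eq_prod, Finset.prod_ne_zero_iff]
    exact fun j _ => (zero_lt_one.trans (hR.one_lt_ord j)).ne'
  have htors (n) (hn : (ψ n).1 = 0) : ((Finset.univ.lcm ord : ℕ) : ℤ) • n ∈ multRel σ α := by
    rw [hψ, map_zsmul, lcm_zsmul_eq_zero hn]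
  refine ⟨le_of_ker_le (M := M) (ψ := (AddMonoidHom.fst _ _).comp ψ) (fun n hn => ?_) hM_surj,
    fun hd => ?_⟩
  · have h := hM _ (htors n hn)
    rw [map_zsmul] at h
    exact (smul_eq_zero.mp h).resolve_left (by exact_mod_cast hlcm)
  · have hvz_free : (ψ vz).1 = 0 := by
      have h := congrArg Prod.fst ((hψ _).mp ((hvz d).mpr dvd_rfl))
      rw [map_zsmul, Prod.smul_fst] at h
      exact (smul_eq_zero.mp h).resolve_left (by exact_mod_cast (zero_lt_one.trans hd).ne')
    have hle := Nat.le_of_dvd (Nat.pos_of_ne_zero hlcm) ((hvz _).mp (htors _ hvz_free))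
    refine ⟨Nat.one_le_iff_ne_zero.mpr ?_, hle, hR.lcm_eq_prod⟩
    rintro rfl
    simp only [Finset.univ_eq_empty, Finset.lcm_empty] at hle
    omega

end Nested

/-! ### Certificates for optimal representations -/

section Certificates

variable {F : Type*} [Field F] {σ : RingAut F}

theorem IsPExtension.map_mono {r : ℕ} {α : Fin r → Fˣ} {σE : RingAut (PRing F r)}
    (h : IsPExtension σ α σE) (n : Fin r → ℤ) :
    σE (mono n 0) = algebraMap F _ (zpowProd α n : Fˣ) * mono n 0 := by
  let coeffs : Fˣ →* (PRing F r)ˣ := Units.map (algebraMap F (PRing F r))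
  have hx (i : Fin r) : onUnits σE (monoUnit (.ofAdd (Pi.single i 1))) =
      coeffs (α i) * monoUnit (.ofAdd (Pi.single i 1)) := Units.ext (h.map_x i)
  have hunit : onUnits σE (monoUnit (.ofAdd n)) =
      coeffs (zpowProd α n) * monoUnit (.ofAdd n) := by
    have hmono := hom_eq_zpowProd (monoUnit : Multiplicative (Fin r → ℤ) →* (PRing F r)ˣ) n
    rw [hmono, map_zpowProd, map_zpowProd, ← zpowProd_mul]
    exact congrArg (zpowProd · n) (funext hx)
  exact congrArg Units.val hunit

/-- A constant of `(F, σ)`, regarded as an element of `F`, on the level of units. -/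
def rootUnit (ρ : (constField σ)ˣ) : Fˣ :=
  Units.map ((constField σ).subtype : constField σ →* F) ρ

theorem onUnits_rootUnit (ρ : (constField σ)ˣ) : onUnits σ (rootUnit ρ) = rootUnit ρ :=
  Units.ext (ρ : constField σ).2

theorem rootUnit_zpow_of_dvd {ρ : (constField σ)ˣ} {d : ℕ} (hρ : ρ ^ d = 1) {k : ℤ}
    (hk : (d : ℤ) ∣ k) : rootUnit ρ ^ k = 1 := by
  obtain ⟨c, rfl⟩ := hk
  rw [zpow_mul, zpow_natCast, rootUnit, ← map_pow, hρ, map_one, one_zpow]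

variable {r s u : ℕ}

namespace RepData

/-- The exponent vector of the `Π`-monomials in the image of the monomial `x̂^n`. -/
def xExp (D : RepData F r s u) : (Fin r → ℤ) →+ (Fin s → ℤ) :=
  (Matrix.vecMulLinear (Matrix.of D.m)).toAddMonoidHom

theorem xExp_apply (D : RepData F r s u) (n : Fin r → ℤ) :
    D.xExp n = Matrix.vecMul n (Matrix.of D.m) := rfl

/-- The exponent of the `R`-monomial in the image of the monomial `x̂^n`, not reduced mod `d`. -/
def zExp (D : RepData F r s u) : (Fin r → ℤ) →+ ℤ :=
  AddMonoidHom.mk' (fun n => ∑ i, n i * D.o i) fun a b => by simp [add_mul, Finset.sum_add_distrib]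

theorem zExp_apply (D : RepData F r s u) (n : Fin r → ℤ) : D.zExp n = ∑ i, n i * D.o i := rfl

/-- The exponents of all generators in the image of a monomial. -/
def expHom (D : RepData F r s u) :
    (Fin r → ℤ) × ((j : Fin 0) → ZMod (j.elim0 : ℕ)) →+
      (Fin s → ℤ) × (Fin (if D.d = 1 then 0 else 1) → ZMod D.d) :=
  AddMonoidHom.mk' (fun g => (D.xExp g.1, fun _ => (D.zExp g.1 : ZMod D.d))) fun a b =>
    Prod.ext (by simp) (funext fun j => by simp)

theorem expHom_apply (D : RepData F r s u) (n : Fin r → ℤ) (k) :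
    D.expHom (n, k) = (D.xExp n, fun _ => (D.zExp n : ZMod D.d)) := rfl

theorem expHom_eq_zero_iff (D : RepData F r s u) (n : Fin r → ℤ) (k) :
    D.expHom (n, k) = 0 ↔ D.xExp n = 0 ∧ (D.d : ℤ) ∣ D.zExp n := by
  rw [expHom_apply, Prod.mk_eq_zero, ← ZMod.intCast_zmod_eq_zero_iff_dvd]
  refine and_congr_right fun _ => ⟨fun h => ?_, fun h => funext fun _ => h⟩
  by_cases hd : D.d = 1
  · rw [hd]
    exact Subsingleton.elim (α := ZMod 1) _ _
  · exact congrFun h ⟨0, by simp [hd]⟩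

/-- The coefficients of the images of the monomials. -/
def coeffChar (D : RepData F r s u) :
    Multiplicative ((Fin r → ℤ) × ((j : Fin 0) → ZMod (j.elim0 : ℕ))) →* Fˣ :=
  (zpowProdHom D.γ).comp (AddMonoidHom.toMultiplicative (AddMonoidHom.fst _ _))

theorem coeffChar_apply (D : RepData F r s u) (n : Fin r → ℤ) (k) :
    D.coeffChar (.ofAdd (n, k)) = zpowProd D.γ n := rfl

/-- The homomorphism `λ` described by `D`. -/
def lam (D : RepData F r s u) : PRing F r →+* HRing F s D.d :=
  monomialHom (RingHom.id F) D.expHom D.coeffChar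

theorem lam_single (D : RepData F r s u) (n : Fin r → ℤ) (k) (c : F) :
    D.lam (single (n, k) c) =
      single (D.xExp n, fun _ => (D.zExp n : ZMod D.d)) (c * (zpowProd D.γ n : Fˣ)) := by
  rw [lam, monomialHom_single, expHom_apply, coeffChar_apply, RingHom.id_apply]

theorem lam_mono (D : RepData F r s u) (n : Fin r → ℤ) :
    D.lam (mono n 0) =
      algebraMap F _ (zpowProd D.γ n : Fˣ) * mono (D.xExp n) fun _ => (D.zExp n : ZMod D.d) := by
  rw [mono, lam_single, one_mul, algebraMap_mul_mono]

theorem lam_base (D : RepData F r s u) (c : F) : D.lam (algebraMap F _ c) = algebraMap F _ c := by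
  rw [algebraMap_eq_single, lam, monomialHom_single, map_zero, algebraMap_eq_single]
  simp

theorem lam_xVar (D : RepData F r s u) (i : Fin r) :
    D.lam (xVar i) =
      algebraMap F _ (D.γ i : F) * mono (D.m i) fun _ => (D.o i : ZMod D.d) := by
  rw [xVar, lam_mono, xExp_apply, Matrix.single_one_vecMul, zExp_apply, zpowProd_single, zpow_one]
  simp [Pi.single_apply]

end RepData

theorem exists_eq_intCast {d : ℕ} (k : Fin (if d = 1 then 0 else 1) → ZMod d) :
    ∃ c : ℤ, k = fun _ => (c : ZMod d) := by
  by_cases hd : d = 1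
  · subst hd
    exact ⟨0, funext fun j => j.elim0⟩
  · have : Subsingleton (Fin (if d = 1 then 0 else 1)) := by
      simp only [hd, if_false]
      infer_instance
    obtain ⟨c, hc⟩ := ZMod.intCast_surjective (k ⟨0, by simp [hd]⟩)
    exact ⟨c, funext fun j => by rw [hc]; congr 1; exact Subsingleton.elim _ _⟩

theorem single_one_eq {d : ℕ} (j : Fin (if d = 1 then 0 else 1)) :
    (Pi.single j 1 : Fin (if d = 1 then 0 else 1) → ZMod d) = fun _ => 1 := by
  have : Subsingleton (Fin (if d = 1 then 0 else 1)) := by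
    split_ifs <;> infer_instance
  funext i
  rw [Subsingleton.elim i j, Pi.single_eq_same]

/-- The algebraic conditions on the data `D` of a representation; the vectors `v j` and `vz` are the
exponents of preimages of the generators. -/
structure IsAlgCert (σ : RingAut F) {r : ℕ} (α : Fin r → Fˣ) {s u : ℕ} (D : RepData F r s u)
    (ρ : (constField σ)ˣ) (v : Fin s → Fin r → ℤ) (vz : Fin r → ℤ) : Prop where
  basis : RowsAreBasis (multRel σ α) (Matrix.of D.n)
  d_pos : 0 < D.d
  o_lt : ∀ i, D.o i < D.d
  rho : ((ρ : constField σ) : F) = D.ρ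
  rho_pow : ρ ^ D.d = 1
  compat : ∀ i, σ (D.γ i) * ((∏ j, (D.α j : F) ^ D.m i j) * D.ρ ^ D.o i) = α i * D.γ i
  x_n : ∀ k, D.xExp (D.n k) = 0
  z_n : ∀ k, (D.d : ℤ) ∣ D.zExp (D.n k)
  x_v : ∀ j, D.xExp (v j) = Pi.single j 1
  z_v : ∀ j, (D.d : ℤ) ∣ D.zExp (v j)
  x_vz : D.xExp vz = 0
  z_vz : (D.d : ℤ) ∣ D.zExp vz - 1
  g_eq : ∀ k, D.g k = zpowProd D.γ (D.n k)

/-- Finitely many conditions on the data `D` which imply that `D` describes an optimal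
representation. -/
structure IsCert (σ : RingAut F) {r : ℕ} (α : Fin r → Fˣ) (τ₀ : F →+* SeqRing (constField σ))
    (τE : PRing F r →+* SeqRing (constField σ)) {s u : ℕ} (D : RepData F r s u)
    (ρ : (constField σ)ˣ) (v : Fin s → Fin r → ℤ) (vz : Fin r → ℤ) : Prop
    extends IsAlgCert σ α D ρ v vz where
  tau_n : ∀ k, τE (mono (D.n k) 0) = τ₀ (D.g k : F)
  tau_vz : τE (mono vz 0) = τ₀ (zpowProd D.γ vz : Fˣ) * geomSeq ρ

/-- The conditions on the data `D` that concern values of evaluation functions at the single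
point `N`. -/
structure IsEvalCert {σ : RingAut F} {r : ℕ} (evE : PRing F r → ℕ → constField σ)
    (LE : PRing F r → ℕ) {s u : ℕ} (D : RepData F r s u) (ρ : (constField σ)ˣ)
    (v : Fin s → Fin r → ℤ) (vz : Fin r → ℤ) (κ : Fin s → constField σ) (N : ℕ) : Prop where
  bound_n : ∀ k, LE (algebraMap F _ ((D.g k : F)⁻¹) * mono (D.n k) 0) ≤ N
  eval_n : ∀ k, evE (algebraMap F _ ((D.g k : F)⁻¹) * mono (D.n k) 0) N = 1
  bound_v : ∀ j, LE (algebraMap F _ (((zpowProd D.γ (v j) : Fˣ) : F)⁻¹) * mono (v j) 0) ≤ N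
  eval_v : ∀ j, evE (algebraMap F _ (((zpowProd D.γ (v j) : Fˣ) : F)⁻¹) * mono (v j) 0) N = κ j
  bound_α : ∀ j, LE (algebraMap F _ (D.α j : F)) ≤ N
  bound_vz : LE (algebraMap F _ (((zpowProd D.γ vz : Fˣ) : F)⁻¹) * mono vz 0) ≤ N
  eval_vz :
    evE (algebraMap F _ (((zpowProd D.γ vz : Fˣ) : F)⁻¹) * mono vz 0) N = (ρ : constField σ) ^ N
  bound_ρ : LE (algebraMap F _ D.ρ) ≤ N

namespace IsAlgCert

variable {α : Fin r → Fˣ} {D : RepData F r s u} {ρ : (constField σ)ˣ} {v : Fin s → Fin r → ℤ}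
  {vz : Fin r → ℤ}

theorem compat_zpowProd (h : IsAlgCert σ α D ρ v vz) (n : Fin r → ℤ) :
    onUnits σ (zpowProd D.γ n) * (zpowProd D.α (D.xExp n) * rootUnit ρ ^ D.zExp n) =
      zpowProd α n * zpowProd D.γ n := by
  have hgen (i : Fin r) :
      onUnits σ (D.γ i) * (zpowProd D.α (D.m i) * rootUnit ρ ^ D.o i) = α i * D.γ i := by
    have := h.compat i
    rw [← h.rho, ← val_zpowProd] at this
    exact Units.ext (by simpa [rootUnit] using this)
  have hx : zpowProd D.α (D.xExp n) = zpowProd (fun i => zpowProd D.α (D.m i)) n :=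
    zpowProd_vecMul D.α n (Matrix.of D.m)
  have hz : rootUnit ρ ^ D.zExp n = zpowProd (fun i => rootUnit ρ ^ D.o i) n :=
    (zpowProd_pow_const (rootUnit ρ) D.o n).symm
  rw [map_zpowProd, hx, hz, ← zpowProd_mul, ← zpowProd_mul, ← zpowProd_mul]
  exact congrArg (zpowProd · n) (funext hgen)

theorem mem_iff (h : IsAlgCert σ α D ρ v vz) (n : Fin r → ℤ) :
    n ∈ multRel σ α ↔ D.xExp n = 0 ∧ (D.d : ℤ) ∣ D.zExp n := by
  constructor
  · intro hn
    rw [← h.basis.2] at hn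
    induction hn using Submodule.span_induction with
    | mem x hx =>
      obtain ⟨k, rfl⟩ := hx
      exact ⟨h.x_n k, h.z_n k⟩
    | zero => simp
    | add x y _ _ hx hy =>
      rw [map_add, map_add, hx.1, hy.1]
      exact ⟨add_zero 0, dvd_add hx.2 hy.2⟩
    | smul c x _ hx =>
      rw [map_zsmul, map_zsmul, hx.1]
      exact ⟨smul_zero c, hx.2.mul_left c⟩
  · rintro ⟨hx, hz⟩
    refine mem_multRel.mpr ⟨zpowProd D.γ n, ?_⟩
    simpa [hx, zpowProd_zero, rootUnit_zpow_of_dvd h.rho_pow hz] using h.compat_zpowProd n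

/-- The homomorphism `k ↦ ρ ^ k` on `ℤ/dℤ`. -/
def rootChar (h : IsAlgCert σ α D ρ v vz) : ZMod D.d →+ Additive Fˣ :=
  ZMod.lift D.d ⟨zmultiplesHom (Additive Fˣ) (.ofMul (rootUnit ρ)), by
    rw [zmultiplesHom_apply, ← ofMul_zpow, rootUnit_zpow_of_dvd h.rho_pow dvd_rfl, ofMul_one]⟩

theorem rootChar_intCast (h : IsAlgCert σ α D ρ v vz) (k : ℤ) :
    h.rootChar (k : ZMod D.d) = Additive.ofMul (rootUnit ρ ^ k) := by
  simp [rootChar, ZMod.lift_coe]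

/-- The quotients `σ(y)/y` for the monomials `y` of the ring `H`. -/
def char (h : IsAlgCert σ α D ρ v vz) :
    Multiplicative ((Fin s → ℤ) × (Fin (if D.d = 1 then 0 else 1) → ZMod D.d)) →* Fˣ :=
  (zpowProdHom D.α).comp (AddMonoidHom.toMultiplicative (AddMonoidHom.fst _ _)) *
    AddMonoidHom.toMultiplicativeLeft
      (∑ j : Fin (if D.d = 1 then 0 else 1),
        h.rootChar.comp ((Pi.evalAddMonoidHom _ j).comp (AddMonoidHom.snd _ _)))

theorem char_apply (h : IsAlgCert σ α D ρ v vz) (n : Fin s → ℤ) (k : ℤ) :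
    h.char (.ofAdd (n, fun _ => (k : ZMod D.d))) = zpowProd D.α n * rootUnit ρ ^ k := by
  have hroot : (∑ _ : Fin (if D.d = 1 then 0 else 1), h.rootChar (k : ZMod D.d)) =
      Additive.ofMul (rootUnit ρ ^ k) := by
    rw [Finset.sum_const, h.rootChar_intCast, Finset.card_univ, Fintype.card_fin]
    split_ifs with hd
    · rw [zero_smul, rootUnit_zpow_of_dvd h.rho_pow (by simp [hd]), ofMul_one]
    · exact one_smul _ _
  simp only [char, MonoidHom.mul_apply]
  congr 1
  change Additive.toMul ((∑ j, h.rootChar.comp ((Pi.evalAddMonoidHom _ j).comp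
    (AddMonoidHom.snd _ _))) _) = _
  rw [AddMonoidHom.finsetSum_apply]
  exact congrArg Additive.toMul hroot

theorem char_expHom (h : IsAlgCert σ α D ρ v vz) (n : Fin r → ℤ) (k) :
    onUnits σ (zpowProd D.γ n) * h.char (.ofAdd (D.expHom (n, k))) =
      zpowProd α n * zpowProd D.γ n := by
  rw [RepData.expHom_apply, h.char_apply, h.compat_zpowProd]

theorem zExp_v_cast (h : IsAlgCert σ α D ρ v vz) (j : Fin s) : (D.zExp (v j) : ZMod D.d) = 0 :=
  (ZMod.intCast_zmod_eq_zero_iff_dvd _ _).mpr (h.z_v j)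

theorem zExp_vz_cast (h : IsAlgCert σ α D ρ v vz) : (D.zExp vz : ZMod D.d) = 1 := by
  simpa [sub_eq_zero] using (ZMod.intCast_zmod_eq_zero_iff_dvd _ _).mpr h.z_vz

theorem xExp_sum_v (h : IsAlgCert σ α D ρ v vz) (n : Fin s → ℤ) :
    D.xExp (∑ j, n j • v j) = n := by
  simp only [map_sum, map_zsmul, h.x_v]
  funext i
  simp [Finset.sum_apply, Pi.single_apply]

theorem expHom_surjective (h : IsAlgCert σ α D ρ v vz) : Function.Surjective D.expHom := by
  rintro ⟨n, k⟩
  obtain ⟨c, rfl⟩ := exists_eq_intCast k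
  refine ⟨(∑ j, n j • v j + c • vz, 0), Prod.ext ?_ (funext fun _ => ?_)⟩
  · simp only [RepData.expHom_apply, map_add, h.xExp_sum_v, map_zsmul, h.x_vz, smul_zero, add_zero]
  · simp only [RepData.expHom_apply, map_add, map_sum, map_zsmul, smul_eq_mul, Int.cast_add,
      Int.cast_sum, Int.cast_mul, h.zExp_v_cast, h.zExp_vz_cast, mul_zero, mul_one,
      Finset.sum_const_zero, zero_add]

theorem closure_eq_ker (h : IsAlgCert σ α D ρ v vz) :
    AddSubgroup.closure (Set.range fun k => (D.n k, (0 : (j : Fin 0) → ZMod (j.elim0 : ℕ)))) =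
      D.expHom.ker := by
  refine le_antisymm ((AddSubgroup.closure_le _).mpr ?_) ?_
  · rintro _ ⟨k, rfl⟩
    exact (D.expHom_eq_zero_iff _ _).mpr ⟨h.x_n k, h.z_n k⟩
  · rintro ⟨n, k⟩ hnk
    obtain rfl : k = 0 := Subsingleton.elim _ _
    have hn : n ∈ multRel σ α := (h.mem_iff n).mpr ((D.expHom_eq_zero_iff _ _).mp hnk)
    rw [← h.basis.2] at hn
    clear hnk
    induction hn using Submodule.span_induction with
    | mem x hx =>
      obtain ⟨k, rfl⟩ := hx
      exact AddSubgroup.subset_closure ⟨k, rfl⟩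
    | zero => exact AddSubgroup.zero_mem _
    | add x y _ _ hx hy => simpa using AddSubgroup.add_mem _ hx hy
    | smul c x _ hx => simpa using AddSubgroup.zsmul_mem _ hx c

theorem lam_surjective (h : IsAlgCert σ α D ρ v vz) : Function.Surjective D.lam :=
  monomialHom_surjective Function.surjective_id h.expHom_surjective _

theorem lam_shift (h : IsAlgCert σ α D ρ v vz) {σE : RingAut (PRing F r)}
    (hE : IsPExtension σ α σE) (f : PRing F r) : D.lam (σE f) = twist σ h.char (D.lam f) := by
  induction f using AddMonoidAlgebra.induction_linear with
  | zero => simp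
  | add a b ha hb => simp only [map_add, ha, hb]
  | single g c =>
    obtain ⟨n, k⟩ := g
    obtain rfl : k = 0 := Subsingleton.elim _ _
    have hchar := congrArg Units.val (h.char_expHom n 0)
    simp only [Units.val_mul, Units.coe_map, MonoidHom.coe_coe] at hchar
    rw [← algebraMap_mul_mono, map_mul, hE.map_base, hE.map_mono, ← mul_assoc, ← map_mul,
      algebraMap_mul_mono, algebraMap_mul_mono, RepData.lam_single, RepData.lam_single,
      twist_single, ← RepData.expHom_apply D n 0, map_mul, mul_assoc, mul_assoc, hchar]

theorem eq_zero_of_fixed (h : IsAlgCert σ α D ρ v vz)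
    (g : (Fin s → ℤ) × (Fin (if D.d = 1 then 0 else 1) → ZMod D.d)) {x : F} (hx : x ≠ 0)
    (hfix : σ x * h.char (.ofAdd g) = x) : g = 0 := by
  obtain ⟨⟨n, k⟩, rfl⟩ := h.expHom_surjective g
  have hunit : onUnits σ (Units.mk0 x hx) * h.char (.ofAdd (D.expHom (n, k))) = Units.mk0 x hx :=
    Units.ext hfix
  rw [RepData.expHom_eq_zero_iff, ← h.mem_iff, mem_multRel]
  refine ⟨zpowProd D.γ n * (Units.mk0 x hx)⁻¹, ?_⟩
  rw [map_mul, map_inv, ← mul_assoc, ← h.char_expHom n k]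
  nth_rewrite 2 [← hunit]
  rw [mul_inv, mul_mul_mul_comm, mul_inv_cancel, mul_one]

theorem eq_algebraMap_of_fixed (h : IsAlgCert σ α D ρ v vz) (f : HRing F s D.d)
    (hf : twist σ h.char f = f) : ∃ c ∈ constField σ, algebraMap F _ c = f := by
  have hcoeff (g) : σ (f.coeff g) * h.char (.ofAdd g) = f.coeff g := by rw [← coeff_twist, hf]
  have hconst : σ (f.coeff 0) = f.coeff 0 := by simpa using hcoeff 0
  refine ⟨f.coeff 0, hconst, ?_⟩
  rw [algebraMap_eq_single]
  ext g
  rw [coeff_single]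
  by_cases hg : g = 0
  · simp [hg]
  · rw [Finsupp.single_eq_of_ne hg]
    by_contra hne
    exact hg (h.eq_zero_of_fixed g (Ne.symm hne) (hcoeff g))

theorem twist_algebraMap (h : IsAlgCert σ α D ρ v vz) (f : F) :
    twist σ h.char (algebraMap F (HRing F s D.d) f) = algebraMap F _ (σ f) := by
  rw [algebraMap_eq_single, algebraMap_eq_single, twist_single]
  simp

theorem twist_xVar (h : IsAlgCert σ α D ρ v vz) (i : Fin s) :
    twist σ h.char (xVar i : HRing F s D.d) = algebraMap F _ (D.α i : F) * xVar i := by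
  have hchar := h.char_apply (Pi.single i 1) 0
  rw [Int.cast_zero, zpow_zero, mul_one, zpowProd_single, zpow_one] at hchar
  rw [xVar, algebraMap_mul_mono, mono, twist_single, map_one, one_mul]
  exact congrArg (single _) (congrArg Units.val hchar)

theorem twist_zVar (h : IsAlgCert σ α D ρ v vz) (j : Fin (if D.d = 1 then 0 else 1)) :
    twist σ h.char (zVar j : HRing F s D.d) = algebraMap F _ ((ρ : constField σ) : F) * zVar j := by
  have hchar := h.char_apply 0 1
  rw [Int.cast_one, zpowProd_zero, one_mul, zpow_one] at hchar
  rw [zVar, algebraMap_mul_mono, mono, twist_single, single_one_eq, map_one, one_mul]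
  exact congrArg (single _) (congrArg Units.val hchar)

theorem isRPiExtension (h : IsAlgCert σ α D ρ v vz) :
    IsRPiExtension (s := s) (ord := fun _ : Fin (if D.d = 1 then 0 else 1) => D.d) σ
      (twist σ h.char) where
  one_lt_ord j := by
    have hj := j.isLt
    have hd := h.d_pos
    split_ifs at hj <;> omega
  map_base := h.twist_algebraMap
  map_x i := ⟨algebraMap F _ (D.α i : F), Subalgebra.algebraMap_mem _ _,
    algebraMap F _ ((D.α i)⁻¹ : Fˣ), Subalgebra.algebraMap_mem _ _,
    by rw [← map_mul, Units.mul_inv, map_one], h.twist_xVar i⟩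
  map_z j := ⟨ρ, ρ.ne_zero, h.twist_zVar j⟩
  const_eq f := by
    refine ⟨h.eq_algebraMap_of_fixed f, ?_⟩
    rintro ⟨c, hc, rfl⟩
    rw [h.twist_algebraMap, show σ c = c from hc]

theorem lam_mono_n (h : IsAlgCert σ α D ρ v vz) (k : Fin u) :
    D.lam (mono (D.n k) 0) = algebraMap F _ (D.g k : F) := by
  rw [RepData.lam_mono, h.x_n, (ZMod.intCast_zmod_eq_zero_iff_dvd _ _).mpr (h.z_n k), h.g_eq]
  exact mul_one _

theorem ker_lam (h : IsAlgCert σ α D ρ v vz) :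
    RingHom.ker D.lam =
      Ideal.span (Set.range fun i => mono (D.n i) 0 - algebraMap F _ (D.g i : F)) := by
  rw [RepData.lam, ker_monomialHom_eq_span _ h.closure_eq_ker]
  simp only [RepData.coeffChar_apply, h.g_eq]
  rfl

theorem lam_mono_v (h : IsAlgCert σ α D ρ v vz) (j : Fin s) :
    D.lam (mono (v j) 0) = algebraMap F _ (zpowProd D.γ (v j) : Fˣ) * xVar j := by
  rw [RepData.lam_mono, h.x_v, h.zExp_v_cast]
  rfl

theorem lam_mono_vz (h : IsAlgCert σ α D ρ v vz) (j : Fin (if D.d = 1 then 0 else 1)) :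
    D.lam (mono vz 0) = algebraMap F _ (zpowProd D.γ vz : Fˣ) * zVar j := by
  rw [RepData.lam_mono, h.x_vz, h.zExp_vz_cast, zVar, single_one_eq]

theorem smul_vz_mem_iff (h : IsAlgCert σ α D ρ v vz) (k : ℕ) :
    (k : ℤ) • vz ∈ multRel σ α ↔ D.d ∣ k := by
  rw [h.mem_iff, map_zsmul, map_zsmul, h.x_vz, smul_zero, smul_eq_mul, ← Int.natCast_dvd_natCast,
    (dvd_iff_dvd_of_dvd_sub (a := (D.d : ℤ)) (b := k * D.zExp vz) (c := k) ?_)]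
  · exact and_iff_right rfl
  · simpa [mul_sub] using h.z_vz.mul_left (k : ℤ)

theorem isMinimal (h : IsAlgCert σ α D ρ v vz) {σE : RingAut (PRing F r)}
    (hE : IsPExtension σ α σE) {τ₀ : F →+* SeqRing (constField σ)}
    {τE : PRing F r →+* SeqRing (constField σ)} (hbase : ∀ f : F, τE (algebraMap F _ f) = τ₀ f) :
    IsMinimal σ τ₀ σE τE s D.d :=
  isMinimal_of_multRel hE hbase (M := D.xExp) (fun n hn => ((h.mem_iff n).mp hn).1)
    (fun n => ⟨_, h.xExp_sum_v n⟩) h.smul_vz_mem_iff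

end IsAlgCert

namespace IsCert

variable {α : Fin r → Fˣ} {τ₀ : F →+* SeqRing (constField σ)}
  {τE : PRing F r →+* SeqRing (constField σ)} {D : RepData F r s u} {ρ : (constField σ)ˣ}
  {v : Fin s → Fin r → ℤ} {vz : Fin r → ℤ}

theorem ker_lam_le_ker (h : IsCert σ α τ₀ τE D ρ v vz)
    (hbase : ∀ f : F, τE (algebraMap F _ f) = τ₀ f) : RingHom.ker D.lam ≤ RingHom.ker τE := by
  rw [h.ker_lam, Ideal.span_le]
  rintro _ ⟨k, rfl⟩
  rw [SetLike.mem_coe, RingHom.mem_ker, map_sub, h.tau_n, hbase, sub_self]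

/-- The homomorphism from `H` to the ring of sequences that is induced by `τE` on the quotient `H`
of the `P`-extension. -/
def seqHom (h : IsCert σ α τ₀ τE D ρ v vz) (hbase : ∀ f : F, τE (algebraMap F _ f) = τ₀ f) :
    HRing F s D.d →+* SeqRing (constField σ) :=
  D.lam.liftOfSurjective h.lam_surjective ⟨τE, h.ker_lam_le_ker hbase⟩

variable (h : IsCert σ α τ₀ τE D ρ v vz) (hbase : ∀ f : F, τE (algebraMap F _ f) = τ₀ f)
  {σE : RingAut (PRing F r)} (hE : IsPExtension σ α σE) (hτE : IsKHom σ σE τE)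

theorem seqHom_lam (f : PRing F r) : h.seqHom hbase (D.lam f) = τE f :=
  RingHom.liftOfRightInverse_comp_apply _ _ (Function.rightInverse_surjInv h.lam_surjective)
    ⟨τE, h.ker_lam_le_ker hbase⟩ f

theorem seqHom_algebraMap (f : F) : h.seqHom hbase (algebraMap F _ f) = τ₀ f := by
  rw [← RepData.lam_base, seqHom_lam, hbase]

theorem seqHom_xVar (j : Fin s) :
    h.seqHom hbase (xVar j) =
      τE (algebraMap F _ ((zpowProd D.γ (v j))⁻¹ : Fˣ) * mono (v j) 0) := by
  rw [← h.seqHom_lam hbase, map_mul, RepData.lam_base, h.lam_mono_v, ← mul_assoc, ← map_mul,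
    Units.inv_mul, map_one, one_mul]

theorem seqHom_zVar (j : Fin (if D.d = 1 then 0 else 1)) :
    h.seqHom hbase (zVar j) = toSeq fun n => (ρ : constField σ) ^ n := by
  have hvz := h.seqHom_lam hbase (mono vz 0)
  rw [h.lam_mono_vz j, map_mul, seqHom_algebraMap, h.tau_vz] at hvz
  exact ((Units.isUnit _).map τ₀).mul_left_cancel hvz

include hE hτE

theorem seqHom_shift (f : HRing F s D.d) :
    h.seqHom hbase (twist σ h.char f) = shift (h.seqHom hbase f) := by
  obtain ⟨x, rfl⟩ := h.lam_surjective f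
  rw [← h.lam_shift hE, seqHom_lam, seqHom_lam, hτE.map_shift]

theorem isKEmbedding_seqHom : IsKEmbedding σ (twist σ h.char) (h.seqHom hbase) where
  map_shift := h.seqHom_shift hbase hE hτE
  map_const c := by rw [seqHom_algebraMap, ← hbase, hτE.map_const]
  injective :=
    injective_of_constants_scalar
      (fun f hf => (h.eq_algebraMap_of_fixed f hf).imp fun _ hc => hc.2.symm) _
      fun f hf => by rw [h.seqHom_shift hbase hE hτE, hf]; rfl

theorem isOptimalRep :
    IsOptimalRep σ τ₀ σE τE D (twist σ h.char) (h.seqHom hbase) D.lam where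
  rpi := h.isRPiExtension
  embedding := h.isKEmbedding_seqHom hbase hE hτE
  embedding_base := h.seqHom_algebraMap hbase
  lam_shift := h.lam_shift hE
  lam_surjective := h.lam_surjective
  commutes := h.seqHom_lam hbase
  map_x := h.twist_xVar
  map_z j := ⟨h.rho ▸ (ρ : constField σ).2, h.rho ▸ h.twist_zVar j⟩
  lam_base := D.lam_base
  o_lt := h.o_lt
  lam_x := D.lam_xVar
  minimal := h.isMinimal hE hbase
  n_indep := h.basis.1
  lam_n := h.lam_mono_n
  ker_eq := by
    ext f
    rw [RingHom.mem_ker, RingHom.mem_ker, ← h.seqHom_lam hbase,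
      map_eq_zero_iff _ (h.isKEmbedding_seqHom hbase hE hτE).injective]
  ker_lam := h.ker_lam

end IsCert

end Certificates

/-! ### Existence of certificates -/

section Coordinates

theorem RowsAreBasis.finrank_eq {r u : ℕ} {V : Submodule ℤ (Fin r → ℤ)}
    {Z : Matrix (Fin u) (Fin r) ℤ} (h : RowsAreBasis V Z) : Module.finrank ℤ V = u := by
  rw [← h.2, finrank_span_eq_card h.1, Fintype.card_fin]

theorem RowsAreBasis.le {r u : ℕ} {V : Submodule ℤ (Fin r → ℤ)}
    {Z : Matrix (Fin u) (Fin r) ℤ} (h : RowsAreBasis V Z) : u ≤ r := by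
  simpa using h.1.fintype_card_le_finrank

theorem RowsAreBasis.row_mem {r u : ℕ} {V : Submodule ℤ (Fin r → ℤ)}
    {Z : Matrix (Fin u) (Fin r) ℤ} (h : RowsAreBasis V Z) (k : Fin u) : Z k ∈ V :=
  h.2 ▸ Submodule.subset_span ⟨k, rfl⟩

theorem RowsAreBasis.mem_iff {r u : ℕ} {V : Submodule ℤ (Fin r → ℤ)}
    {Z : Matrix (Fin u) (Fin r) ℤ} (h : RowsAreBasis V Z) (n : Fin r → ℤ) :
    n ∈ V ↔ ∃ c : Fin u → ℤ, Matrix.vecMul c Z = n := by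
  rw [← h.2, Submodule.mem_span_range_iff_exists_fun]
  refine exists_congr fun c => ?_
  rw [Matrix.vecMul_eq_sum]
  rfl

/-- The coordinate change `n ↦ n B` of `ℤ^{u+s}`, with inverse `y ↦ y C`, maps the submodule `V`
onto the vectors `(δ₁ c₁, …, δ_u c_u, 0, …, 0)`. -/
structure IsDiagonalization {u s : ℕ} (V : Submodule ℤ (Fin (u + s) → ℤ))
    (B C : Matrix (Fin (u + s)) (Fin (u + s)) ℤ) (δ : Fin u → ℕ) : Prop where
  mul_inv : B * C = 1
  inv_mul : C * B = 1
  mem_iff : ∀ n, n ∈ V ↔ (∀ i, (δ i : ℤ) ∣ Matrix.vecMul n B (Fin.castAdd s i)) ∧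
    ∀ j, Matrix.vecMul n B (Fin.natAdd u j) = 0

theorem vecMul_diagonal_eq_append {u s : ℕ} (δ : Fin u → ℕ) (c : Fin u → ℤ) :
    Matrix.vecMul c (Matrix.of fun (i : Fin u) (j : Fin (u + s)) =>
      if i.val = j.val then (δ i : ℤ) else 0) = Fin.append (fun i => c i * δ i) 0 := by
  funext j
  refine Fin.addCases (fun i => ?_) (fun j => ?_) j
  · simp [Matrix.vecMul, dotProduct, Fin.val_inj]
  · have hne (k : Fin u) : (k : ℕ) ≠ u + j := by omega
    simp [Matrix.vecMul, dotProduct, hne]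

theorem IsLargestDivisor.exists_isDiagonalization {u s d : ℕ}
    {V : Submodule ℤ (Fin (u + s) → ℤ)} (hd : IsLargestDivisor V d)
    (hV : Module.finrank ℤ V = u) :
    ∃ B C δ, IsDiagonalization V B C δ ∧ (∀ i, 0 < δ i) ∧ (∀ i, δ i ∣ d) ∧ ∃ i, δ i = d := by
  obtain ⟨u', hu, Z, A, B, δ, hZ, hA, hB, hAZB, hpos, hdvd, hdδ⟩ := hd
  obtain rfl : u' = u := by rw [← hV, hZ.finrank_eq]
  refine ⟨B, B⁻¹, δ, ⟨Matrix.mul_nonsing_inv B hB, Matrix.nonsing_inv_mul B hB, fun n => ?_⟩, hpos,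
    fun i => hdδ ▸ hdvd i _ (Fin.le_def.mpr (by simp; omega)), _, hdδ.symm⟩
  have hcoord (c : Fin u' → ℤ) : Matrix.vecMul c Z = n ↔
      Matrix.vecMul n B = Fin.append (fun i => Matrix.vecMul c A⁻¹ i * δ i) 0 := by
    rw [← vecMul_diagonal_eq_append, ← hAZB, Matrix.vecMul_vecMul, ← Matrix.mul_assoc,
      ← Matrix.mul_assoc, Matrix.nonsing_inv_mul A hA, Matrix.one_mul, ← Matrix.vecMul_vecMul,
      (Matrix.vecMul_injective_of_isUnit ((Matrix.isUnit_iff_isUnit_det B).mpr hB)).eq_iff, eq_comm]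
  rw [hZ.mem_iff]
  simp only [hcoord]
  constructor
  · rintro ⟨c, hc⟩
    simp [hc]
  · rintro ⟨hleft, hright⟩
    choose c hc using hleft
    refine ⟨Matrix.vecMul c A, ?_⟩
    rw [Matrix.vecMul_vecMul, Matrix.mul_nonsing_inv A hA, Matrix.vecMul_one]
    funext j
    refine Fin.addCases (fun i => ?_) (fun j => ?_) j
    · rw [hc, Fin.append_left, mul_comm]
    · rw [hright, Fin.append_right, Pi.zero_apply]

namespace IsDiagonalization

variable {u s : ℕ} {V : Submodule ℤ (Fin (u + s) → ℤ)}
  {B C : Matrix (Fin (u + s)) (Fin (u + s)) ℤ} {δ : Fin u → ℕ}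

theorem vecMul_inv_row (h : IsDiagonalization V B C δ) (k : Fin (u + s)) :
    Matrix.vecMul (C k) B = Pi.single k 1 := by
  funext j
  have hkj := congrFun (congrFun h.inv_mul k) j
  rwa [Matrix.one_eq_pi_single] at hkj

theorem vecMul_vecMul (h : IsDiagonalization V B C δ) (n : Fin (u + s) → ℤ) :
    Matrix.vecMul (Matrix.vecMul n B) C = n := by
  rw [Matrix.vecMul_vecMul, h.mul_inv, Matrix.vecMul_one]

theorem smul_inv_row_mem_iff (h : IsDiagonalization V B C δ) (i : Fin u) (c : ℤ) :
    c • C (Fin.castAdd s i) ∈ V ↔ (δ i : ℤ) ∣ c := by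
  rw [h.mem_iff, Matrix.smul_vecMul, h.vecMul_inv_row]
  constructor
  · exact fun hmem => by simpa using hmem.1 i
  · refine fun hc => ⟨fun k => ?_, fun j => ?_⟩
    · obtain rfl | hk := eq_or_ne k i
      · simpa using hc
      · simp [hk]
    · simp [Pi.single_apply, Fin.ext_iff]
      omega

theorem hom_eq_mul {G : Type*} [CommGroup G] (h : IsDiagonalization V B C δ)
    (f : Multiplicative (Fin (u + s) → ℤ) →* G) (n : Fin (u + s) → ℤ) :
    f (.ofAdd n) =
      zpowProd (fun i => f (.ofAdd (C (Fin.castAdd s i))))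
          (fun i => Matrix.vecMul n B (Fin.castAdd s i)) *
        zpowProd (fun j => f (.ofAdd (C (Fin.natAdd u j))))
          (fun j => Matrix.vecMul n B (Fin.natAdd u j)) := by
  conv_lhs => rw [← h.vecMul_vecMul n, hom_vecMul]
  exact Fin.prod_univ_add _

end IsDiagonalization

end Coordinates

section Sequences

variable {F : Type*} [Field F] {σ : RingAut F} {r : ℕ} {α : Fin r → Fˣ}
  {τ₀ : F →+* SeqRing (constField σ)} {σE : RingAut (PRing F r)}
  {τE : PRing F r →+* SeqRing (constField σ)}

/-- The images of the monomials as units. -/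
def monoSeq (τE : PRing F r →+* SeqRing (constField σ)) :
    Multiplicative (Fin r → ℤ) →* (SeqRing (constField σ))ˣ :=
  (Units.map (τE : PRing F r →* SeqRing (constField σ))).comp monoUnit

/-- The images of the nonzero elements of `F` as units. -/
abbrev baseSeq (τ₀ : F →+* SeqRing (constField σ)) : Fˣ →* (SeqRing (constField σ))ˣ :=
  Units.map (τ₀ : F →* SeqRing (constField σ))

theorem shift_baseSeq (hτ₀ : IsKHom σ σ τ₀) (f : Fˣ) :
    Units.map shiftHom (baseSeq τ₀ f) = baseSeq τ₀ (onUnits σ f) :=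
  Units.ext (hτ₀.map_shift f).symm

theorem baseSeq_rootUnit (hτ₀ : IsKHom σ σ τ₀) (c : (constField σ)ˣ) :
    baseSeq τ₀ (rootUnit c) = constSeq c :=
  Units.ext (hτ₀.map_const c)

theorem shift_monoSeq (hE : IsPExtension σ α σE) (hτE : IsKHom σ σE τE)
    (hbase : ∀ f : F, τE (algebraMap F _ f) = τ₀ f) (n : Fin r → ℤ) :
    Units.map shiftHom (monoSeq τE (.ofAdd n)) =
      baseSeq τ₀ (zpowProd α n) * monoSeq τE (.ofAdd n) := by
  refine Units.ext ?_
  change shift (τE (mono n 0)) = τ₀ (zpowProd α n : Fˣ) * τE (mono n 0)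
  rw [← hτE.map_shift, hE.map_mono, map_mul, hbase]

theorem RadicalStable.exists_root (hσ : RadicalStable σ) {a : Fˣ} {m : ℕ} (hm : 0 < m)
    (ha : InHomogGroup σ ((a ^ m : Fˣ) : F)) :
    ∃ (η : (constField σ)ˣ) (g : Fˣ), η ^ m = 1 ∧ onUnits σ g * rootUnit η = a * g := by
  rw [Units.val_pow_eq_pow_val] at ha
  obtain ⟨ρ, hρ, hρm, g, hg, haρ⟩ := hσ a m a.ne_zero hm ha
  have hρ0 : ρ ≠ 0 := by
    rintro rfl
    rw [zero_pow hm.ne'] at hρm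
    exact zero_ne_one hρm
  let ρ' : (constField σ)ˣ := Units.mk0 ⟨ρ, hρ⟩ (by simpa [Subtype.ext_iff] using hρ0)
  have hρ' : ρ' ^ m = 1 := Units.ext (Subtype.ext hρm)
  refine ⟨ρ'⁻¹, Units.mk0 g hg, by rw [inv_pow, hρ', inv_one], ?_⟩
  rw [rootUnit, map_inv, mul_inv_eq_iff_eq_mul]
  refine Units.ext ?_
  change σ g = a * g * ρ
  rw [eq_div_iff hg] at haρ
  rw [← haρ, mul_right_comm]

theorem exists_constSeq_mul_eq_monoSeq (hτ₀ : IsKHom σ σ τ₀) (hE : IsPExtension σ α σE)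
    (hτE : IsKHom σ σE τE) (hbase : ∀ f : F, τE (algebraMap F _ f) = τ₀ f) {n : Fin r → ℤ}
    {η : (constField σ)ˣ} {g : Fˣ} (hg : onUnits σ g * rootUnit η = zpowProd α n * g) :
    ∃ κ : (constField σ)ˣ,
      monoSeq τE (.ofAdd n) = constSeq κ * (baseSeq τ₀ g * geomSeq η) := by
  have hshift : Units.map shiftHom (baseSeq τ₀ g * geomSeq η) =
      baseSeq τ₀ (zpowProd α n) * (baseSeq τ₀ g * geomSeq η) := by
    rw [map_mul, shift_baseSeq hτ₀, shift_geomSeq, ← baseSeq_rootUnit hτ₀, ← mul_assoc, ← map_mul,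
      hg, map_mul, mul_assoc]
  obtain ⟨κ, hκ⟩ := exists_constSeq_of_shift_eq
    (x := monoSeq τE (.ofAdd n) / (baseSeq τ₀ g * geomSeq η)) (by
      rw [map_div, hshift, shift_monoSeq hE hτE hbase, mul_div_mul_left_eq_div])
  exact ⟨κ, div_eq_iff_eq_mul.mp hκ⟩

theorem exists_monoSeq_eq (hσ : RadicalStable σ) (hτ₀ : IsKHom σ σ τ₀) (hE : IsPExtension σ α σE)
    (hτE : IsKHom σ σE τE) (hbase : ∀ f : F, τE (algebraMap F _ f) = τ₀ f) {n : Fin r → ℤ} {m : ℕ}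
    (hm : 0 < m) (hn : (m : ℤ) • n ∈ multRel σ α) :
    ∃ (η : (constField σ)ˣ) (γ : Fˣ), η ^ m = 1 ∧ onUnits σ γ * rootUnit η = zpowProd α n * γ ∧
      monoSeq τE (.ofAdd n) = baseSeq τ₀ γ * geomSeq η := by
  have hpow : InHomogGroup σ ((zpowProd α n ^ m : Fˣ) : F) := by
    rw [← zpow_natCast, ← zpowProd_zsmul, val_zpowProd]
    exact hn
  obtain ⟨η, g, hη, hg⟩ := hσ.exists_root hm hpow
  obtain ⟨κ, hκ⟩ := exists_constSeq_mul_eq_monoSeq hτ₀ hE hτE hbase hg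
  refine ⟨η, rootUnit κ * g, hη, ?_, ?_⟩
  · rw [map_mul, onUnits_rootUnit, mul_assoc, hg, mul_left_comm]
  · rw [map_mul, baseSeq_rootUnit hτ₀, hκ, mul_assoc]

end Sequences

section CertificateExistence

variable {F : Type*} [Field F] {σ : RingAut F} {u s d : ℕ} {α : Fin (u + s) → Fˣ}
  {τ₀ : F →+* SeqRing (constField σ)} {τE : PRing F (u + s) →+* SeqRing (constField σ)}
  {B C : Matrix (Fin (u + s)) (Fin (u + s)) ℤ} {δ : Fin u → ℕ} {ζ : (constField σ)ˣ}
  {c : Fin u → ℕ} {γ : Fin u → Fˣ}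

/-- A diagonalization `(B, C, δ)` of the module of relations, together with solutions
`γ i * ζ ^ (c i * n)` of the recurrences of the products with exponent vectors
`C (Fin.castAdd s i)`, where `ζ` is a `d`-th root of unity. -/
structure IsDiagonalSolution (σ : RingAut F) (α : Fin (u + s) → Fˣ)
    (τ₀ : F →+* SeqRing (constField σ)) (τE : PRing F (u + s) →+* SeqRing (constField σ))
    (B C : Matrix (Fin (u + s)) (Fin (u + s)) ℤ) (δ : Fin u → ℕ) (d : ℕ) (ζ : (constField σ)ˣ)
    (c : Fin u → ℕ) (γ : Fin u → Fˣ) : Prop extends IsDiagonalization (multRel σ α) B C δ where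
  d_pos : 0 < d
  zeta_pow : ζ ^ d = 1
  dvd_mul : ∀ i, d ∣ δ i * c i
  shift_eq : ∀ i, onUnits σ (γ i) * rootUnit (ζ ^ c i) = zpowProd α (C (Fin.castAdd s i)) * γ i
  seq_eq : ∀ i, monoSeq τE (.ofAdd (C (Fin.castAdd s i))) = baseSeq τ₀ (γ i) * geomSeq (ζ ^ c i)

/-- The representation read off a diagonalization: the `Π`-monomials correspond to the last `s`
coordinates, while the first `u` coordinates contribute the coefficients `γ` and powers of the
`R`-monomial. -/
def diagonalRep (α : Fin (u + s) → Fˣ) (B C : Matrix (Fin (u + s)) (Fin (u + s)) ℤ) (d : ℕ)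
    (ζ : (constField σ)ˣ) (c : Fin u → ℕ) (γ : Fin u → Fˣ) (n : Matrix (Fin u) (Fin (u + s)) ℤ) :
    RepData F (u + s) s u where
  d := d
  α j := zpowProd α (C (Fin.natAdd u j))
  ρ := rootUnit ζ
  γ i := zpowProd γ fun k => B i (Fin.castAdd s k)
  o i := ((∑ k, B i (Fin.castAdd s k) * c k) % d).toNat
  m i j := B i (Fin.natAdd u j)
  n := n
  g k := zpowProd γ fun i => Matrix.vecMul (n k) B (Fin.castAdd s i)

section DiagonalRep

variable (α B C ζ c γ) (n : Matrix (Fin u) (Fin (u + s)) ℤ)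

theorem diagonalRep_xExp (w : Fin (u + s) → ℤ) :
    (diagonalRep α B C d ζ c γ n).xExp w = fun j => Matrix.vecMul w B (Fin.natAdd u j) := rfl

theorem zpowProd_diagonalRep_γ (w : Fin (u + s) → ℤ) :
    zpowProd (diagonalRep α B C d ζ c γ n).γ w =
      zpowProd γ fun k => Matrix.vecMul w B (Fin.castAdd s k) :=
  (zpowProd_vecMul γ w (B.submatrix id (Fin.castAdd s))).symm

theorem diagonalRep_o_cast (hd : 0 < d) (i : Fin (u + s)) :
    ((diagonalRep α B C d ζ c γ n).o i : ℤ) = (∑ k, B i (Fin.castAdd s k) * c k) % d :=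
  Int.toNat_of_nonneg (Int.emod_nonneg _ (by exact_mod_cast hd.ne'))

theorem diagonalRep_o_lt (hd : 0 < d) (i : Fin (u + s)) :
    (diagonalRep α B C d ζ c γ n).o i < d := by
  have hlt := Int.emod_lt_of_pos (∑ k, B i (Fin.castAdd s k) * c k)
    (by exact_mod_cast hd : (0 : ℤ) < d)
  rw [← diagonalRep_o_cast α B C ζ c γ n hd] at hlt
  exact_mod_cast hlt

theorem dvd_diagonalRep_zExp_sub (hd : 0 < d) (w : Fin (u + s) → ℤ) :
    (d : ℤ) ∣ (diagonalRep α B C d ζ c γ n).zExp w -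
      ∑ k, Matrix.vecMul w B (Fin.castAdd s k) * c k := by
  have hsum : ∑ k, Matrix.vecMul w B (Fin.castAdd s k) * c k =
      ∑ i, w i * ∑ k, B i (Fin.castAdd s k) * c k := by
    simp only [Matrix.vecMul, dotProduct, Finset.sum_mul, Finset.mul_sum, mul_assoc]
    exact Finset.sum_comm
  rw [hsum, RepData.zExp_apply, ← Finset.sum_sub_distrib]
  refine Finset.dvd_sum fun i _ => ?_
  rw [← mul_sub, diagonalRep_o_cast α B C ζ c γ n hd]
  exact (Int.mod_modEq _ _).symm.dvd.mul_left _

end DiagonalRep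

namespace IsDiagonalSolution

theorem compat (h : IsDiagonalSolution σ α τ₀ τE B C δ d ζ c γ)
    (n : Matrix (Fin u) (Fin (u + s)) ℤ) (i : Fin (u + s)) :
    letI D := diagonalRep α B C d ζ c γ n
    onUnits σ (D.γ i) * (zpowProd D.α (D.m i) * rootUnit ζ ^ D.o i) = α i * D.γ i := by
  set D := diagonalRep α B C d ζ c γ n
  let y : Fin u → ℤ := fun k => B i (Fin.castAdd s k)
  have hα : α i = zpowProd (fun k => zpowProd α (C (Fin.castAdd s k))) y *
      zpowProd D.α (D.m i) := by
    have hi := h.hom_eq_mul (zpowProdHom α) (Pi.single i 1)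
    rw [Matrix.single_one_vecMul] at hi
    exact ((zpowProd_single α i 1).trans (zpow_one _)).symm.trans hi
  have hroot : rootUnit ζ ^ D.o i = zpowProd (fun k => rootUnit (ζ ^ c k)) y := by
    have hdvd : (d : ℤ) ∣ D.o i - ∑ k, y k * c k := by
      rw [diagonalRep_o_cast α B C ζ c γ n h.d_pos]
      exact (Int.mod_modEq _ _).symm.dvd
    simp only [rootUnit, map_pow, zpowProd_pow_const]
    rw [← zpow_natCast, ← mul_inv_eq_one, ← zpow_sub]
    exact rootUnit_zpow_of_dvd h.zeta_pow hdvd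
  have hcoord : zpowProd (fun k => onUnits σ (γ k)) y * zpowProd (fun k => rootUnit (ζ ^ c k)) y =
      zpowProd (fun k => zpowProd α (C (Fin.castAdd s k))) y * zpowProd γ y := by
    rw [← zpowProd_mul, ← zpowProd_mul]
    exact congrArg (zpowProd · y) (funext h.shift_eq)
  change onUnits σ (zpowProd γ y) * _ = α i * zpowProd γ y
  rw [hroot, map_zpowProd, mul_left_comm, hcoord, hα]
  ac_rfl

theorem monoSeq_eq_of_mem (h : IsDiagonalSolution σ α τ₀ τE B C δ d ζ c γ)
    {w : Fin (u + s) → ℤ} (hw : w ∈ multRel σ α) :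
    monoSeq τE (.ofAdd w) =
      baseSeq τ₀ (zpowProd γ fun k => Matrix.vecMul w B (Fin.castAdd s k)) := by
  obtain ⟨hdvd, hzero⟩ := (h.mem_iff w).mp hw
  set y : Fin u → ℤ := fun k => Matrix.vecMul w B (Fin.castAdd s k)
  have hroot : zpowProd (fun k => ζ ^ c k) y = 1 := by
    refine Finset.prod_eq_one fun k _ => ?_
    obtain ⟨a, ha⟩ := hdvd k
    obtain ⟨b, hb⟩ := h.dvd_mul k
    change (ζ ^ c k) ^ y k = 1
    rw [show y k = δ k * a from ha, zpow_mul, zpow_natCast, ← pow_mul, mul_comm, hb, pow_mul,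
      h.zeta_pow, one_pow, one_zpow]
  rw [h.hom_eq_mul]
  simp only [hzero]
  rw [show (fun _ : Fin s => (0 : ℤ)) = 0 from rfl, zpowProd_zero, mul_one,
    show (fun i => monoSeq τE (.ofAdd (C (Fin.castAdd s i)))) =
      (fun i => baseSeq τ₀ (γ i)) * fun i => geomSeq (ζ ^ c i) from funext h.seq_eq,
    zpowProd_mul, ← map_zpowProd, ← map_zpowProd geomSeq (fun i => ζ ^ c i), hroot, map_one,
    mul_one]

theorem isAlgCert (h : IsDiagonalSolution σ α τ₀ τE B C δ d ζ c γ)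
    {n : Matrix (Fin u) (Fin (u + s)) ℤ} (hn : RowsAreBasis (multRel σ α) n) {i : Fin u}
    (hi : c i = 1) :
    IsAlgCert σ α (diagonalRep α B C d ζ c γ n) ζ (fun j => C (Fin.natAdd u j))
      (C (Fin.castAdd s i)) where
  basis := hn
  d_pos := h.d_pos
  o_lt := diagonalRep_o_lt α B C ζ c γ n h.d_pos
  rho := rfl
  rho_pow := h.zeta_pow
  compat k := by
    rw [← val_zpowProd]
    exact congrArg Units.val (h.compat n k)
  x_n k := funext ((h.mem_iff _).mp (hn.row_mem k)).2
  z_n k := by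
    refine (dvd_iff_dvd_of_dvd_sub (dvd_diagonalRep_zExp_sub α B C ζ c γ n h.d_pos _)).mpr
      (Finset.dvd_sum fun k' _ => ?_)
    have hk : (d : ℤ) ∣ δ k' * c k' := by exact_mod_cast h.dvd_mul k'
    exact hk.trans (mul_dvd_mul_right (((h.mem_iff _).mp (hn.row_mem k)).1 k') _)
  x_v j := by
    rw [diagonalRep_xExp, h.vecMul_inv_row]
    funext j'
    simp [Pi.single_apply]
  z_v j := by
    refine (dvd_iff_dvd_of_dvd_sub (dvd_diagonalRep_zExp_sub α B C ζ c γ n h.d_pos _)).mpr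
      (Finset.dvd_sum fun k _ => ?_)
    have hne : Fin.castAdd s k ≠ Fin.natAdd u j := by simp [Fin.ext_iff]; omega
    simp [h.vecMul_inv_row, hne]
  x_vz := by
    rw [diagonalRep_xExp, h.vecMul_inv_row]
    funext j
    simp [Pi.single_apply, Fin.ext_iff]
    omega
  z_vz := by
    change (d : ℤ) ∣ _
    have hz := dvd_diagonalRep_zExp_sub α B C ζ c γ n h.d_pos (C (Fin.castAdd s i))
    simpa [h.vecMul_inv_row, Pi.single_apply, hi] using hz
  g_eq k := (zpowProd_diagonalRep_γ α B C ζ c γ n (n k)).symm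

theorem isCert (h : IsDiagonalSolution σ α τ₀ τE B C δ d ζ c γ)
    {n : Matrix (Fin u) (Fin (u + s)) ℤ} (hn : RowsAreBasis (multRel σ α) n) {i : Fin u}
    (hi : c i = 1) :
    IsCert σ α τ₀ τE (diagonalRep α B C d ζ c γ n) ζ (fun j => C (Fin.natAdd u j))
      (C (Fin.castAdd s i)) where
  toIsAlgCert := h.isAlgCert hn hi
  tau_n k := congrArg Units.val (h.monoSeq_eq_of_mem (hn.row_mem k))
  tau_vz := by
    have hγ : zpowProd (diagonalRep α B C d ζ c γ n).γ (C (Fin.castAdd s i)) = γ i := by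
      rw [zpowProd_diagonalRep_γ, h.vecMul_inv_row]
      have hsingle : (fun k => (Pi.single (Fin.castAdd s i) 1 : Fin (u + s) → ℤ)
          (Fin.castAdd s k)) = Pi.single i 1 := by
        funext k
        simp [Pi.single_apply]
      rw [hsingle, zpowProd_single, zpow_one]
    have hseq := congrArg Units.val (h.seq_eq i)
    rw [hi, pow_one] at hseq
    rw [hγ]
    exact hseq

end IsDiagonalSolution

theorem IsDiagonalization.isPrimitiveRoot (h : IsDiagonalization (multRel σ α) B C δ)
    {i : Fin u} {η : (constField σ)ˣ} {g : Fˣ} (hη : η ^ δ i = 1)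
    (hg : onUnits σ g * rootUnit η = zpowProd α (C (Fin.castAdd s i)) * g) :
    IsPrimitiveRoot η (δ i) := by
  refine ⟨hη, fun l hl => ?_⟩
  have hmem : (l : ℤ) • C (Fin.castAdd s i) ∈ multRel σ α := by
    have hgl := congrArg (· ^ l) hg
    simp only [mul_pow] at hgl
    rw [rootUnit, ← map_pow (Units.map _) η, hl, map_one, mul_one] at hgl
    exact mem_multRel.mpr ⟨g ^ l, by rw [map_pow, hgl, zpowProd_zsmul, zpow_natCast]⟩
  exact_mod_cast (h.smul_inv_row_mem_iff i l).mp hmem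

theorem exists_pow_eq_of_isPrimitiveRoot {K ι : Type*} [Field K] {δ : ι → ℕ}
    {η : ι → Kˣ} (hη : ∀ i, η i ^ δ i = 1) {d : ℕ} (hd : 0 < d) (hδ : ∀ i, δ i ∣ d) {i₀ : ι}
    (hprim : IsPrimitiveRoot (η i₀) d) :
    ∃ c : ι → ℕ, (∀ i, η i₀ ^ c i = η i) ∧ c i₀ = 1 := by
  classical
  have : NeZero d := ⟨hd.ne'⟩
  have hex (i : ι) : ∃ c : ℕ, η i₀ ^ c = η i := by
    have hpow : (η i : K) ^ d = 1 := by
      obtain ⟨k, rfl⟩ := hδ i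
      rw [pow_mul, ← Units.val_pow_eq_pow_val, hη, Units.val_one, one_pow]
    obtain ⟨c, -, hc⟩ := (IsPrimitiveRoot.coe_units_iff.mpr hprim).eq_pow_of_pow_eq_one hpow
    exact ⟨c, Units.ext (by simpa using hc)⟩
  choose c hc using hex
  refine ⟨Function.update c i₀ 1, fun i => ?_, Function.update_self ..⟩
  obtain rfl | hi := eq_or_ne i i₀
  · rw [Function.update_self, pow_one]
  · rw [Function.update_of_ne hi, hc]

theorem exists_isDiagonalSolution (hσ : RadicalStable σ) (hτ₀ : IsKHom σ σ τ₀)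
    {σE : RingAut (PRing F (u + s))} (hE : IsPExtension σ α σE) (hτE : IsKHom σ σE τE)
    (hbase : ∀ f : F, τE (algebraMap F _ f) = τ₀ f) (hd : IsLargestDivisor (multRel σ α) d)
    (hu : Module.finrank ℤ (multRel σ α) = u) :
    ∃ B C δ ζ c γ, IsDiagonalSolution σ α τ₀ τE B C δ d ζ c γ ∧ ∃ i, c i = 1 := by
  obtain ⟨B, C, δ, hdiag, hδ, hδd, i₀, hi₀⟩ := hd.exists_isDiagonalization hu
  choose η γ hη hγ hseq using fun i : Fin u =>
    exists_monoSeq_eq hσ hτ₀ hE hτE hbase (hδ i)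
      ((hdiag.smul_inv_row_mem_iff i (δ i)).mpr dvd_rfl)
  have hprim : IsPrimitiveRoot (η i₀) d := hi₀ ▸ hdiag.isPrimitiveRoot (hη i₀) (hγ i₀)
  have hd0 : 0 < d := hi₀ ▸ hδ i₀
  obtain ⟨c, hc, hci₀⟩ := exists_pow_eq_of_isPrimitiveRoot hη hd0 hδd hprim
  exact ⟨B, C, δ, η i₀, c, γ,
    { toIsDiagonalization := hdiag
      d_pos := hd0
      zeta_pow := hprim.pow_eq_one
      dvd_mul := fun i => hprim.dvd_of_pow_eq_one _ (by rw [mul_comm, pow_mul, hc, hη])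
      shift_eq := fun i => by rw [hc, hγ]
      seq_eq := fun i => by rw [hc, hseq] }, i₀, hci₀⟩

theorem exists_isCert (hσ : RadicalStable σ) (hτ₀ : IsKHom σ σ τ₀)
    {σE : RingAut (PRing F (u + s))} (hE : IsPExtension σ α σE) (hτE : IsKHom σ σE τE)
    (hbase : ∀ f : F, τE (algebraMap F _ f) = τ₀ f) (hd : IsLargestDivisor (multRel σ α) d)
    {n : Matrix (Fin u) (Fin (u + s)) ℤ} (hn : RowsAreBasis (multRel σ α) n) :
    ∃ D : RepData F (u + s) s u,
      D.n = n ∧ D.d = d ∧ ∃ ρ v vz, IsCert σ α τ₀ τE D ρ v vz := by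
  obtain ⟨B, C, δ, ζ, c, γ, hsol, i, hi⟩ :=
    exists_isDiagonalSolution hσ hτ₀ hE hτE hbase hd hn.finrank_eq
  exact ⟨diagonalRep α B C d ζ c γ n, rfl, rfl, ζ, _, _, hsol.isCert hn hi⟩

end CertificateExistence

/-! ### Smith normal forms of submodules of `ℤ^r` -/

section TwoByTwo

variable {R ι M : Type*} [CommRing R] [AddCommGroup M] [Module R M] {v v' : ι → M} {i j : ι}
  {p q p' q' : R}

theorem span_range_le_of_two (h : ∀ k, k ≠ i → k ≠ j → v' k = v k)
    (hi : v' i = p • v i + q • v j) (hj : v' j = p' • v i + q' • v j) :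
    Submodule.span R (Set.range v') ≤ Submodule.span R (Set.range v) := by
  have hv : ∀ k, v k ∈ Submodule.span R (Set.range v) := fun k => Submodule.subset_span ⟨k, rfl⟩
  have hv₂ : ∀ a b : R, a • v i + b • v j ∈ Submodule.span R (Set.range v) := fun a b =>
    add_mem (Submodule.smul_mem _ _ (hv _)) (Submodule.smul_mem _ _ (hv _))
  rw [Submodule.span_le]
  rintro _ ⟨k, rfl⟩
  rcases eq_or_ne k i with rfl | hki
  · exact hi ▸ hv₂ p q
  rcases eq_or_ne k j with rfl | hkj
  · exact hj ▸ hv₂ p' q'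
  · exact h k hki hkj ▸ hv k

theorem span_range_eq_of_two (h : ∀ k, k ≠ i → k ≠ j → v' k = v k)
    (hi : v' i = p • v i + q • v j) (hj : v' j = p' • v i + q' • v j)
    (hdet : p * q' - q * p' = 1) :
    Submodule.span R (Set.range v') = Submodule.span R (Set.range v) := by
  refine (span_range_le_of_two h hi hj).antisymm
    (span_range_le_of_two (p := q') (q := -q) (p' := -p') (q' := p)
      (fun k hki hkj => (h k hki hkj).symm) ?_ ?_)
  · calc v i = (p * q' - q * p') • v i := by rw [hdet, one_smul]
      _ = q' • v' i + -q • v' j := by rw [hi, hj]; module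
  · calc v j = (p * q' - q * p') • v j := by rw [hdet, one_smul]
      _ = -p' • v' i + p • v' j := by rw [hi, hj]; module

end TwoByTwo

section HasDivisors

variable {ι κ M : Type*} [AddCommGroup M]

/-- `V` is spanned by positive multiples `a i • C i` of the members of a family `C` that generates
the module together with a complementary family indexed by `κ`. The `a i` are thus elementary
divisors of `V` up to the divisibility relations between them. -/
def HasDivisors (κ : Type*) (V : Submodule ℤ M) (a : ι → ℕ) : Prop :=
  (∀ i, 0 < a i) ∧ ∃ (C : ι → M) (E : κ → M),
    Submodule.span ℤ (Set.range C) ⊔ Submodule.span ℤ (Set.range E) = ⊤ ∧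
    Submodule.span ℤ (Set.range fun i => (a i : ℤ) • C i) = V

theorem span_range_natAbs_smul (a : ι → ℤ) (v : ι → M) :
    Submodule.span ℤ (Set.range fun i => ((a i).natAbs : ℤ) • v i) =
      Submodule.span ℤ (Set.range fun i => a i • v i) := by
  refine le_antisymm ?_ ?_ <;> rw [Submodule.span_le] <;> rintro _ ⟨i, rfl⟩
  · have hmem : a i • v i ∈ Submodule.span ℤ (Set.range fun i => a i • v i) :=
      Submodule.subset_span ⟨i, rfl⟩
    simpa only [SetLike.mem_coe, Int.sign_mul_self_eq_natAbs, smul_smul]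
      using Submodule.smul_mem _ (a i).sign hmem
  · have hmem : ((a i).natAbs : ℤ) • v i ∈
        Submodule.span ℤ (Set.range fun i => ((a i).natAbs : ℤ) • v i) :=
      Submodule.subset_span ⟨i, rfl⟩
    simpa only [SetLike.mem_coe, Int.sign_mul_natAbs, smul_smul]
      using Submodule.smul_mem _ (a i).sign hmem

theorem HasDivisors.gcd_lcm [DecidableEq ι] {V : Submodule ℤ M} {a : ι → ℕ}
    (h : HasDivisors κ V a) {i j : ι} (hij : i ≠ j) :
    HasDivisors κ V
      (Function.update (Function.update a j (Nat.lcm (a i) (a j))) i (Nat.gcd (a i) (a j))) := by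
  obtain ⟨hpos, C, E, htop, hV⟩ := h
  obtain ⟨p, q, hpq, hi, hj⟩ := Nat.exists_coprime (a i) (a j)
  have hg : 0 < Nat.gcd (a i) (a j) := Nat.gcd_pos_of_pos_left _ (hpos i)
  have hlcm : Nat.lcm (a i) (a j) = p * q * Nat.gcd (a i) (a j) := by
    refine Nat.eq_of_mul_eq_mul_left hg ?_
    calc _ = a i * a j := Nat.gcd_mul_lcm _ _
      _ = p * Nat.gcd (a i) (a j) * (q * Nat.gcd (a i) (a j)) := congrArg₂ _ hi hj
      _ = _ := by ring
  have hi' : (a i : ℤ) = p * Nat.gcd (a i) (a j) := by exact_mod_cast hi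
  have hj' : (a j : ℤ) = q * Nat.gcd (a i) (a j) := by exact_mod_cast hj
  obtain ⟨x, y, hxy⟩ : ∃ x y : ℤ, x * p + y * q = 1 := Nat.isCoprime_iff_coprime.mpr hpq
  set g := Nat.gcd (a i) (a j)
  let C' : ι → M :=
    Function.update (Function.update C j ((-y) • C i + x • C j)) i ((p : ℤ) • C i + (q : ℤ) • C j)
  have hC'i : C' i = (p : ℤ) • C i + (q : ℤ) • C j := Function.update_self ..
  have hC'j : C' j = (-y) • C i + x • C j := by simp [C', hij.symm]
  have hC' : ∀ k, k ≠ i → k ≠ j → C' k = C k := fun k hki hkj => by simp [C', hki, hkj]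
  refine ⟨fun k => ?_, C', E, ?_, ?_⟩
  · rcases eq_or_ne k i with rfl | hki
    · simpa using hg
    rcases eq_or_ne k j with rfl | hkj
    · simpa [hki] using Nat.lcm_pos (hpos i) (hpos k)
    · simpa [hki, hkj] using hpos k
  · rwa [span_range_eq_of_two hC' hC'i hC'j (by linear_combination hxy)]
  · rw [← hV]
    refine span_range_eq_of_two (i := i) (j := j) (p := 1) (q := 1) (p' := -(y * q)) (q' := x * p)
      (fun k hki hkj => ?_) ?_ ?_ (by linear_combination hxy)
    · simp [hki, hkj, hC' k hki hkj]
    · rw [Function.update_self, hC'i, hi', hj']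
      module
    · rw [Function.update_of_ne hij.symm, Function.update_self, hC'j, hlcm, hi', hj']
      push_cast
      module

theorem HasDivisors.exists_chain [LinearOrder ι] [WellFoundedLT ι] [Finite ι] {V : Submodule ℤ M}
    {a₀ : ι → ℕ} (h₀ : HasDivisors κ V a₀) :
    ∃ a : ι → ℕ, HasDivisors κ V a ∧ ∀ i j, i ≤ j → a i ∣ a j := by
  have hwf : WellFounded (Pi.Lex (· < ·) (fun {_ : ι} => ((· < ·) : ℕ → ℕ → Prop))) :=
    Pi.Lex.wellFounded (· < ·) fun _ => wellFounded_lt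
  obtain ⟨a, ha, hmin⟩ := hwf.has_min {a | HasDivisors κ V a} ⟨a₀, h₀⟩
  refine ⟨a, ha, fun i j hij => ?_⟩
  rcases hij.eq_or_lt with rfl | hij
  · exact dvd_rfl
  by_contra hndvd
  refine hmin _ (ha.gcd_lcm hij.ne) ⟨i, fun k hk => ?_, ?_⟩
  · rw [Function.update_of_ne hk.ne, Function.update_of_ne (hk.trans hij).ne]
  · rw [Function.update_self]
    refine lt_of_le_of_ne (Nat.gcd_le_left _ (ha.1 i)) fun hgcd => hndvd ?_
    exact hgcd ▸ Nat.gcd_dvd_right _ _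

end HasDivisors

theorem exists_perm_castAdd {u s : ℕ} (f : Fin u ↪ Fin (u + s)) :
    ∃ e : Equiv.Perm (Fin (u + s)), ∀ i, e (Fin.castAdd s i) = f i := by
  have := Equiv.Perm.isMultiplyPretransitive (Fin (u + s)) u
  obtain ⟨e, he⟩ := MulAction.exists_smul_eq (Equiv.Perm (Fin (u + s))) (Fin.castAddEmb s) f
  exact ⟨e, fun i => DFunLike.congr_fun he i⟩

theorem range_append {u s : ℕ} {α : Type*} (C : Fin u → α) (E : Fin s → α) :
    Set.range (Fin.append C E) = Set.range C ∪ Set.range E := by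
  ext x
  simp only [Set.mem_range, Set.mem_union, ← finSumFinEquiv.exists_congr_right, Sum.exists,
    finSumFinEquiv_apply_left, finSumFinEquiv_apply_right, Fin.append_left, Fin.append_right]

theorem exists_hasDivisors {r : ℕ} (V : Submodule ℤ (Fin r → ℤ)) :
    ∃ (u s : ℕ) (_ : u + s = r) (a : Fin u → ℕ), HasDivisors (Fin s) V a := by
  obtain ⟨u, bM, bN, f, a, snf⟩ := Submodule.smithNormalForm (Pi.basisFun ℤ (Fin r)) V
  obtain ⟨s, rfl⟩ : ∃ s, r = u + s :=
    Nat.exists_eq_add_of_le (by simpa using Fintype.card_le_of_embedding f)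
  obtain ⟨e, he⟩ := exists_perm_castAdd f
  have ha : ∀ i, a i ≠ 0 := fun i hi =>
    bN.ne_zero i (Subtype.ext (by rw [snf, hi, zero_smul, ZeroMemClass.coe_zero]))
  have hspan : Submodule.span ℤ (Set.range fun i => a i • bM (f i)) = V := by
    rw [← funext snf]
    change Submodule.span ℤ (Set.range (V.subtype ∘ bN)) = V
    rw [Set.range_comp, ← Submodule.map_span, bN.span_eq, Submodule.map_subtype_top]
  refine ⟨u, s, rfl, fun i => (a i).natAbs, fun i => Int.natAbs_pos.mpr (ha i),
    fun i => bM (e (Fin.castAdd s i)), fun j => bM (e (Fin.natAdd u j)), ?_, ?_⟩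
  · rw [← Submodule.span_union, ← range_append, Fin.append_castAdd_natAdd (f := fun k => bM (e k)),
      ← bM.span_eq]
    exact congrArg _ (e.surjective.range_comp bM)
  · simp only [he]
    rw [span_range_natAbs_smul, hspan]

theorem diagonal_mul_append {u s : ℕ} (a : Fin u → ℕ) (C : Fin u → Fin (u + s) → ℤ)
    (E : Fin s → Fin (u + s) → ℤ) :
    Matrix.of (fun (i : Fin u) (j : Fin (u + s)) => if i.val = j.val then (a i : ℤ) else 0) *
      Matrix.of (Fin.append C E) = Matrix.of fun i => (a i : ℤ) • C i := by
  ext i j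
  have hne (k : Fin s) : (i : ℕ) ≠ u + k := by omega
  simp [Matrix.mul_apply, Fin.sum_univ_add, hne, Fin.val_inj]

theorem exists_isLargestDivisor {r : ℕ} {V : Submodule ℤ (Fin r → ℤ)} (hV : V ≠ ⊥) :
    ∃ d, IsLargestDivisor V d := by
  obtain ⟨u, s, rfl, a₀, ha₀⟩ := exists_hasDivisors V
  obtain ⟨a, ⟨hpos, C, E, htop, hspan⟩, hchain⟩ := HasDivisors.exists_chain ha₀
  have hu : 0 < u := by
    rw [pos_iff_ne_zero]
    rintro rfl
    rw [Set.range_eq_empty, Submodule.span_empty] at hspan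
    exact hV hspan.symm
  set P : Matrix (Fin (u + s)) (Fin (u + s)) ℤ := Matrix.of (Fin.append C E)
  set D : Matrix (Fin u) (Fin (u + s)) ℤ :=
    Matrix.of fun i j => if i.val = j.val then (a i : ℤ) else 0
  have hP : IsUnit P := by
    have hrange : LinearMap.range P.vecMulLinear = ⊤ := by
      rw [range_vecMulLinear, ← htop, ← Submodule.span_union, ← range_append]
      rfl
    exact Matrix.vecMul_surjective_iff_isUnit.mp (LinearMap.range_eq_top.mp hrange)
  have hPdet : IsUnit P.det := (Matrix.isUnit_iff_isUnit_det P).mp hP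
  refine ⟨_, u, hu, D * P, 1, P⁻¹, a, ⟨?_, ?_⟩, by simp, Matrix.isUnit_nonsing_inv_det P hPdet, ?_,
    hpos, hchain, rfl⟩
  · rw [← Matrix.vecMul_injective_iff]
    intro c c' hcc'
    simp only [← Matrix.vecMul_vecMul, (Matrix.vecMul_injective_of_isUnit hP).eq_iff, D,
      vecMul_diagonal_eq_append] at hcc'
    funext i
    simpa [(hpos i).ne'] using congrFun hcc' (Fin.castAdd s i)
  · rw [diagonal_mul_append]
    exact hspan
  · rw [Matrix.one_mul, Matrix.mul_assoc, Matrix.mul_nonsing_inv P hPdet, Matrix.mul_one]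

/-! ### Computability -/

attribute [fun_prop] Computable Computable.const

section Basic

variable {X α β γ : Type*} [Primcodable X] [Primcodable α] [Primcodable β] [Primcodable γ]

@[fun_prop]
theorem computable_id' : Computable fun x : α => x := Computable.id

@[fun_prop]
theorem computable_comp' {f : β → γ} {g : α → β} (hf : Computable f) (hg : Computable g) :
    Computable fun x => f (g x) := hf.comp hg

@[fun_prop]
theorem computable_fst' {f : X → α × β} (hf : Computable f) : Computable fun x => (f x).1 :=
  Computable.fst.comp hf

@[fun_prop]
theorem computable_snd' {f : X → α × β} (hf : Computable f) : Computable fun x => (f x).2 :=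
  Computable.snd.comp hf

@[fun_prop]
theorem computable_pair' {f : X → α} {g : X → β} (hf : Computable f) (hg : Computable g) :
    Computable fun x => (f x, g x) := hf.pair hg

@[fun_prop]
theorem computable_getD {f : X → List α} {g : X → ℕ} (d : α) (hf : Computable f)
    (hg : Computable g) : Computable fun x => (f x).getD (g x) d :=
  (Primrec.list_getD d).to_comp.comp hf hg

@[fun_prop]
theorem computable_length {f : X → List α} (hf : Computable f) :
    Computable fun x => (f x).length := Computable.list_length.comp hf

@[fun_prop]
theorem computable_cons {f : X → α} {g : X → List α} (hf : Computable f) (hg : Computable g) :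
    Computable fun x => f x :: g x := Computable.list_cons.comp hf hg

@[fun_prop]
theorem computable_map_fst {f : X → List (α × β)} (hf : Computable f) :
    Computable fun x => (f x).map Prod.fst :=
  (Primrec.list_map Primrec.id (Primrec.fst.comp Primrec.snd).to₂).to_comp.comp hf

@[fun_prop]
theorem computable_encode {f : X → α} (hf : Computable f) :
    Computable fun x => Encodable.encode (f x) := Computable.encode.comp hf

@[fun_prop]
theorem computable_some {f : X → α} (hf : Computable f) :
    Computable fun x => some (f x) := Computable.option_some.comp hf

@[fun_prop]
theorem computable_optionGetD {f : X → Option α} {g : X → α} (hf : Computable f)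
    (hg : Computable g) : Computable fun x => (f x).getD (g x) :=
  Primrec.option_getD.to_comp.comp hf hg

@[fun_prop]
theorem computable_evaln {k : X → ℕ} {c : X → Code} {n : X → ℕ} (hk : Computable k)
    (hc : Computable c) (hn : Computable n) : Computable fun x => (c x).evaln (k x) (n x) :=
  Code.primrec_evaln.to_comp.comp ((hk.pair hc).pair hn)

/-- The addition of `M` is computable; a class, so that `fun_prop` proves computability of
arithmetical expressions. -/
class ComputableAdd (M : Type*) [Add M] [Primcodable M] : Prop where
  add : Computable₂ fun a b : M => a + b

/-- The multiplication of `M` is computable. -/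
class ComputableMul (M : Type*) [Mul M] [Primcodable M] : Prop where
  mul : Computable₂ fun a b : M => a * b

/-- The powers of elements of `M` with exponents in `E` are computable. -/
class ComputablePow (M E : Type*) [Pow M E] [Primcodable M] [Primcodable E] : Prop where
  pow : Computable₂ fun (a : M) (e : E) => a ^ e

@[fun_prop]
theorem computable_add [Add α] [ComputableAdd α] {f g : X → α} (hf : Computable f)
    (hg : Computable g) : Computable fun x => f x + g x := ComputableAdd.add.comp hf hg

@[fun_prop]
theorem computable_mul [Mul α] [ComputableMul α] {f g : X → α} (hf : Computable f)
    (hg : Computable g) : Computable fun x => f x * g x := ComputableMul.mul.comp hf hg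

@[fun_prop]
theorem computable_pow [Pow α β] [ComputablePow α β] {f : X → α} {g : X → β} (hf : Computable f)
    (hg : Computable g) : Computable fun x => f x ^ g x := ComputablePow.pow.comp hf hg

instance : ComputableAdd ℕ := ⟨Primrec.nat_add.to_comp⟩

instance : ComputableMul ℕ := ⟨Primrec.nat_mul.to_comp⟩

@[fun_prop]
theorem computable_natMod {f g : X → ℕ} (hf : Computable f) (hg : Computable g) :
    Computable fun x => f x % g x := Primrec.nat_mod.to_comp.comp hf hg

end Basic

section Int

variable {X : Type*} [Primcodable X]

theorem encode_int_natCast (n : ℕ) : Encodable.encode (n : ℤ) = 2 * n := rfl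

theorem encode_int_negSucc (n : ℕ) : Encodable.encode (Int.negSucc n) = 2 * n + 1 := rfl

theorem primrecPred_even_encode : PrimrecPred fun z : ℤ => Encodable.encode z % 2 = 0 :=
  Primrec.eq.comp (Primrec.nat_mod.comp Primrec.encode (Primrec.const 2)) (Primrec.const 0)

theorem primrec_encode_div_two : Primrec fun z : ℤ => Encodable.encode z / 2 :=
  Primrec.nat_div.comp Primrec.encode (Primrec.const 2)

theorem primrec_toNat : Primrec Int.toNat := by
  refine (Primrec.ite primrecPred_even_encode primrec_encode_div_two (Primrec.const 0)).of_eq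
    fun z => ?_
  cases z with
  | ofNat n => simp [encode_int_natCast]
  | negSucc n => simp [encode_int_negSucc]

theorem primrec_neg_toNat : Primrec fun z : ℤ => (-z).toNat := by
  refine (Primrec.ite primrecPred_even_encode (Primrec.const 0)
    (Primrec.succ.comp primrec_encode_div_two)).of_eq fun z => ?_
  cases z with
  | ofNat n => simp [encode_int_natCast]
  | negSucc n =>
    have hdiv : (2 * n + 1) / 2 = n := by omega
    simp [encode_int_negSucc, hdiv]

theorem primrec_natSub : Primrec₂ fun a b : ℕ => (a : ℤ) - b := by
  refine Primrec.encode_iff.mp ?_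
  have h : Primrec fun p : ℕ × ℕ =>
      if p.2 ≤ p.1 then 2 * (p.1 - p.2) else 2 * (p.2 - p.1 - 1) + 1 :=
    Primrec.ite (Primrec.nat_le.comp Primrec.snd Primrec.fst)
      (Primrec.nat_mul.comp (Primrec.const 2) Primrec.nat_sub)
      (Primrec.succ.comp (Primrec.nat_mul.comp (Primrec.const 2)
        (Primrec.nat_sub.comp (Primrec.nat_sub.comp Primrec.snd Primrec.fst) (Primrec.const 1))))
  refine h.of_eq fun ⟨a, b⟩ => ?_
  dsimp only
  split_ifs with hab
  · rw [← Nat.cast_sub hab, encode_int_natCast]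
  · rw [show (a : ℤ) - b = Int.negSucc (b - a - 1) by omega, encode_int_negSucc]

@[fun_prop]
theorem computable_toNat {f : X → ℤ} (hf : Computable f) : Computable fun x => (f x).toNat :=
  primrec_toNat.to_comp.comp hf

@[fun_prop]
theorem computable_neg_toNat {f : X → ℤ} (hf : Computable f) :
    Computable fun x => (-f x).toNat :=
  primrec_neg_toNat.to_comp.comp hf

theorem computable_natSub {f g : X → ℕ} (hf : Computable f) (hg : Computable g) :
    Computable fun x => (f x : ℤ) - g x :=
  primrec_natSub.to_comp.comp hf hg

@[fun_prop]
theorem computable_intCast {f : X → ℕ} (hf : Computable f) : Computable fun x => (f x : ℤ) :=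
  (computable_natSub hf (Computable.const 0)).of_eq fun x => by simp

instance : ComputableAdd ℤ := ⟨by
  refine (computable_natSub (f := fun x : ℤ × ℤ => x.1.toNat + x.2.toNat)
    (g := fun x => (-x.1).toNat + (-x.2).toNat) (by fun_prop) (by fun_prop)).of_eq fun x => ?_
  dsimp only
  omega⟩

instance : ComputableMul ℤ := ⟨by
  refine (computable_natSub
    (f := fun x : ℤ × ℤ => x.1.toNat * x.2.toNat + (-x.1).toNat * (-x.2).toNat)
    (g := fun x => x.1.toNat * (-x.2).toNat + (-x.1).toNat * x.2.toNat)
    (by fun_prop) (by fun_prop)).of_eq fun x => ?_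
  dsimp only
  conv_rhs => rw [← Int.toNat_sub_toNat_neg x.1, ← Int.toNat_sub_toNat_neg x.2]
  push_cast
  ring⟩

@[fun_prop]
theorem computable_ite_eq {f g : X → ℕ} (hf : Computable f) (hg : Computable g) :
    Computable fun x => if f x = g x then (1 : ℤ) else 0 :=
  ((Primrec.ite (Primrec.eq.comp Primrec.fst Primrec.snd) (Primrec.const 1)
    (Primrec.const 0)).to_comp (f := fun p : ℕ × ℕ => if p.1 = p.2 then (1 : ℤ) else 0)).comp
    (hf.pair hg)

theorem natCast_dvd_iff_toNat (d : ℕ) (z : ℤ) :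
    (d : ℤ) ∣ z ↔ (z.toNat + (-z).toNat) % d = 0 := by
  rw [← Nat.dvd_iff_mod_eq_zero, Int.natCast_dvd]
  rw [show z.natAbs = z.toNat + (-z).toNat by omega]

end Int

section Fold

variable {X M : Type*} [Primcodable X] [Primcodable M]

@[fun_prop]
theorem computable_sum_range [AddCommMonoid M] [ComputableAdd M] {k : X → ℕ} {f : X → ℕ → M}
    (hk : Computable k) (hf : Computable fun p : X × ℕ => f p.1 p.2) :
    Computable fun x => ∑ i ∈ Finset.range (k x), f x i := by
  refine (Computable.nat_rec (f := k) (g := fun _ => (0 : M)) (h := fun x p => p.2 + f x p.1) hk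
    (Computable.const 0) (ComputableAdd.add.comp (by fun_prop)
      (hf.comp (g := fun q : X × ℕ × M => (q.1, q.2.1)) (by fun_prop)))).of_eq fun x => ?_
  induction k x with
  | zero => rfl
  | succ n ih => rw [Finset.sum_range_succ, ← ih]

@[fun_prop]
theorem computable_prod_range [CommMonoid M] [ComputableMul M] {k : X → ℕ} {f : X → ℕ → M}
    (hk : Computable k) (hf : Computable fun p : X × ℕ => f p.1 p.2) :
    Computable fun x => ∏ i ∈ Finset.range (k x), f x i := by
  refine (Computable.nat_rec (f := k) (g := fun _ => (1 : M)) (h := fun x p => p.2 * f x p.1) hk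
    (Computable.const 1) (ComputableMul.mul.comp (by fun_prop)
      (hf.comp (g := fun q : X × ℕ × M => (q.1, q.2.1)) (by fun_prop)))).of_eq fun x => ?_
  induction k x with
  | zero => rfl
  | succ n ih => rw [Finset.prod_range_succ, ← ih]

end Fold

/-- The inversion of the field `F`, with `0⁻¹ = 0`, is computable. -/
class ComputableInv (F : Type*) [Field F] [Primcodable F] : Prop where
  inv : Computable fun a : F => a⁻¹

section Field

variable {X F : Type*} [Primcodable X] [Field F] [Primcodable F] [ComputableInv F]

@[fun_prop]
theorem computable_fieldInv {f : X → F} (hf : Computable f) :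
    Computable fun x => (f x)⁻¹ := ComputableInv.inv.comp hf

instance computablePow_nat {M : Type*} [CommMonoid M] [Primcodable M] [ComputableMul M] :
    ComputablePow M ℕ :=
  ⟨(computable_prod_range (X := M × ℕ) (k := fun x => x.2) (f := fun x _ => x.1) (by fun_prop)
    (by fun_prop)).of_eq fun x => by simp⟩

instance computablePow_int [ComputableMul F] : ComputablePow F ℤ := ⟨by
  refine Computable.of_eq (f := fun x : F × ℤ => x.1 ^ x.2.toNat * x.1⁻¹ ^ (-x.2).toNat)
    (by fun_prop) fun x => ?_
  obtain ⟨n, h | h⟩ := x.2.eq_nat_or_neg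
  · simp [h]
  · simp [h]⟩

end Field

section Pred

variable {X α : Type*} [Primcodable X] [Primcodable α] {P Q : X → Prop}

theorem computablePred_of_bool {b : X → Bool} (hb : Computable b) (h : ∀ x, b x = true ↔ P x) :
    ComputablePred P :=
  ComputablePred.computable_iff.mpr ⟨b, hb, funext fun x => propext (h x).symm⟩

theorem computablePred_and (hP : ComputablePred P) (hQ : ComputablePred Q) :
    ComputablePred fun x => P x ∧ Q x := by
  obtain ⟨_, hP⟩ := hP
  obtain ⟨_, hQ⟩ := hQ
  exact computablePred_of_bool (Primrec.and.to_comp.comp hP hQ) fun x => by simp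

theorem computablePred_eq {f g : X → α} (hf : Computable f) (hg : Computable g) :
    ComputablePred fun x => f x = g x :=
  computablePred_of_bool (b := fun x => decide (Encodable.encode (f x) = Encodable.encode (g x)))
    ((Primrec.eq (α := ℕ)).decide.to_comp.comp (Computable.encode.comp hf)
      (Computable.encode.comp hg)) fun x => by simp

theorem computablePred_ne {f g : X → α} (hf : Computable f) (hg : Computable g) :
    ComputablePred fun x => f x ≠ g x := (computablePred_eq hf hg).not

theorem computablePred_le {f g : X → ℕ} (hf : Computable f) (hg : Computable g) :
    ComputablePred fun x => f x ≤ g x :=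
  computablePred_of_bool (b := fun x => decide (f x ≤ g x))
    (Primrec.nat_le.decide.to_comp.comp hf hg) fun x => by simp

theorem computablePred_lt {f g : X → ℕ} (hf : Computable f) (hg : Computable g) :
    ComputablePred fun x => f x < g x :=
  computablePred_le (f := fun x => f x + 1) (by fun_prop) hg

theorem computablePred_dvd {f : X → ℕ} {g : X → ℤ} (hf : Computable f) (hg : Computable g) :
    ComputablePred fun x => (f x : ℤ) ∣ g x := by
  simp only [natCast_dvd_iff_toNat]
  exact computablePred_eq (by fun_prop) (by fun_prop)

theorem computablePred_ball {k : X → ℕ} {R : X → ℕ → Prop} (hk : Computable k)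
    (hR : ComputablePred fun p : X × ℕ => R p.1 p.2) :
    ComputablePred fun x => ∀ i < k x, R x i := by
  obtain ⟨inst, hR⟩ := hR
  have h := Computable.nat_rec (f := k) (g := fun _ => true)
    (h := fun x p => p.2 && @decide (R x p.1) (inst (x, p.1))) hk (Computable.const true)
    (Primrec.and.to_comp.comp (show Computable fun q : X × ℕ × Bool => q.2.2 by fun_prop)
      (hR.comp (show Computable fun q : X × ℕ × Bool => (q.1, q.2.1) by fun_prop)))
  refine computablePred_of_bool h fun x => ?_
  induction k x with
  | zero => simp
  | succ n ih =>
    simp only [Bool.and_eq_true, decide_eq_true_eq] at ih ⊢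
    rw [ih, Nat.forall_lt_succ_right]

end Pred

theorem exists_search {X Y Z : Type*} [Primcodable X] [Primcodable Y] [Primcodable Z]
    {P : X × Y → Prop} (hP : ComputablePred P) {out : Y → Z} (hout : Computable out) :
    ∃ alg : X →. Z, Partrec alg ∧
      ∀ x, (∃ y, P (x, y)) → ∃ y, P (x, y) ∧ out y ∈ alg x := by
  obtain ⟨_, hP⟩ := hP
  let f : X → ℕ → Option Z := fun x n =>
    (Encodable.decode (α := Y) n).bind fun y => bif decide (P (x, y)) then some (out y) else none
  have hf : Computable₂ f := by
    refine Computable.option_bind (f := fun p : X × ℕ => Encodable.decode (α := Y) p.2)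
      (g := fun p y => bif decide (P (p.1, y)) then some (out y) else none)
      (Computable.decode.comp Computable.snd) ?_
    exact Computable.cond (hP.comp (g := fun q : (X × ℕ) × Y => (q.1.1, q.2)) (by fun_prop))
      (Computable.option_some.comp (hout.comp Computable.snd)) (Computable.const none)
  refine ⟨fun x => Nat.rfindOpt (f x), Partrec.rfindOpt hf, fun x ⟨y, hy⟩ => ?_⟩
  have hdom : (Nat.rfindOpt (f x)).Dom :=
    Nat.rfindOpt_dom.mpr ⟨Encodable.encode y, out y, by simp [f, hy]⟩
  obtain ⟨n, hn⟩ := Nat.rfindOpt_spec (Part.get_mem hdom)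
  obtain ⟨y', -, hout'⟩ := Option.bind_eq_some_iff.mp hn
  by_cases hP' : P (x, y')
  · simp only [hP', decide_true, cond_true, Option.some.injEq] at hout'
    exact ⟨y', hP', hout' ▸ Part.get_mem hdom⟩
  · simp [hP'] at hout'

/-! ### Existence of optimal representations -/

section OptimalRep

variable {F : Type*} [Field F] {σ : RingAut F} {τ₀ : F →+* SeqRing (constField σ)} {r : ℕ}
  {α : Fin r → Fˣ} {σE : RingAut (PRing F r)} {τE : PRing F r →+* SeqRing (constField σ)}

theorem exists_optimalRep (hσ : RadicalStable σ) (hτ₀ : IsKHom σ σ τ₀) (hE : IsPExtension σ α σE)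
    (hτE : IsKHom σ σE τE) (hbase : ∀ f : F, τE (algebraMap F _ f) = τ₀ f) {u d : ℕ}
    (hu : Module.finrank ℤ (multRel σ α) = u) (hd : IsLargestDivisor (multRel σ α) d) :
    ∃ (s : ℕ) (D : RepData F r s u) (σH : RingAut (HRing F s D.d))
      (τH : HRing F s D.d →+* SeqRing (constField σ)) (lam : PRing F r →+* HRing F s D.d),
      s + u = r ∧ D.d = d ∧ IsOptimalRep σ τ₀ σE τE D σH τH lam ∧
      ∀ ev : F → ℕ → constField σ, Represents ev τ₀ →
        ∃ (κ : Fin s → constField σ) (l : Fin s → ℕ), HasProductEval σ ev D σH τH κ l := by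
  obtain ⟨u', _, Z, _, _, _, hZ, -⟩ := id hd
  obtain rfl : u' = u := hZ.finrank_eq.symm.trans hu
  obtain ⟨s, rfl⟩ := Nat.exists_eq_add_of_le hZ.le
  obtain ⟨D, -, hDd, ρ, v, vz, hD⟩ := exists_isCert hσ hτ₀ hE hτE hbase hd hZ
  have hrep := hD.isOptimalRep hbase hE hτE
  refine ⟨s, D, _, _, D.lam, Nat.add_comm _ _, hDd, hrep, fun ev hev => ?_⟩
  have hx (i : Fin s) : shift (hD.seqHom hbase (xVar i)) =
      toSeq (ev (D.α i : F)) * hD.seqHom hbase (xVar i) := by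
    rw [← hrep.embedding.map_shift, hrep.map_x, map_mul, hrep.embedding_base, hev]
  choose κ l hκ hl hprod using fun i => exists_product_form ((isUnit_xVar i).map _) (hx i)
  exact ⟨κ, l, hasProductEval_of_toSeq hev hrep.embedding.toIsKHom hrep.embedding_base hD.rho
    (hD.seqHom_zVar hbase) hκ hl hprod⟩

theorem IsMinimal.le_of_isOptimalRep {s d : ℕ} (h : IsMinimal σ τ₀ σE τE s d) {s' u' : ℕ}
    {D : RepData F r s' u'} {σH : RingAut (HRing F s' D.d)}
    {τH : HRing F s' D.d →+* SeqRing (constField σ)} {lam : PRing F r →+* HRing F s' D.d}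
    (hH : IsOptimalRep σ τ₀ σE τE D σH τH lam) (hD : 0 < D.d) : d ≤ D.d := by
  obtain hd | hd := le_or_gt d 1
  · exact hd.trans hD
  · obtain ⟨-, hle, -⟩ := (h _ _ _ σH τH lam hH.rpi hH.embedding hH.embedding_base hH.lam_shift
      hH.commutes).2 hd
    exact hle.trans (Nat.le_of_dvd hD (Finset.lcm_dvd fun _ _ => dvd_rfl))

-- Two optimal representations have the same `d`, and one of them realises the largest divisor.
theorem IsCert.isLargestDivisor (hσ : RadicalStable σ) (hτ₀ : IsKHom σ σ τ₀) {s u : ℕ}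
    {D : RepData F r s u} {ρ : (constField σ)ˣ} {v : Fin s → Fin r → ℤ} {vz : Fin r → ℤ}
    (h : IsCert σ α τ₀ τE D ρ v vz) (hE : IsPExtension σ α σE) (hτE : IsKHom σ σE τE)
    (hbase : ∀ f : F, τE (algebraMap F _ f) = τ₀ f) (hV : multRel σ α ≠ ⊥) :
    IsLargestDivisor (multRel σ α) D.d := by
  obtain ⟨d, hd⟩ := exists_isLargestDivisor hV
  obtain ⟨u', _, Z, _, _, _, hZ, -⟩ := id hd
  obtain ⟨s', rfl⟩ := Nat.exists_eq_add_of_le hZ.le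
  obtain ⟨D', -, rfl, ρ', v', vz', h'⟩ := exists_isCert hσ hτ₀ hE hτE hbase hd hZ
  have hrep := h.isOptimalRep hbase hE hτE
  have hrep' := h'.isOptimalRep hbase hE hτE
  rwa [le_antisymm (hrep.minimal.le_of_isOptimalRep hrep' h'.d_pos)
    (hrep'.minimal.le_of_isOptimalRep hrep h.d_pos)]

end OptimalRep

/-! ### Verification of certificates by evaluation -/

section EvalCert

variable {F : Type*} [Field F] {σ : RingAut F} {r : ℕ} {σE : RingAut (PRing F r)}
  {evE : PRing F r → ℕ → constField σ} {LE : PRing F r → ℕ}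

namespace IsOSigmaFun

theorem eval_succ (hL : IsOSigmaFun σE evE LE) (y : PRing F r) {n : ℕ} (hn : LE y ≤ n) :
    evE y (n + 1) = evE (σE y) n := by
  simpa using (hL.map_shift y 1 n (by simpa using hn) (n + 1) (by simp)).symm

theorem eval_succ_of_map_eq_mul (hL : IsOSigmaFun σE evE LE) {y c : PRing F r}
    (hy : σE y = c * y) {n : ℕ} (hyn : LE y ≤ n) (hcn : LE c ≤ n) :
    evE y (n + 1) = evE c n * evE y n := by
  rw [hL.eval_succ y hyn, hy, hL.map_mul _ _ _ (max_le hcn hyn)]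

theorem eval_eq_of_map_eq (hL : IsOSigmaFun σE evE LE) {y : PRing F r} (hy : σE y = y) {N : ℕ}
    (hN : LE y ≤ N) {n : ℕ} (hn : N ≤ n) : evE y n = evE y N := by
  induction n, hn using Nat.le_induction with
  | base => rfl
  | succ n hn ih => rw [hL.eval_succ y (hN.trans hn), hy, ih]

theorem eval_constField (hL : IsOSigmaFun σE evE LE) (hev : IsEvalFun σ σE evE)
    {c : constField σ} (hc : σE (algebraMap F _ (c : F)) = algebraMap F _ (c : F)) {n : ℕ}
    (hn : LE (algebraMap F _ (c : F)) ≤ n) : evE (algebraMap F _ (c : F)) n = c := by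
  obtain ⟨N, hN⟩ := hev.map_const c
  rw [← hL.eval_eq_of_map_eq hc hn (le_max_left n N), hN _ (le_max_right _ _)]

end IsOSigmaFun

variable {α : Fin r → Fˣ} {s u : ℕ} {D : RepData F r s u} {ρ : (constField σ)ˣ}
  {v : Fin s → Fin r → ℤ} {vz : Fin r → ℤ}

namespace IsAlgCert

theorem map_quotient (h : IsAlgCert σ α D ρ v vz) (hE : IsPExtension σ α σE) (w : Fin r → ℤ) :
    σE (algebraMap F _ (((zpowProd D.γ w : Fˣ) : F)⁻¹) * mono w 0) =
      algebraMap F _ ((zpowProd D.α (D.xExp w) * rootUnit ρ ^ D.zExp w : Fˣ) : F) *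
        (algebraMap F _ (((zpowProd D.γ w : Fˣ) : F)⁻¹) * mono w 0) := by
  have hunits : onUnits σ (zpowProd D.γ w)⁻¹ * zpowProd α w =
      zpowProd D.α (D.xExp w) * rootUnit ρ ^ D.zExp w * (zpowProd D.γ w)⁻¹ := by
    rw [map_inv, inv_mul_eq_iff_eq_mul, ← mul_assoc, h.compat_zpowProd, mul_inv_cancel_right]
  rw [map_mul, hE.map_base, hE.map_mono, ← mul_assoc, ← mul_assoc, ← map_mul, ← map_mul]
  congr 2
  simpa [onUnits] using congrArg Units.val hunits

theorem map_quotient_n (h : IsAlgCert σ α D ρ v vz) (hE : IsPExtension σ α σE) (k : Fin u) :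
    σE (algebraMap F _ ((D.g k : F)⁻¹) * mono (D.n k) 0) =
      algebraMap F _ ((D.g k : F)⁻¹) * mono (D.n k) 0 := by
  have := h.map_quotient hE (D.n k)
  rwa [h.x_n, zpowProd_zero, rootUnit_zpow_of_dvd h.rho_pow (h.z_n k), mul_one, Units.val_one,
    map_one, one_mul, ← h.g_eq] at this

theorem map_quotient_v (h : IsAlgCert σ α D ρ v vz) (hE : IsPExtension σ α σE) (j : Fin s) :
    σE (algebraMap F _ (((zpowProd D.γ (v j) : Fˣ) : F)⁻¹) * mono (v j) 0) =
      algebraMap F _ (D.α j : F) *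
        (algebraMap F _ (((zpowProd D.γ (v j) : Fˣ) : F)⁻¹) * mono (v j) 0) := by
  have := h.map_quotient hE (v j)
  rwa [h.x_v, zpowProd_single, zpow_one, rootUnit_zpow_of_dvd h.rho_pow (h.z_v j), mul_one] at this

theorem map_quotient_vz (h : IsAlgCert σ α D ρ v vz) (hE : IsPExtension σ α σE) :
    σE (algebraMap F _ (((zpowProd D.γ vz : Fˣ) : F)⁻¹) * mono vz 0) =
      algebraMap F _ ((ρ : constField σ) : F) *
        (algebraMap F _ (((zpowProd D.γ vz : Fˣ) : F)⁻¹) * mono vz 0) := by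
  have hroot : rootUnit ρ ^ D.zExp vz = rootUnit ρ := by
    have := rootUnit_zpow_of_dvd h.rho_pow h.z_vz
    rwa [zpow_sub_one, mul_inv_eq_one] at this
  have := h.map_quotient hE vz
  rwa [h.x_vz, zpowProd_zero, one_mul, hroot] at this

end IsAlgCert

variable {τ₀ : F →+* SeqRing (constField σ)} {τE : PRing F r →+* SeqRing (constField σ)}
  {ev : F → ℕ → constField σ} {κ : Fin s → constField σ} {N : ℕ}

theorem map_mono_eq_mul (hbase : ∀ f : F, τE (algebraMap F _ f) = τ₀ f) (c : Fˣ)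
    (w : Fin r → ℤ) :
    τE (mono w 0) = τ₀ (c : F) * τE (algebraMap F _ ((c : F)⁻¹) * mono w 0) := by
  rw [map_mul, hbase, ← mul_assoc, ← map_mul, mul_inv_cancel₀ c.ne_zero, map_one, one_mul]

namespace IsEvalCert

theorem tau_quotient_n (h : IsEvalCert evE LE D ρ v vz κ N) (hA : IsAlgCert σ α D ρ v vz)
    (hE : IsPExtension σ α σE) (hL : IsOSigmaFun σE evE LE) (hrep : Represents evE τE)
    (k : Fin u) : τE (algebraMap F _ ((D.g k : F)⁻¹) * mono (D.n k) 0) = 1 := by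
  rw [hrep]
  exact toSeq_eq_iff.mpr ⟨N, fun n hn =>
    (hL.eval_eq_of_map_eq (hA.map_quotient_n hE k) (h.bound_n k) hn).trans (h.eval_n k)⟩

theorem tau_quotient_v (h : IsEvalCert evE LE D ρ v vz κ N) (hA : IsAlgCert σ α D ρ v vz)
    (hE : IsPExtension σ α σE) (hL : IsOSigmaFun σE evE LE) (hrep : Represents evE τE)
    (hevE : ∀ (f : F) (n : ℕ), evE (algebraMap F _ f) n = ev f n) (j : Fin s) :
    τE (algebraMap F _ (((zpowProd D.γ (v j) : Fˣ) : F)⁻¹) * mono (v j) 0) =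
      toSeq fun n => κ j * ∏ k ∈ Finset.Icc (N + 1) n, ev (D.α j : F) (k - 1) := by
  rw [hrep, toSeq_eq_iff]
  refine ⟨N, fun n hn => ?_⟩
  rw [← h.eval_v j]
  refine eq_prod_of_recurrence (fun n hn => ?_) hn
  rw [hL.eval_succ_of_map_eq_mul (hA.map_quotient_v hE j) ((h.bound_v j).trans hn)
    ((h.bound_α j).trans hn), hevE]

theorem tau_quotient_vz (h : IsEvalCert evE LE D ρ v vz κ N) (hA : IsAlgCert σ α D ρ v vz)
    (hE : IsPExtension σ α σE) (hev : IsEvalFun σ σE evE) (hL : IsOSigmaFun σE evE LE)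
    (hrep : Represents evE τE) :
    τE (algebraMap F _ (((zpowProd D.γ vz : Fˣ) : F)⁻¹) * mono vz 0) = geomSeq ρ := by
  have hfix : σE (algebraMap F _ (((ρ : constField σ)) : F)) =
      algebraMap F _ (((ρ : constField σ)) : F) := by
    rw [hE.map_base]
    exact congrArg _ (ρ : constField σ).2
  rw [val_geomSeq, hrep, toSeq_eq_iff]
  refine ⟨N, fun n hn => ?_⟩
  induction n, hn using Nat.le_induction with
  | base => exact h.eval_vz
  | succ n hn ih =>
    have hbound : LE (algebraMap F _ ((ρ : constField σ) : F)) ≤ n :=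
      hA.rho ▸ h.bound_ρ.trans hn
    rw [hL.eval_succ_of_map_eq_mul (hA.map_quotient_vz hE) (h.bound_vz.trans hn) hbound, ih,
      hL.eval_constField hev hfix hbound, pow_succ']

theorem isCert (h : IsEvalCert evE LE D ρ v vz κ N) (hA : IsAlgCert σ α D ρ v vz)
    (hE : IsPExtension σ α σE) (hev : IsEvalFun σ σE evE) (hL : IsOSigmaFun σE evE LE)
    (hrep : Represents evE τE) (hbase : ∀ f : F, τE (algebraMap F _ f) = τ₀ f) :
    IsCert σ α τ₀ τE D ρ v vz where
  toIsAlgCert := hA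
  tau_n k := by
    rw [map_mono_eq_mul hbase (D.g k), h.tau_quotient_n hA hE hL hrep, mul_one]
  tau_vz := by
    rw [map_mono_eq_mul hbase (zpowProd D.γ vz), h.tau_quotient_vz hA hE hev hL hrep]

theorem exists_optimalRep (h : IsEvalCert evE LE D ρ v vz κ N) (hA : IsAlgCert σ α D ρ v vz)
    (hσ : RadicalStable σ) (hτ₀ : IsKHom σ σ τ₀) (hev₀ : Represents ev τ₀)
    (hE : IsPExtension σ α σE) (hτE : IsKHom σ σE τE) (hev : IsEvalFun σ σE evE)
    (hL : IsOSigmaFun σE evE LE) (hrep : Represents evE τE)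
    (hevE : ∀ (f : F) (n : ℕ), evE (algebraMap F _ f) n = ev f n) (hV : multRel σ α ≠ ⊥) :
    ∃ (σH : RingAut (HRing F s D.d)) (τH : HRing F s D.d →+* SeqRing (constField σ))
      (lam : PRing F r →+* HRing F s D.d),
      IsLargestDivisor (multRel σ α) D.d ∧ IsOptimalRep σ τ₀ σE τE D σH τH lam ∧
      HasProductEval σ ev D σH τH κ fun _ => N + 1 := by
  have hbase (f : F) : τE (algebraMap F _ f) = τ₀ f := by rw [hrep, hev₀, funext (hevE f)]
  have hC := h.isCert hA hE hev hL hrep hbase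
  have hopt := hC.isOptimalRep hbase hE hτE
  have hx (j : Fin s) : hC.seqHom hbase (xVar j) =
      toSeq fun n => κ j * ∏ k ∈ Finset.Icc (N + 1) n, ev (D.α j : F) (k - 1) := by
    rw [hC.seqHom_xVar, Units.val_inv_eq_inv_val, h.tau_quotient_v hA hE hL hrep hevE]
  have hκ (j : Fin s) : κ j ≠ 0 := fun h0 => by
    refine ((isUnit_xVar j).map (hC.seqHom hbase)).ne_zero ?_
    simp only [hx, h0, zero_mul]
    rfl
  exact ⟨_, _, _, hC.isLargestDivisor hσ hτ₀ hE hτE hbase hV, hopt,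
    hasProductEval_of_toSeq hev₀ hopt.embedding.toIsKHom hopt.embedding_base hA.rho
      (hC.seqHom_zVar hbase) hκ (fun _ => Nat.le_add_left 1 N) hx⟩

end IsEvalCert

theorem IsCert.exists_isEvalCert (h : IsCert σ α τ₀ τE D ρ v vz)
    (hbase : ∀ f : F, τE (algebraMap F _ f) = τ₀ f) (hrep : Represents evE τE)
    (LE : PRing F r → ℕ) : ∃ κ N, IsEvalCert evE LE D ρ v vz κ N := by
  have hn (k : Fin u) :
      ∀ᶠ n in atTop, evE (algebraMap F _ ((D.g k : F)⁻¹) * mono (D.n k) 0) n = 1 := by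
    have : τE (algebraMap F _ ((D.g k : F)⁻¹) * mono (D.n k) 0) = 1 := by
      rw [map_mul, h.tau_n, hbase, ← map_mul, inv_mul_cancel₀ (D.g k).ne_zero, map_one]
    rw [hrep] at this
    exact eventually_atTop.mpr (toSeq_eq_iff.mp this)
  have hvz : ∀ᶠ n in atTop, evE (algebraMap F _ (((zpowProd D.γ vz : Fˣ) : F)⁻¹) * mono vz 0) n =
      (ρ : constField σ) ^ n := by
    have : τE (algebraMap F _ (((zpowProd D.γ vz : Fˣ) : F)⁻¹) * mono vz 0) = geomSeq ρ := by
      rw [map_mul, h.tau_vz, hbase, ← mul_assoc, ← map_mul, inv_mul_cancel₀ (Units.ne_zero _),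
        map_one, one_mul]
    rw [hrep, val_geomSeq] at this
    exact eventually_atTop.mpr (toSeq_eq_iff.mp this)
  have hbound (y : PRing F r) : ∀ᶠ n in atTop, LE y ≤ n := eventually_ge_atTop _
  obtain ⟨N, hN⟩ := ((eventually_all.mpr hn).and <| hvz.and <| (eventually_all.mpr fun k =>
    hbound (algebraMap F _ ((D.g k : F)⁻¹) * mono (D.n k) 0)).and <| (eventually_all.mpr fun j =>
    hbound (algebraMap F _ (((zpowProd D.γ (v j) : Fˣ) : F)⁻¹) * mono (v j) 0)).and <|
    (eventually_all.mpr fun j => hbound (algebraMap F _ (D.α j : F))).and <|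
    (hbound (algebraMap F _ (((zpowProd D.γ vz : Fˣ) : F)⁻¹) * mono vz 0)).and <|
    hbound (algebraMap F _ D.ρ)).exists
  obtain ⟨eval_n, eval_vz, bound_n, bound_v, bound_α, bound_vz, bound_ρ⟩ := hN
  exact ⟨_, N, ⟨bound_n, eval_n, bound_v, fun _ => rfl, bound_α, bound_vz, eval_vz, bound_ρ⟩⟩

end EvalCert

/-! ### Computations with a bounded number of steps -/

section Bounded

variable {T W X : Type*} [Primcodable T] [Primcodable W] [Primcodable X]

/-- Within `K` steps, the program `c` finds a value of at most `N` at `t`. -/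
def EvalnLE (K : ℕ) (c : Code) (t : T) (N : ℕ) : Prop :=
  (c.evaln K (Encodable.encode t)).getD (N + 1) ≤ N

/-- Within `K` steps, the program `c` finds the value `w` at `t`. -/
def EvalnEq (K : ℕ) (c : Code) (t : T) (w : W) : Prop :=
  c.evaln K (Encodable.encode t) = some (Encodable.encode w)

theorem Computes.eventually_evalnEq {c : Code} {f : T → W} (hc : Computes c f) (t : T) :
    ∀ᶠ K in atTop, EvalnEq K c t (f t) := by
  have hmem : Encodable.encode (f t) ∈ c.eval (Encodable.encode t) := by
    rw [hc t]
    exact Part.mem_some _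
  obtain ⟨k, hk⟩ := Code.evaln_complete.mp hmem
  exact eventually_atTop.mpr ⟨k, fun K hK => Code.evaln_mono hK hk⟩

theorem EvalnEq.eq {c : Code} {f : T → W} (hc : Computes c f) {K : ℕ} {t : T} {w : W}
    (h : EvalnEq K c t w) : f t = w := by
  have hmem : Encodable.encode w ∈ c.eval (Encodable.encode t) := Code.evaln_sound h
  rw [hc t, Part.mem_some_iff] at hmem
  exact (Encodable.encode_injective hmem).symm

theorem Computes.eventually_evalnLE {c : Code} {f : T → ℕ} (hc : Computes c f) {t : T} {N : ℕ}
    (h : f t ≤ N) : ∀ᶠ K in atTop, EvalnLE K c t N := by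
  filter_upwards [hc.eventually_evalnEq t] with K hK
  rw [EvalnLE, hK]
  simpa using h

theorem EvalnLE.le {c : Code} {f : T → ℕ} (hc : Computes c f) {K : ℕ} {t : T} {N : ℕ}
    (h : EvalnLE K c t N) : f t ≤ N := by
  rw [EvalnLE] at h
  cases hx : c.evaln K (Encodable.encode t) with
  | none => simp [hx] at h
  | some x =>
    rw [show f t = x from EvalnEq.eq hc hx]
    simpa [hx] using h

theorem computablePred_evalnLE {k : X → ℕ} {c : X → Code} {t : X → T} {N : X → ℕ}
    (hk : Computable k) (hc : Computable c) (ht : Computable t) (hN : Computable N) :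
    ComputablePred fun x => EvalnLE (k x) (c x) (t x) (N x) :=
  computablePred_le (by fun_prop) hN

theorem computablePred_evalnEq {k : X → ℕ} {c : X → Code} {t : X → T} {w : X → W}
    (hk : Computable k) (hc : Computable c) (ht : Computable t) (hw : Computable w) :
    ComputablePred fun x => EvalnEq (k x) (c x) (t x) (w x) :=
  computablePred_eq (by fun_prop) (by fun_prop)

end Bounded

/-! ### Certificates as finite data -/

/-- An output of the algorithm together with the exponents `v` and `vz` of preimages of the
generators, the point `N` of evaluation and a bound `K` for the number of steps. Missing entries of
the lists are read as `0`. -/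
abbrev ListCert (F : Type*) : Type _ := AlgOutput F × List (List ℤ) × List ℤ × ℕ × ℕ

namespace ListCert

section Projections

variable {F : Type*} (y : ListCert F)

/-- The order of the `R`-monomial. -/
def d : ℕ := y.1.1

/-- The root of unity. -/
def ρ : F := y.1.2.1

/-- The list of the quotients of the `Π`-monomials. -/
def αList : List F := y.1.2.2.1

/-- The list of the triples `(γ_i, o_i, (m_{ij})_j)`. -/
def images : List (F × ℕ × List ℤ) := y.1.2.2.2.1

/-- The list of the pairs `((n_{ki})_i, g_k)`. -/
def relations : List (List ℤ × F) := y.1.2.2.2.2.1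

/-- The list of the pairs `(κ_j, l_j)`. -/
def products : List (F × ℕ) := y.1.2.2.2.2.2

/-- The number of `Π`-monomials. -/
def s : ℕ := y.αList.length

/-- The number of generators of the kernel. -/
def u : ℕ := y.relations.length

/-- The lists of exponents of preimages of the `Π`-monomials. -/
def vLists : List (List ℤ) := y.2.1

/-- The list of exponents of a preimage of the `j`-th `Π`-monomial. -/
def vList (j : ℕ) : List ℤ := y.vLists.getD j []

/-- The exponents of a preimage of the `j`-th `Π`-monomial. -/
def v (j i : ℕ) : ℤ := (y.vList j).getD i 0

/-- The list of exponents of a preimage of the `R`-monomial. -/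
def vzList : List ℤ := y.2.2.1

/-- The exponents of a preimage of the `R`-monomial. -/
def vz (i : ℕ) : ℤ := y.vzList.getD i 0

/-- The point of evaluation. -/
def N : ℕ := y.2.2.2.1

/-- The bound for the number of steps. -/
def K : ℕ := y.2.2.2.2

variable [Field F]

/-- The quotient of the `j`-th `Π`-monomial. -/
def α (j : ℕ) : F := y.αList.getD j 0

/-- The coefficient of the image of `x̂_i`. -/
def γ (i : ℕ) : F := (y.images.getD i (0, 0, [])).1

/-- The exponent of the `R`-monomial in the image of `x̂_i`. -/
def o (i : ℕ) : ℕ := (y.images.getD i (0, 0, [])).2.1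

/-- The list of exponents of the `Π`-monomials in the image of `x̂_i`. -/
def mList (i : ℕ) : List ℤ := (y.images.getD i (0, 0, [])).2.2

/-- The exponents of the `Π`-monomials in the image of `x̂_i`. -/
def m (i j : ℕ) : ℤ := (y.mList i).getD j 0

/-- The list of exponents of the `k`-th relation. -/
def nList (k : ℕ) : List ℤ := (y.relations.getD k ([], 0)).1

/-- The exponents of the `k`-th relation. -/
def n (k i : ℕ) : ℤ := (y.nList k).getD i 0

/-- The right hand side of the `k`-th relation. -/
def g (k : ℕ) : F := (y.relations.getD k ([], 0)).2

/-- The initial value of the `j`-th product. -/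
def κ (j : ℕ) : F := (y.products.getD j (0, 0)).1

/-- The lower bound of the `j`-th product. -/
def l (j : ℕ) : ℕ := (y.products.getD j (0, 0)).2

/-- The power product of the coefficients `γ`. -/
def γpow (r : ℕ) (w : ℕ → ℤ) : F := ∏ i ∈ Finset.range r, y.γ i ^ w i

end Projections

section ComputableProjections

variable {X F : Type*} [Primcodable X] [Primcodable F] {f : X → ListCert F} {a b : X → ℕ}

@[fun_prop]
theorem computable_d (hf : Computable f) : Computable fun x => d (f x) := by
  unfold d; fun_prop

@[fun_prop]
theorem computable_ρ (hf : Computable f) : Computable fun x => ρ (f x) := by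
  unfold ρ; fun_prop

@[fun_prop]
theorem computable_αList (hf : Computable f) : Computable fun x => αList (f x) := by
  unfold αList; fun_prop

@[fun_prop]
theorem computable_images (hf : Computable f) : Computable fun x => images (f x) := by
  unfold images; fun_prop

@[fun_prop]
theorem computable_relations (hf : Computable f) : Computable fun x => relations (f x) := by
  unfold relations; fun_prop

@[fun_prop]
theorem computable_products (hf : Computable f) : Computable fun x => products (f x) := by
  unfold products; fun_prop

@[fun_prop]
theorem computable_s (hf : Computable f) : Computable fun x => s (f x) := by
  unfold s; fun_prop

@[fun_prop]
theorem computable_u (hf : Computable f) : Computable fun x => u (f x) := by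
  unfold u; fun_prop

@[fun_prop]
theorem computable_vLists (hf : Computable f) : Computable fun x => vLists (f x) := by
  unfold vLists; fun_prop

@[fun_prop]
theorem computable_vList (hf : Computable f) (ha : Computable a) :
    Computable fun x => vList (f x) (a x) := by
  unfold vList; fun_prop

@[fun_prop]
theorem computable_v (hf : Computable f) (ha : Computable a) (hb : Computable b) :
    Computable fun x => v (f x) (a x) (b x) := by
  unfold v; fun_prop

@[fun_prop]
theorem computable_vzList (hf : Computable f) : Computable fun x => vzList (f x) := by
  unfold vzList; fun_prop

@[fun_prop]
theorem computable_vz (hf : Computable f) (ha : Computable a) :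
    Computable fun x => vz (f x) (a x) := by
  unfold vz; fun_prop

@[fun_prop]
theorem computable_N (hf : Computable f) : Computable fun x => N (f x) := by
  unfold N; fun_prop

@[fun_prop]
theorem computable_K (hf : Computable f) : Computable fun x => K (f x) := by
  unfold K; fun_prop

variable [Field F]

@[fun_prop]
theorem computable_α (hf : Computable f) (ha : Computable a) :
    Computable fun x => α (f x) (a x) := by
  unfold α; fun_prop

@[fun_prop]
theorem computable_γ (hf : Computable f) (ha : Computable a) :
    Computable fun x => γ (f x) (a x) := by
  unfold γ; fun_prop

@[fun_prop]
theorem computable_o (hf : Computable f) (ha : Computable a) :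
    Computable fun x => o (f x) (a x) := by
  unfold o; fun_prop

@[fun_prop]
theorem computable_mList (hf : Computable f) (ha : Computable a) :
    Computable fun x => mList (f x) (a x) := by
  unfold mList; fun_prop

@[fun_prop]
theorem computable_m (hf : Computable f) (ha : Computable a) (hb : Computable b) :
    Computable fun x => m (f x) (a x) (b x) := by
  unfold m; fun_prop

@[fun_prop]
theorem computable_nList (hf : Computable f) (ha : Computable a) :
    Computable fun x => nList (f x) (a x) := by
  unfold nList; fun_prop

@[fun_prop]
theorem computable_n (hf : Computable f) (ha : Computable a) (hb : Computable b) :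
    Computable fun x => n (f x) (a x) (b x) := by
  unfold n; fun_prop

@[fun_prop]
theorem computable_g (hf : Computable f) (ha : Computable a) :
    Computable fun x => g (f x) (a x) := by
  unfold g; fun_prop

@[fun_prop]
theorem computable_κ (hf : Computable f) (ha : Computable a) :
    Computable fun x => κ (f x) (a x) := by
  unfold κ; fun_prop

@[fun_prop]
theorem computable_l (hf : Computable f) (ha : Computable a) :
    Computable fun x => l (f x) (a x) := by
  unfold l; fun_prop

@[fun_prop]
theorem computable_γpow [ComputableMul F] [ComputableInv F] {w : X → ℕ → ℤ} (hf : Computable f)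
    (ha : Computable a) (hw : Computable fun p : X × ℕ => w p.1 p.2) :
    Computable fun x => γpow (f x) (a x) (w x) := by
  unfold γpow
  exact computable_prod_range ha (computable_pow (by fun_prop) hw)

end ComputableProjections

section Check

variable {F : Type*} [Field F]

/-- The lists have the right lengths, and all products start at `N + 1`. -/
def ShapeCheck (r : ℕ) (y : ListCert F) : Prop :=
  y.images.length = r ∧ y.products.length = y.s ∧ y.vLists.length = y.s ∧ y.vzList.length = r ∧
  (∀ i < r, (y.mList i).length = y.s) ∧ (∀ k < y.u, (y.nList k).length = r) ∧
  (∀ j < y.s, (y.vList j).length = r) ∧ (∀ j < y.s, y.l j = y.N + 1)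

/-- All entries that stand for units are nonzero, and all entries that stand for constants are
fixed by `σ`. -/
def EntryCheck (σ : F → F) (r : ℕ) (y : ListCert F) : Prop :=
  (∀ j < y.s, y.α j ≠ 0) ∧ (∀ i < r, y.γ i ≠ 0) ∧ (∀ k < y.u, y.g k ≠ 0) ∧
  (∀ j < y.s, σ (y.κ j) = y.κ j) ∧ y.ρ ≠ 0 ∧ σ y.ρ = y.ρ

/-- The equations in `F` that are required of a certificate. -/
def FieldCheck (σ : F → F) (αs : List F) (y : ListCert F) : Prop :=
  y.ρ ^ y.d = 1 ∧
  (∀ i < αs.length, σ (y.γ i) * ((∏ j ∈ Finset.range y.s, y.α j ^ y.m i j) * y.ρ ^ y.o i) =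
    αs.getD i 0 * y.γ i) ∧
  ∀ k < y.u, y.g k = y.γpow αs.length (y.n k)

/-- The relations form the basis that the program `bas` finds, and they satisfy the linear equations
and congruences that are required of a certificate. -/
def LinearCheck (bas : List F → List (List ℤ)) (αs : List F) (y : ListCert F) : Prop :=
  bas αs = y.relations.map Prod.fst ∧ y.s + y.u = αs.length ∧ 0 < y.d ∧
  (∀ i < αs.length, y.o i < y.d) ∧
  (∀ k < y.u, ∀ j < y.s, ∑ i ∈ Finset.range αs.length, y.n k i * y.m i j = 0) ∧
  (∀ k < y.u, (y.d : ℤ) ∣ ∑ i ∈ Finset.range αs.length, y.n k i * (y.o i : ℤ)) ∧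
  (∀ j < y.s, ∀ j' < y.s,
    ∑ i ∈ Finset.range αs.length, y.v j i * y.m i j' = if j' = j then 1 else 0) ∧
  (∀ j < y.s, (y.d : ℤ) ∣ ∑ i ∈ Finset.range αs.length, y.v j i * (y.o i : ℤ)) ∧
  (∀ j < y.s, ∑ i ∈ Finset.range αs.length, y.vz i * y.m i j = 0) ∧
  (y.d : ℤ) ∣ ∑ i ∈ Finset.range αs.length, y.vz i * (y.o i : ℤ) + -1

variable [Primcodable F]

/-- Within the bound on the number of steps, the programs `c₁` for an evaluation function and `c₂`
for an `o^σ`-function find the values at the point of evaluation that are required of a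
certificate. -/
def EvalCheck (c₁ c₂ : Code) (r : ℕ) (y : ListCert F) : Prop :=
  (∀ k < y.u, EvalnLE y.K c₂ [((y.g k)⁻¹, y.nList k)] y.N) ∧
  (∀ k < y.u, EvalnEq y.K c₁ ([((y.g k)⁻¹, y.nList k)], y.N) (1 : F)) ∧
  (∀ j < y.s, EvalnLE y.K c₂ [((y.γpow r (y.v j))⁻¹, y.vList j)] y.N) ∧
  (∀ j < y.s, EvalnEq y.K c₁ ([((y.γpow r (y.v j))⁻¹, y.vList j)], y.N) (y.κ j)) ∧
  (∀ j < y.s, EvalnLE y.K c₂ [(y.α j, ([] : List ℤ))] y.N) ∧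
  EvalnLE y.K c₂ [((y.γpow r y.vz)⁻¹, y.vzList)] y.N ∧
  EvalnEq y.K c₁ ([((y.γpow r y.vz)⁻¹, y.vzList)], y.N) (y.ρ ^ y.N) ∧
  EvalnLE y.K c₂ [(y.ρ, ([] : List ℤ))] y.N

/-- The computable test of certificates that the algorithm performs. -/
def Check (σ : F → F) (bas : List F → List (List ℤ)) (p : AlgInput F × ListCert F) : Prop :=
  ShapeCheck p.1.1.length p.2 ∧ EntryCheck σ p.1.1.length p.2 ∧ FieldCheck σ p.1.1 p.2 ∧
    LinearCheck bas p.1.1 p.2 ∧ EvalCheck p.1.2.1 p.1.2.2 p.1.1.length p.2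

theorem computablePred_shapeCheck :
    ComputablePred fun p : AlgInput F × ListCert F => ShapeCheck p.1.1.length p.2 := by
  unfold ShapeCheck
  repeat' first
    | apply computablePred_and
    | apply computablePred_eq
    | apply computablePred_ball
  all_goals fun_prop

theorem computablePred_entryCheck {σ : F → F} (hσ : Computable σ) :
    ComputablePred fun p : AlgInput F × ListCert F => EntryCheck σ p.1.1.length p.2 := by
  unfold EntryCheck
  repeat' first
    | apply computablePred_and
    | apply computablePred_eq
    | apply computablePred_ne
    | apply computablePred_ball
  all_goals fun_prop

theorem computablePred_fieldCheck [ComputableMul F] [ComputableInv F] {σ : F → F}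
    (hσ : Computable σ) :
    ComputablePred fun p : AlgInput F × ListCert F => FieldCheck σ p.1.1 p.2 := by
  unfold FieldCheck
  repeat' first
    | apply computablePred_and
    | apply computablePred_eq
    | apply computablePred_ball
  all_goals fun_prop

theorem computablePred_linearCheck {bas : List F → List (List ℤ)} (hbas : Computable bas) :
    ComputablePred fun p : AlgInput F × ListCert F => LinearCheck bas p.1.1 p.2 := by
  unfold LinearCheck
  repeat' first
    | apply computablePred_and
    | apply computablePred_eq
    | apply computablePred_lt
    | apply computablePred_dvd
    | apply computablePred_ball
  all_goals fun_prop

theorem computablePred_evalCheck [ComputableMul F] [ComputableInv F] :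
    ComputablePred fun p : AlgInput F × ListCert F =>
      EvalCheck p.1.2.1 p.1.2.2 p.1.1.length p.2 := by
  unfold EvalCheck
  repeat' first
    | apply computablePred_and
    | apply computablePred_evalnLE
    | apply computablePred_evalnEq
    | apply computablePred_ball
  all_goals fun_prop

theorem computablePred_check [ComputableMul F] [ComputableInv F] {σ : F → F} (hσ : Computable σ)
    {bas : List F → List (List ℤ)} (hbas : Computable bas) : ComputablePred (Check σ bas) :=
  computablePred_and computablePred_shapeCheck <|
    computablePred_and (computablePred_entryCheck hσ) <|
    computablePred_and (computablePred_fieldCheck hσ) <|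
    computablePred_and (computablePred_linearCheck hbas) computablePred_evalCheck

end Check

end ListCert

/-! ### Correctness of the test -/

section Lists

variable {A : Type*} {k : ℕ}

theorem ofFn_getD (l : List A) (x : A) (h : l.length = k) :
    (List.ofFn fun i : Fin k => l.getD i x) = l := by
  subst h
  exact List.ext_getElem (by simp) fun i h1 h2 => by simp

theorem getD_ofFn (f : Fin k → A) (x : A) (i : Fin k) : (List.ofFn f).getD i x = f i := by
  rw [List.getD_eq_getElem _ _ (by simp)]
  simp

theorem forall_lt_iff_forall_fin {P : ℕ → Prop} : (∀ i < k, P i) ↔ ∀ i : Fin k, P i :=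
  ⟨fun h i => h i i.isLt, fun h i hi => h ⟨i, hi⟩⟩

variable {F : Type*} [Field F]

theorem ofTerms_singleton (r : ℕ) (c : F) (w : List ℤ) :
    ofTerms F r [(c, w)] = algebraMap F _ c * mono (fun i : Fin r => w.getD i 0) 0 := by
  simp [ofTerms]

theorem ofTerms_ofFn {r : ℕ} (c : F) (w : Fin r → ℤ) :
    ofTerms F r [(c, List.ofFn w)] = algebraMap F _ c * mono w 0 := by
  simp only [ofTerms_singleton, getD_ofFn]

theorem ofTerms_nil (r : ℕ) (c : F) : ofTerms F r [(c, [])] = algebraMap F (PRing F r) c := by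
  rw [ofTerms_singleton]
  exact mul_one _

end Lists

namespace ListCert

section OfRepData

variable {F : Type*} [Field F] {r s u : ℕ}

/-- The certificate that consists of the data `D`, the initial values `κ` of the products, the
exponents `v` and `vz`, the point `N` of evaluation and the bound `K`. -/
def ofRepData (D : RepData F r s u) (κ : Fin s → F) (v : Fin s → Fin r → ℤ) (vz : Fin r → ℤ)
    (N K : ℕ) : ListCert F :=
  (D.toOutput κ fun _ => N + 1, List.ofFn fun j => List.ofFn (v j), List.ofFn vz, N, K)

variable (D : RepData F r s u) (κ : Fin s → F) (v : Fin s → Fin r → ℤ) (vz : Fin r → ℤ) (N K : ℕ)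

@[simp]
theorem d_ofRepData : (ofRepData D κ v vz N K).d = D.d := rfl

@[simp]
theorem ρ_ofRepData : (ofRepData D κ v vz N K).ρ = D.ρ := rfl

@[simp]
theorem N_ofRepData : (ofRepData D κ v vz N K).N = N := rfl

@[simp]
theorem K_ofRepData : (ofRepData D κ v vz N K).K = K := rfl

@[simp]
theorem s_ofRepData : (ofRepData D κ v vz N K).s = s := List.length_ofFn

@[simp]
theorem u_ofRepData : (ofRepData D κ v vz N K).u = u := List.length_ofFn

@[simp]
theorem α_ofRepData (j : Fin s) : (ofRepData D κ v vz N K).α j = D.α j := getD_ofFn _ _ j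

theorem images_getD_ofRepData (i : Fin r) :
    (ofRepData D κ v vz N K).images.getD i (0, 0, []) = (↑(D.γ i), D.o i, List.ofFn (D.m i)) :=
  getD_ofFn _ _ i

@[simp]
theorem γ_ofRepData (i : Fin r) : (ofRepData D κ v vz N K).γ i = D.γ i :=
  congrArg (·.1) (images_getD_ofRepData D κ v vz N K i)

@[simp]
theorem o_ofRepData (i : Fin r) : (ofRepData D κ v vz N K).o i = D.o i :=
  congrArg (·.2.1) (images_getD_ofRepData D κ v vz N K i)

@[simp]
theorem mList_ofRepData (i : Fin r) : (ofRepData D κ v vz N K).mList i = List.ofFn (D.m i) :=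
  congrArg (·.2.2) (images_getD_ofRepData D κ v vz N K i)

@[simp]
theorem m_ofRepData (i : Fin r) (j : Fin s) : (ofRepData D κ v vz N K).m i j = D.m i j := by
  rw [m, mList_ofRepData, getD_ofFn]

theorem relations_getD_ofRepData (k : Fin u) :
    (ofRepData D κ v vz N K).relations.getD k ([], 0) = (List.ofFn (D.n k), ↑(D.g k)) :=
  getD_ofFn _ _ k

@[simp]
theorem nList_ofRepData (k : Fin u) : (ofRepData D κ v vz N K).nList k = List.ofFn (D.n k) :=
  congrArg (·.1) (relations_getD_ofRepData D κ v vz N K k)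

@[simp]
theorem n_ofRepData (k : Fin u) (i : Fin r) : (ofRepData D κ v vz N K).n k i = D.n k i := by
  rw [n, nList_ofRepData, getD_ofFn]

@[simp]
theorem g_ofRepData (k : Fin u) : (ofRepData D κ v vz N K).g k = D.g k :=
  congrArg (·.2) (relations_getD_ofRepData D κ v vz N K k)

theorem products_getD_ofRepData (j : Fin s) :
    (ofRepData D κ v vz N K).products.getD j (0, 0) = (κ j, N + 1) :=
  getD_ofFn _ _ j

@[simp]
theorem κ_ofRepData (j : Fin s) : (ofRepData D κ v vz N K).κ j = κ j :=
  congrArg (·.1) (products_getD_ofRepData D κ v vz N K j)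

@[simp]
theorem l_ofRepData (j : Fin s) : (ofRepData D κ v vz N K).l j = N + 1 :=
  congrArg (·.2) (products_getD_ofRepData D κ v vz N K j)

@[simp]
theorem vList_ofRepData (j : Fin s) : (ofRepData D κ v vz N K).vList j = List.ofFn (v j) :=
  getD_ofFn _ _ j

@[simp]
theorem v_ofRepData (j : Fin s) (i : Fin r) : (ofRepData D κ v vz N K).v j i = v j i := by
  rw [ListCert.v, vList_ofRepData, getD_ofFn]

@[simp]
theorem vzList_ofRepData : (ofRepData D κ v vz N K).vzList = List.ofFn vz := rfl

@[simp]
theorem vz_ofRepData (i : Fin r) : (ofRepData D κ v vz N K).vz i = vz i := getD_ofFn _ _ i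

@[simp]
theorem γpow_ofRepData (w : ℕ → ℤ) :
    (ofRepData D κ v vz N K).γpow r w = (zpowProd D.γ fun i => w i : Fˣ) := by
  simp only [γpow, Finset.prod_range, γ_ofRepData, val_zpowProd]

theorem map_fst_relations_ofRepData :
    (ofRepData D κ v vz N K).relations.map Prod.fst = List.ofFn fun k => List.ofFn (D.n k) :=
  List.map_ofFn

theorem shapeCheck_ofRepData : ShapeCheck r (ofRepData D κ v vz N K) := by
  simp only [ShapeCheck, s_ofRepData, u_ofRepData, N_ofRepData, forall_lt_iff_forall_fin,
    mList_ofRepData, nList_ofRepData, vList_ofRepData, l_ofRepData, List.length_ofFn, implies_true,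
    and_true]
  exact ⟨List.length_ofFn, List.length_ofFn, List.length_ofFn, List.length_ofFn⟩

theorem entryCheck_ofRepData_iff {σ : F → F} :
    EntryCheck σ r (ofRepData D κ v vz N K) ↔
      (∀ j, σ (κ j) = κ j) ∧ D.ρ ≠ 0 ∧ σ D.ρ = D.ρ := by
  simp [EntryCheck, forall_lt_iff_forall_fin]

theorem fieldCheck_ofRepData_iff {σ : F → F} (α : Fin r → F) :
    FieldCheck σ (List.ofFn α) (ofRepData D κ v vz N K) ↔ D.ρ ^ D.d = 1 ∧
      (∀ i, σ (D.γ i) * ((∏ j, (D.α j : F) ^ D.m i j) * D.ρ ^ D.o i) = α i * D.γ i) ∧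
      ∀ k, D.g k = zpowProd D.γ (D.n k) := by
  simp only [FieldCheck, List.length_ofFn, s_ofRepData, u_ofRepData, forall_lt_iff_forall_fin,
    Finset.prod_range, getD_ofFn, ρ_ofRepData, d_ofRepData, γ_ofRepData, α_ofRepData, m_ofRepData,
    o_ofRepData, g_ofRepData, γpow_ofRepData, n_ofRepData, Units.val_inj]

theorem linearCheck_ofRepData_iff {bas : List F → List (List ℤ)} (α : Fin r → F) :
    LinearCheck bas (List.ofFn α) (ofRepData D κ v vz N K) ↔
      bas (List.ofFn α) = (List.ofFn fun k => List.ofFn (D.n k)) ∧ s + u = r ∧ 0 < D.d ∧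
      (∀ i, D.o i < D.d) ∧ (∀ k, D.xExp (D.n k) = 0) ∧ (∀ k, (D.d : ℤ) ∣ D.zExp (D.n k)) ∧
      (∀ j, D.xExp (v j) = Pi.single j 1) ∧ (∀ j, (D.d : ℤ) ∣ D.zExp (v j)) ∧ D.xExp vz = 0 ∧
      (D.d : ℤ) ∣ D.zExp vz - 1 := by
  simp only [LinearCheck, List.length_ofFn, s_ofRepData, u_ofRepData, forall_lt_iff_forall_fin,
    Finset.sum_range, map_fst_relations_ofRepData, d_ofRepData, m_ofRepData, o_ofRepData,
    n_ofRepData, v_ofRepData, vz_ofRepData, funext_iff, RepData.xExp_apply, RepData.zExp_apply,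
    Matrix.vecMul, dotProduct, Matrix.of_apply, Pi.single_apply, Pi.zero_apply, Fin.val_inj,
    sub_eq_add_neg]

theorem exists_eq_ofRepData {σ : RingAut F} {y : ListCert F} (hshape : ShapeCheck r y)
    (hentry : EntryCheck σ r y) :
    ∃ (s u : ℕ) (D : RepData F r s u) (κ : Fin s → constField σ) (v : Fin s → Fin r → ℤ)
      (vz : Fin r → ℤ) (N K : ℕ), y = ofRepData D (fun j => κ j) v vz N K := by
  obtain ⟨himages, hproducts, hvLists, hvzList, hmList, hnList, hvList, hl⟩ := hshape
  obtain ⟨hα, hγ, hg, hκ, -, -⟩ := hentry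
  let D : RepData F r y.s y.u :=
    { d := y.d
      α := fun j => Units.mk0 (y.α j) (hα j j.isLt)
      ρ := y.ρ
      γ := fun i => Units.mk0 (y.γ i) (hγ i i.isLt)
      o := fun i => y.o i
      m := fun i j => y.m i j
      n := fun k i => y.n k i
      g := fun k => Units.mk0 (y.g k) (hg k k.isLt) }
  have halpha : y.αList = List.ofFn fun j => (D.α j : F) := (ofFn_getD _ _ rfl).symm
  have himages' : y.images = List.ofFn fun i => ((D.γ i : F), D.o i, List.ofFn (D.m i)) := by
    rw [← ofFn_getD y.images (0, 0, []) himages]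
    exact congrArg List.ofFn <| funext fun i =>
      congrArg (fun w => (y.γ i, y.o i, w)) (ofFn_getD _ 0 (hmList i i.isLt)).symm
  have hrelations : y.relations = List.ofFn fun k => (List.ofFn (D.n k), (D.g k : F)) := by
    rw [← ofFn_getD y.relations ([], 0) rfl]
    exact congrArg List.ofFn <| funext fun k =>
      congrArg (fun w => (w, y.g k)) (ofFn_getD _ 0 (hnList k k.isLt)).symm
  have hproducts' : y.products = List.ofFn fun j : Fin y.s => (y.κ j, y.N + 1) := by
    rw [← ofFn_getD y.products (0, 0) hproducts]
    exact congrArg List.ofFn <| funext fun j => congrArg (fun w => (y.κ j, w)) (hl j j.isLt)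
  have hvLists' : y.vLists = List.ofFn fun j : Fin y.s => List.ofFn fun i : Fin r => y.v j i := by
    rw [← ofFn_getD y.vLists [] hvLists]
    exact congrArg List.ofFn <| funext fun j => (ofFn_getD _ 0 (hvList j j.isLt)).symm
  have hvzList' : y.vzList = List.ofFn fun i : Fin r => y.vz i := (ofFn_getD _ _ hvzList).symm
  refine ⟨y.s, y.u, D, fun j => ⟨y.κ j, hκ j j.isLt⟩, fun j i => y.v j i, fun i => y.vz i, y.N,
    y.K, ?_⟩
  rw [ofRepData, RepData.toOutput, ← halpha, ← himages', ← hrelations, ← hproducts', ← hvLists',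
    ← hvzList']
  rfl

end OfRepData

section Correctness

variable {F : Type*} [Field F] {σ : RingAut F} {r s u : ℕ} {α : Fin r → Fˣ} {D : RepData F r s u}
  {κ : Fin s → constField σ} {v : Fin s → Fin r → ℤ} {vz : Fin r → ℤ} {N K : ℕ}
  {ρ : (constField σ)ˣ}

theorem rowsAreBasis_of_ofFn_eq {V : Submodule ℤ (Fin r → ℤ)} {n : Fin u → Fin r → ℤ} {u' : ℕ}
    {Z : Matrix (Fin u') (Fin r) ℤ} (hZ : RowsAreBasis V Z)
    (h : (List.ofFn fun k => List.ofFn (Z k)) = List.ofFn fun k => List.ofFn (n k)) :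
    RowsAreBasis V (Matrix.of n) := by
  obtain rfl : u' = u := by simpa using congrArg List.length h
  have hn : Z = Matrix.of n :=
    funext fun k => List.ofFn_injective (congrFun (List.ofFn_injective h) k)
  exact hn ▸ hZ

theorem isAlgCert_of_check {bas : List F → List (List ℤ)}
    (hbas : ∃ (u : ℕ) (Z : Matrix (Fin u) (Fin r) ℤ), RowsAreBasis (multRel σ α) Z ∧
      bas (List.ofFn fun i => (α i : F)) = List.ofFn fun i => List.ofFn (Z i))
    (hρ : ((ρ : constField σ) : F) = D.ρ)
    (hfield : FieldCheck σ (List.ofFn fun i => (α i : F)) (ofRepData D (fun j => κ j) v vz N K))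
    (hlinear : LinearCheck bas (List.ofFn fun i => (α i : F))
      (ofRepData D (fun j => κ j) v vz N K)) :
    IsAlgCert σ α D ρ v vz := by
  obtain ⟨hρd, compat, hg⟩ := (fieldCheck_ofRepData_iff ..).mp hfield
  obtain ⟨hn, -, d_pos, o_lt, x_n, z_n, x_v, z_v, x_vz, z_vz⟩ :=
    (linearCheck_ofRepData_iff ..).mp hlinear
  obtain ⟨u', Z, hZ, hbas⟩ := hbas
  exact
    { basis := rowsAreBasis_of_ofFn_eq hZ (hbas.symm.trans hn)
      rho_pow := Units.ext <| Subtype.ext <| by simpa [hρ] using hρd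
      d_pos, o_lt, rho := hρ, compat, x_n, z_n, x_v, z_v, x_vz, z_vz, g_eq := hg }

theorem fieldCheck_of_isAlgCert (h : IsAlgCert σ α D ρ v vz) (κ : Fin s → F) (N K : ℕ) :
    FieldCheck σ (List.ofFn fun i => (α i : F)) (ofRepData D κ v vz N K) := by
  refine (fieldCheck_ofRepData_iff ..).mpr ⟨?_, h.compat, h.g_eq⟩
  rw [← h.rho]
  simpa using congrArg (fun x : (constField σ)ˣ => ((x : constField σ) : F)) h.rho_pow

theorem linearCheck_of_isAlgCert {bas : List F → List (List ℤ)} (h : IsAlgCert σ α D ρ v vz)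
    (hsu : s + u = r)
    (hbas : bas (List.ofFn fun i => (α i : F)) = List.ofFn fun i => List.ofFn (D.n i))
    (κ : Fin s → F) (N K : ℕ) :
    LinearCheck bas (List.ofFn fun i => (α i : F)) (ofRepData D κ v vz N K) :=
  (linearCheck_ofRepData_iff ..).mpr
    ⟨hbas, hsu, h.d_pos, h.o_lt, h.x_n, h.z_n, h.x_v, h.z_v, h.x_vz, h.z_vz⟩

variable [Primcodable F] {evE : PRing F r → ℕ → constField σ} {LE : PRing F r → ℕ} {c₁ c₂ : Code}

theorem evalCheck_ofRepData_iff {κ : Fin s → F} :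
    EvalCheck c₁ c₂ r (ofRepData D κ v vz N K) ↔
      (∀ k, EvalnLE K c₂ [(((D.g k : F))⁻¹, List.ofFn (D.n k))] N) ∧
      (∀ k, EvalnEq K c₁ ([((D.g k : F)⁻¹, List.ofFn (D.n k))], N) (1 : F)) ∧
      (∀ j, EvalnLE K c₂ [(((zpowProd D.γ (v j) : Fˣ) : F)⁻¹, List.ofFn (v j))] N) ∧
      (∀ j, EvalnEq K c₁ ([(((zpowProd D.γ (v j) : Fˣ) : F)⁻¹, List.ofFn (v j))], N) (κ j)) ∧
      (∀ j, EvalnLE K c₂ [((D.α j : F), ([] : List ℤ))] N) ∧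
      EvalnLE K c₂ [(((zpowProd D.γ vz : Fˣ) : F)⁻¹, List.ofFn vz)] N ∧
      EvalnEq K c₁ ([(((zpowProd D.γ vz : Fˣ) : F)⁻¹, List.ofFn vz)], N) (D.ρ ^ N) ∧
      EvalnLE K c₂ [(D.ρ, ([] : List ℤ))] N := by
  simp only [EvalCheck, s_ofRepData, u_ofRepData, forall_lt_iff_forall_fin, N_ofRepData,
    K_ofRepData, g_ofRepData, nList_ofRepData, γpow_ofRepData, v_ofRepData, vList_ofRepData,
    κ_ofRepData, α_ofRepData, vz_ofRepData, vzList_ofRepData, ρ_ofRepData]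

section Programs

variable (hc : ComputesEval σ evE LE c₁ c₂) (c : F) (w : Fin r → ℤ) {x : constField σ}
include hc

theorem le_of_evalnLE (h : EvalnLE K c₂ [(c, List.ofFn w)] N) :
    LE (algebraMap F _ c * mono w 0) ≤ N :=
  ofTerms_ofFn c w ▸ h.le hc.2

theorem le_of_evalnLE_nil (h : EvalnLE K c₂ [(c, ([] : List ℤ))] N) : LE (algebraMap F _ c) ≤ N :=
  ofTerms_nil r c ▸ h.le hc.2

theorem eq_of_evalnEq (h : EvalnEq K c₁ ([(c, List.ofFn w)], N) (x : F)) :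
    evE (algebraMap F _ c * mono w 0) N = x :=
  Subtype.ext (ofTerms_ofFn c w ▸ h.eq hc.1)

theorem eventually_evalnLE (h : LE (algebraMap F _ c * mono w 0) ≤ N) :
    ∀ᶠ K in atTop, EvalnLE K c₂ [(c, List.ofFn w)] N :=
  hc.2.eventually_evalnLE (by rwa [ofTerms_ofFn])

theorem eventually_evalnLE_nil (h : LE (algebraMap F _ c) ≤ N) :
    ∀ᶠ K in atTop, EvalnLE K c₂ [(c, ([] : List ℤ))] N :=
  hc.2.eventually_evalnLE (by rwa [ofTerms_nil])

theorem eventually_evalnEq (h : evE (algebraMap F _ c * mono w 0) N = x) :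
    ∀ᶠ K in atTop, EvalnEq K c₁ ([(c, List.ofFn w)], N) (x : F) := by
  simpa only [ofTerms_ofFn, h] using hc.1.eventually_evalnEq ([(c, List.ofFn w)], N)

end Programs

theorem isEvalCert_of_evalCheck (hc : ComputesEval σ evE LE c₁ c₂)
    (hρ : ((ρ : constField σ) : F) = D.ρ)
    (h : EvalCheck c₁ c₂ r (ofRepData D (fun j => κ j) v vz N K)) :
    IsEvalCert evE LE D ρ v vz κ N := by
  obtain ⟨hLn, hn, hLv, hv, hα, hLvz, hvz, hLρ⟩ := evalCheck_ofRepData_iff.mp h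
  rw [← hρ] at hvz
  exact
    { bound_n := fun k => le_of_evalnLE hc _ _ (hLn k)
      eval_n := fun k => eq_of_evalnEq hc _ _ (hn k)
      bound_v := fun j => le_of_evalnLE hc _ _ (hLv j)
      eval_v := fun j => eq_of_evalnEq hc _ _ (hv j)
      bound_α := fun j => le_of_evalnLE_nil hc _ (hα j)
      bound_vz := le_of_evalnLE hc _ _ hLvz
      eval_vz := eq_of_evalnEq hc _ _ hvz
      bound_ρ := le_of_evalnLE_nil hc _ hLρ }

theorem eventually_evalCheck (hc : ComputesEval σ evE LE c₁ c₂)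
    (hρ : ((ρ : constField σ) : F) = D.ρ) (h : IsEvalCert evE LE D ρ v vz κ N) :
    ∀ᶠ K in atTop, EvalCheck c₁ c₂ r (ofRepData D (fun j => κ j) v vz N K) := by
  simp only [evalCheck_ofRepData_iff, ← hρ, eventually_and, eventually_all]
  exact
    ⟨fun k => eventually_evalnLE hc _ _ (h.bound_n k),
      fun k => eventually_evalnEq hc _ _ (h.eval_n k),
      fun j => eventually_evalnLE hc _ _ (h.bound_v j),
      fun j => eventually_evalnEq hc _ _ (h.eval_v j),
      fun j => eventually_evalnLE_nil hc _ (h.bound_α j), eventually_evalnLE hc _ _ h.bound_vz,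
      eventually_evalnEq hc _ _ h.eval_vz, eventually_evalnLE_nil hc _ (hρ ▸ h.bound_ρ)⟩

theorem Check.exists_isCert {bas : List F → List (List ℤ)}
    (hbas : ∃ (u : ℕ) (Z : Matrix (Fin u) (Fin r) ℤ), RowsAreBasis (multRel σ α) Z ∧
      bas (List.ofFn fun i => (α i : F)) = List.ofFn fun i => List.ofFn (Z i))
    (hc : ComputesEval σ evE LE c₁ c₂) {y : ListCert F}
    (h : Check σ bas ((List.ofFn fun i => (α i : F), c₁, c₂), y)) :
    ∃ (s u : ℕ) (D : RepData F r s u) (ρ : (constField σ)ˣ) (v : Fin s → Fin r → ℤ)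
      (vz : Fin r → ℤ) (κ : Fin s → constField σ) (N : ℕ), s + u = r ∧ IsAlgCert σ α D ρ v vz ∧
        IsEvalCert evE LE D ρ v vz κ N ∧ y.1 = D.toOutput (fun j => κ j) fun _ => N + 1 := by
  simp only [Check, List.length_ofFn] at h
  obtain ⟨hshape, hentry, hfield, hlinear, heval⟩ := h
  obtain ⟨s, u, D, κ, v, vz, N, K, rfl⟩ := exists_eq_ofRepData hshape hentry
  obtain ⟨-, hρ, hσρ⟩ := (entryCheck_ofRepData_iff ..).mp hentry
  let ρ : (constField σ)ˣ := Units.mk0 ⟨D.ρ, hσρ⟩ (Subtype.coe_ne_coe.mp hρ)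
  exact ⟨s, u, D, ρ, v, vz, κ, N, ((linearCheck_ofRepData_iff ..).mp hlinear).2.1,
    isAlgCert_of_check hbas rfl hfield hlinear, isEvalCert_of_evalCheck hc rfl heval, rfl⟩

theorem exists_check {bas : List F → List (List ℤ)} (hc : ComputesEval σ evE LE c₁ c₂)
    (hsu : s + u = r) (hA : IsAlgCert σ α D ρ v vz) (hE : IsEvalCert evE LE D ρ v vz κ N)
    (hbas : bas (List.ofFn fun i => (α i : F)) = List.ofFn fun i => List.ofFn (D.n i)) :
    ∃ y, Check σ bas ((List.ofFn fun i => (α i : F), c₁, c₂), y) := by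
  obtain ⟨K, hK⟩ := (eventually_evalCheck hc hA.rho hE).exists
  have hσρ : σ D.ρ = D.ρ := hA.rho ▸ (ρ : constField σ).2
  have hρ : D.ρ ≠ 0 := hA.rho ▸ Subtype.coe_ne_coe.mpr ρ.ne_zero
  refine ⟨ofRepData D (fun j => κ j) v vz N K, ?_⟩
  simp only [Check, List.length_ofFn]
  exact ⟨shapeCheck_ofRepData .., (entryCheck_ofRepData_iff ..).mpr ⟨fun j => (κ j).2, hρ, hσρ⟩,
    fieldCheck_of_isAlgCert hA .., linearCheck_of_isAlgCert hA hsu hbas .., hK⟩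

end Correctness

end ListCert

theorem exists_algorithm {F : Type*} [Field F] [Primcodable F] {σ : RingAut F}
    {τ₀ : F →+* SeqRing (constField σ)} (hτ₀ : IsKHom σ σ τ₀)
    {ev : F → ℕ → constField σ} {L Z : F → ℕ} (hF : IsAlgorithmic σ τ₀ ev L Z) :
    ∃ alg : AlgInput F →. AlgOutput F, Partrec alg ∧
      ∀ (r : ℕ) (α : Fin r → Fˣ) (σE : RingAut (PRing F r))
        (τE : PRing F r →+* SeqRing (constField σ)) (evE : PRing F r → ℕ → constField σ)
        (LE : PRing F r → ℕ) (c₁ c₂ : Code),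
        IsPExtension σ α σE → IsKHom σ σE τE → IsEvalFun σ σE evE → Represents evE τE →
        (∀ (f : F) (n : ℕ), evE (algebraMap F _ f) n = ev f n) →
        IsOSigmaFun σE evE LE → ComputesEval σ evE LE c₁ c₂ → multRel σ α ≠ ⊥ →
        ∃ (s u : ℕ) (D : RepData F r s u) (σH : RingAut (HRing F s D.d))
          (τH : HRing F s D.d →+* SeqRing (constField σ)) (lam : PRing F r →+* HRing F s D.d)
          (κ : Fin s → constField σ) (l : Fin s → ℕ),
          Module.finrank ℤ (multRel σ α) = u ∧ s + u = r ∧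
          IsLargestDivisor (multRel σ α) D.d ∧ IsOptimalRep σ τ₀ σE τE D σH τH lam ∧
          HasProductEval σ ev D σH τH κ l ∧
          D.toOutput (fun i => (κ i : F)) l ∈ alg (List.ofFn (fun i => (α i : F)), c₁, c₂) := by
  obtain ⟨bas, hbas, hbas'⟩ := hF.basis
  have : ComputableMul F := ⟨hF.mul⟩
  have : ComputableInv F := ⟨hF.inv⟩
  obtain ⟨alg, halg, hsearch⟩ := exists_search (ListCert.computablePred_check hF.aut hbas)
    (Computable.fst (α := AlgOutput F))
  refine ⟨alg, halg, fun r α σE τE evE LE c₁ c₂ hE hτE hev hrep hevE hL hc hV => ?_⟩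
  have hbase (f : F) : τE (algebraMap F _ f) = τ₀ f := by
    rw [hrep, hF.represents, funext (hevE f)]
  have hcheck : ∃ y, ListCert.Check σ bas ((List.ofFn fun i => (α i : F), c₁, c₂), y) := by
    obtain ⟨d, hd⟩ := exists_isLargestDivisor hV
    obtain ⟨u, n, hn, hbn⟩ := hbas' r α
    obtain ⟨s, rfl⟩ := Nat.exists_eq_add_of_le hn.le
    obtain ⟨D, rfl, -, ρ, v, vz, hD⟩ := exists_isCert hF.radicalStable hτ₀ hE hτE hbase hd hn
    obtain ⟨κ, N, hκ⟩ := hD.exists_isEvalCert hbase hrep LE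
    exact ListCert.exists_check hc (Nat.add_comm _ _) hD.toIsAlgCert hκ hbn
  obtain ⟨y, hy, hmem⟩ := hsearch _ hcheck
  obtain ⟨s, u, D, ρ, v, vz, κ, N, hsu, hA, hD, hout⟩ := hy.exists_isCert (hbas' r α) hc
  obtain ⟨σH, τH, lam, hd, hopt, hprod⟩ :=
    hD.exists_optimalRep hA hF.radicalStable hτ₀ hF.represents hE hτE hev hL hrep hevE hV
  exact ⟨s, u, D, σH, τH, lam, κ, _, hA.basis.finrank_eq, hsu, hd, hopt, hprod, hout ▸ hmem⟩

end DiffRing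

end

theorem mainTheorem1_general {F : Type*} [Field F] (σ : RingAut F)
    (hσ : DiffRing.RadicalStable σ)
    (τ₀ : F →+* DiffRing.SeqRing (DiffRing.constField σ))
    (hτ₀ : DiffRing.IsKHom σ σ τ₀) :
    (∀ (r : ℕ) (α : Fin r → Fˣ) (σE : RingAut (DiffRing.PRing F r))
        (τE : DiffRing.PRing F r →+* DiffRing.SeqRing (DiffRing.constField σ)),
      DiffRing.IsPExtension σ α σE →
      DiffRing.IsKHom σ σE τE →
      (∀ f : F, τE (algebraMap F _ f) = τ₀ f) →
      ∀ (u d : ℕ), Module.finrank ℤ (DiffRing.multRel σ α) = u →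
        DiffRing.IsLargestDivisor (DiffRing.multRel σ α) d →
        ∃ (s : ℕ) (D : DiffRing.RepData F r s u) (σH : RingAut (DiffRing.HRing F s D.d))
          (τH : DiffRing.HRing F s D.d →+* DiffRing.SeqRing (DiffRing.constField σ))
          (lam : DiffRing.PRing F r →+* DiffRing.HRing F s D.d),
          s + u = r ∧ D.d = d ∧
          DiffRing.IsOptimalRep σ τ₀ σE τE D σH τH lam ∧
          ∀ ev : F → ℕ → DiffRing.constField σ,
            DiffRing.Represents ev τ₀ →
            ∃ (κ : Fin s → DiffRing.constField σ) (l : Fin s → ℕ),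
              DiffRing.HasProductEval σ ev D σH τH κ l) ∧
    (∀ [Primcodable F] (ev : F → ℕ → DiffRing.constField σ) (L Z : F → ℕ),
      DiffRing.IsAlgorithmic σ τ₀ ev L Z →
      ∃ alg : DiffRing.AlgInput F →. DiffRing.AlgOutput F, Partrec alg ∧
        ∀ (r : ℕ) (α : Fin r → Fˣ) (σE : RingAut (DiffRing.PRing F r))
          (τE : DiffRing.PRing F r →+* DiffRing.SeqRing (DiffRing.constField σ))
          (evE : DiffRing.PRing F r → ℕ → DiffRing.constField σ) (LE : DiffRing.PRing F r → ℕ)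
          (c₁ c₂ : Nat.Partrec.Code),
          DiffRing.IsPExtension σ α σE →
          DiffRing.IsKHom σ σE τE →
          DiffRing.IsEvalFun σ σE evE → DiffRing.Represents evE τE →
          (∀ (f : F) (n : ℕ), evE (algebraMap F _ f) n = ev f n) →
          DiffRing.IsOSigmaFun σE evE LE → DiffRing.ComputesEval σ evE LE c₁ c₂ →
          DiffRing.multRel σ α ≠ ⊥ →
          ∃ (s u : ℕ) (D : DiffRing.RepData F r s u) (σH : RingAut (DiffRing.HRing F s D.d))
            (τH : DiffRing.HRing F s D.d →+* DiffRing.SeqRing (DiffRing.constField σ))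
            (lam : DiffRing.PRing F r →+* DiffRing.HRing F s D.d)
            (κ : Fin s → DiffRing.constField σ) (l : Fin s → ℕ),
            Module.finrank ℤ (DiffRing.multRel σ α) = u ∧ s + u = r ∧
            DiffRing.IsLargestDivisor (DiffRing.multRel σ α) D.d ∧
            DiffRing.IsOptimalRep σ τ₀ σE τE D σH τH lam ∧
            DiffRing.HasProductEval σ ev D σH τH κ l ∧
            D.toOutput (fun i => (κ i : F)) l ∈
              alg (List.ofFn (fun i => (α i : F)), c₁, c₂)) :=
  ⟨fun _ _ _ _ hE hτE hbase _ _ hu hd => DiffRing.exists_optimalRep hσ hτ₀ hE hτE hbase hu hd,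
    fun _ _ _ hF => DiffRing.exists_algorithm hτ₀ hF⟩

theorem mainTheorem1 {F : Type*} [Field F] [CharZero F] (σ : RingAut F)
    (hσ : DiffRing.RadicalStable σ)
    (τ₀ : F →+* DiffRing.SeqRing (DiffRing.constField σ))
    (hτ₀ : DiffRing.IsKEmbedding σ σ τ₀) :
    (∀ (r : ℕ) (α : Fin r → Fˣ) (σE : RingAut (DiffRing.PRing F r))
        (τE : DiffRing.PRing F r →+* DiffRing.SeqRing (DiffRing.constField σ)),
      DiffRing.IsPExtension σ α σE →
      DiffRing.IsKHom σ σE τE →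
      (∀ f : F, τE (algebraMap F _ f) = τ₀ f) →
      DiffRing.multRel σ α ≠ ⊥ →
      ∀ (u d : ℕ), Module.finrank ℤ (DiffRing.multRel σ α) = u →
        DiffRing.IsLargestDivisor (DiffRing.multRel σ α) d →
        ∃ (s : ℕ) (D : DiffRing.RepData F r s u) (σH : RingAut (DiffRing.HRing F s D.d))
          (τH : DiffRing.HRing F s D.d →+* DiffRing.SeqRing (DiffRing.constField σ))
          (lam : DiffRing.PRing F r →+* DiffRing.HRing F s D.d),
          s + u = r ∧ D.d = d ∧
          DiffRing.IsOptimalRep σ τ₀ σE τE D σH τH lam ∧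
          ∀ ev : F → ℕ → DiffRing.constField σ,
            DiffRing.IsEvalFun σ σ ev → DiffRing.Represents ev τ₀ →
            ∃ (κ : Fin s → DiffRing.constField σ) (l : Fin s → ℕ),
              DiffRing.HasProductEval σ ev D σH τH κ l) ∧
    (∀ [Primcodable F] (ev : F → ℕ → DiffRing.constField σ) (L Z : F → ℕ),
      DiffRing.IsAlgorithmic σ τ₀ ev L Z →
      ∃ alg : DiffRing.AlgInput F →. DiffRing.AlgOutput F, Partrec alg ∧
        ∀ (r : ℕ) (α : Fin r → Fˣ) (σE : RingAut (DiffRing.PRing F r))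
          (τE : DiffRing.PRing F r →+* DiffRing.SeqRing (DiffRing.constField σ))
          (evE : DiffRing.PRing F r → ℕ → DiffRing.constField σ) (LE : DiffRing.PRing F r → ℕ)
          (c₁ c₂ : Nat.Partrec.Code),
          DiffRing.IsPExtension σ α σE →
          DiffRing.IsKHom σ σE τE →
          DiffRing.IsEvalFun σ σE evE → DiffRing.Represents evE τE →
          (∀ (f : F) (n : ℕ), evE (algebraMap F _ f) n = ev f n) →
          DiffRing.IsOSigmaFun σE evE LE → DiffRing.ComputesEval σ evE LE c₁ c₂ →
          DiffRing.multRel σ α ≠ ⊥ →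
          ∃ (s u : ℕ) (D : DiffRing.RepData F r s u) (σH : RingAut (DiffRing.HRing F s D.d))
            (τH : DiffRing.HRing F s D.d →+* DiffRing.SeqRing (DiffRing.constField σ))
            (lam : DiffRing.PRing F r →+* DiffRing.HRing F s D.d)
            (κ : Fin s → DiffRing.constField σ) (l : Fin s → ℕ),
            Module.finrank ℤ (DiffRing.multRel σ α) = u ∧ s + u = r ∧
            DiffRing.IsLargestDivisor (DiffRing.multRel σ α) D.d ∧
            DiffRing.IsOptimalRep σ τ₀ σE τE D σH τH lam ∧
            DiffRing.HasProductEval σ ev D σH τH κ l ∧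
            D.toOutput (fun i => (κ i : F)) l ∈
              alg (List.ofFn (fun i => (α i : F)), c₁, c₂)) := by
  obtain ⟨hrep, halg⟩ := mainTheorem1_general σ hσ τ₀ hτ₀.toIsKHom
  refine ⟨fun r α σE τE hE hτE hbase _ u d hu hd => ?_, halg⟩
  obtain ⟨s, D, σH, τH, lam, hs, hD, hopt, hev⟩ := hrep r α σE τE hE hτE hbase u d hu hd
  exact ⟨s, D, σH, τH, lam, hs, hD, hopt, fun ev _ => hev ev⟩
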